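/- Let $d\ge 3$, $p=1+\frac4d$, $\gamma>0$ and $|\omega|<1$. Let $H^1_{\mathrm{rad}}(\mathbb{R}^d)$ be the space of radial complex-valued functions in $H^1(\mathbb{R}^d)$, regarded as a real Hilbert space, and put $$\|(-\Delta_\gamma)^{1/2}f\|_{L^2}^2:=\|\nabla f\|_{L^2}^2+\int_{\mathbb{R}^d}\frac{\gamma}{|x|^2}|f(x)|^2\,dx,$$ $$S_{\omega,\gamma}(f):=\frac{1-\omega^2}{2}\|f\|_{L^2}^2+\frac12\|(-\Delta_\gamma)^{1/2}f\|_{L^2}^2-\frac1{p+1}\|f\|_{L^{p+1}}^{p+1},\qquad K^{d,2}_{\omega,\gamma}(f):=\frac{d}{d\lambda}\Big|_{\lambda=0}S_{\omega,\gamma}\big(e^{d\lambda}f(e^{2\lambda}\,\cdot\,)\big).$$ Let $$\mathcal{A}_{\omega,\gamma,\mathrm{rad}}:=\{\phi\in H^1_{\mathrm{rad}}\setminus\{0\}: S_{\omega,\gamma}'(\phi)=0\},$$ $$\mathcal{G}_{\omega,\gamma,\mathrm{rad}}:=\{\phi\in\mathcal{A}_{\omega,\gamma,\mathrm{rad}}: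 S_{\omega,\gamma}(\phi)\le S_{\omega,\gamma}(\psi)\text{ for all }\psi\in\mathcal{A}_{\omega,\gamma,\mathrm{rad}}\},$$ where $S_{\omega,\gamma}'(\phi)$ is the derivative of $S_{\omega,\gamma}$ on $H^1(\mathbb{R}^d)$ at $\phi$, and let $$r^{d,2}_{\omega,\gamma}:=\inf\{S_{\omega,\gamma}(\phi):\phi\in H^1_{\mathrm{rad}}\setminus\{0\},\ K^{d,2}_{\omega,\gamma}(\phi)=0\},$$ $$\mathcal{M}^{d,2}_{\omega,\gamma,\mathrm{rad}}:=\{\phi\in H^1_{\mathrm{rad}}\setminus\{0\}: S_{\omega,\gamma}(\phi)=r^{d,2}_{\omega,\gamma},\ K^{d,2}_{\omega,\gamma}(\phi)=0\}.$$ Then the following hold. 1. $\mathcal{G}_{\omega,\gamma,\mathrm{rad}}\neq\emptyset$ and $\mathcal{G}_{\omega,\gamma,\mathrm{rad}}\subset\mathcal{M}^{d,2}_{\omega,\gamma,\mathrm{rad}}$; in particular the infimum defining $r^{d,2}_{\omega,\gamma}$ is attained. 2. Let $C_{\mathrm{rad}}(\gamma)$ be the best constant in the Gagliardo--Nirenberg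 inequality $$\|f\|_{L^{p+1}}^{p+1}\le C\,\|f\|_{L^2}^{4/d}\,\|(-\Delta_\gamma)^{1/2}f\|_{L^2}^{2},\qquad f\in H^1_{\mathrm{rad}}(\mathbb{R}^d).$$ Then $C_{\mathrm{rad}}(\gamma)$ is a well-defined number in $(0,\infty)$, and $$r^{d,2}_{\omega,\gamma}=\frac{1-\omega^2}{2}\left\{\frac{d+2}{d\,C_{\mathrm{rad}}(\gamma)}\right\}^{d/2}.$$ 3. There is $\psi\in\mathcal{M}^{d,2}_{\omega,\gamma,\mathrm{rad}}$ with $\|\psi\|_{L^{p+1}}=1$, and every such $\psi$ is a rescaled critical point of $S_{\omega,\gamma}$, in fact a rescaled radial ground state: with $\nu>0$ given by $\nu^2=\frac{1}{(d+2)\,r^{d,2}_{\omega,\gamma}}$, there is $Q\in\mathcal{G}_{\omega,\gamma,\mathrm{rad}}$ such that $\psi(x)=\nu^{d/2}Q(\nu x)$. -/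

import Mathlib

open MeasureTheory

noncomputable section

namespace NLKG

/-- The Euclidean space `ℝ^d`. -/
abbrev Space (d : ℕ) : Type := EuclideanSpace ℝ (Fin d)

/-- `g` is the weak (distributional) gradient of `u : ℝ^d → ℂ`. Real-valued test functions suffice,
since the identity is linear in the test function. -/
def IsWeakGradient {d : ℕ} (u : Space d → ℂ) (g : Space d → EuclideanSpace ℂ (Fin d)) : Prop :=
  LocallyIntegrable u volume ∧ LocallyIntegrable g volume ∧
    ∀ φ : Space d → ℝ, ContDiff ℝ ((⊤ : ℕ∞) : WithTop ℕ∞) φ → HasCompactSupport φ → ∀ i : Fin d,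
      ∫ x, fderiv ℝ φ x (EuclideanSpace.single i 1) • u x = - ∫ x, φ x • g x i

/-- Membership in `H^1(ℝ^d)` (complex-valued functions). -/
def MemH1 {d : ℕ} (u : Space d → ℂ) : Prop :=
  MemLp u 2 volume ∧
    ∃ g : Space d → EuclideanSpace ℂ (Fin d), MemLp g 2 volume ∧ IsWeakGradient u g

open Classical in
/-- A square integrable weak gradient of `u`; it is unique up to null sets, and it exists
for `u ∈ H^1(ℝ^d)` (the value `0` is used otherwise). -/
def weakGrad {d : ℕ} (u : Space d → ℂ) : Space d → EuclideanSpace ℂ (Fin d) :=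
  if h : ∃ g : Space d → EuclideanSpace ℂ (Fin d), MemLp g 2 volume ∧ IsWeakGradient u g
  then h.choose else 0

/-- `u` is radial: almost everywhere equal to a function of `|x|`. -/
def IsRadial {d : ℕ} (u : Space d → ℂ) : Prop :=
  ∃ f : ℝ → ℂ, u =ᵐ[volume] fun x => f ‖x‖

/-- Membership in `H^1_rad(ℝ^d) \ {0}`. -/
def MemH1RadNonzero {d : ℕ} (u : Space d → ℂ) : Prop :=
  MemH1 u ∧ IsRadial u ∧ ¬ u =ᵐ[volume] 0

/-- `‖u‖_{L^2}^2`. -/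
def massSq {d : ℕ} (u : Space d → ℂ) : ℝ :=
  ∫ x, ‖u x‖ ^ 2

/-- `‖(-Δ_γ)^{1/2} u‖_{L^2}^2 = ‖∇u‖_{L^2}^2 + ∫ γ |x|^{-2} |u(x)|^2 dx`. -/
def kineticSq {d : ℕ} (γ : ℝ) (u : Space d → ℂ) : ℝ :=
  (∫ x, ‖weakGrad u x‖ ^ 2) + ∫ x, γ / ‖x‖ ^ 2 * ‖u x‖ ^ 2

/-- `‖u‖_{L^{p+1}}^{p+1}`. -/
def potentialPow {d : ℕ} (p : ℝ) (u : Space d → ℂ) : ℝ :=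
  ∫ x, ‖u x‖ ^ (p + 1)

/-- The action functional `S_{ω,γ}`. -/
def action {d : ℕ} (p γ ω : ℝ) (u : Space d → ℂ) : ℝ :=
  (1 - ω ^ 2) / 2 * massSq u + 1 / 2 * kineticSq γ u - 1 / (p + 1) * potentialPow p u

/-- `S_{ω,γ}'(u) = 0`. The functional is continuously differentiable on the real Hilbert space
`H^1(ℝ^d)`, so its derivative at `u` is zero iff all directional derivatives along `H^1` are. -/
def IsCriticalPoint {d : ℕ} (p γ ω : ℝ) (u : Space d → ℂ) : Prop :=
  ∀ v : Space d → ℂ, MemH1 v →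
    HasDerivAt (fun s : ℝ => action p γ ω (fun x => u x + (s : ℂ) * v x)) 0 0

/-- The set `𝒜_{ω,γ,rad}` of nonzero radial solutions of the stationary equation. -/
def radialSolutions (d : ℕ) (p γ ω : ℝ) : Set (Space d → ℂ) :=
  {u | MemH1RadNonzero u ∧ IsCriticalPoint p γ ω u}

/-- The set `𝒢_{ω,γ,rad}` of radial ground states. -/
def radialGroundStates (d : ℕ) (p γ ω : ℝ) : Set (Space d → ℂ) :=
  {u | u ∈ radialSolutions d p γ ω ∧
    ∀ v ∈ radialSolutions d p γ ω, action p γ ω u ≤ action p γ ω v}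

/-- `K_{ω,γ}^{α,β}(u)`, the derivative at `l = 0` of `S_{ω,γ}(e^{α l} u(e^{β l} ·))`. -/
def virial {d : ℕ} (p γ ω α β : ℝ) (u : Space d → ℂ) : ℝ :=
  deriv (fun l : ℝ => action p γ ω
    (fun x => (Real.exp (α * l) : ℂ) * u (Real.exp (β * l) • x))) 0

/-- The values `S_{ω,γ}(u)` for `u ∈ H^1_rad \ {0}` with `K_{ω,γ}^{α,β}(u) = 0`. -/
def constrainedActions (d : ℕ) (p γ ω α β : ℝ) : Set ℝ :=
  {s | ∃ u : Space d → ℂ, MemH1RadNonzero u ∧ virial p γ ω α β u = 0 ∧ s = action p γ ω u}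

/-- `r_{ω,γ}^{α,β}`. -/
def minAction (d : ℕ) (p γ ω α β : ℝ) : ℝ :=
  sInf (constrainedActions d p γ ω α β)

/-- The set `ℳ_{ω,γ,rad}^{α,β}` of minimizers. -/
def radialMinimizers (d : ℕ) (p γ ω α β : ℝ) : Set (Space d → ℂ) :=
  {u | MemH1RadNonzero u ∧ action p γ ω u = minAction d p γ ω α β ∧
    virial p γ ω α β u = 0}

/-- The nonnegative constants `C` for which the Gagliardo–Nirenberg inequality
`‖f‖_{L^{p+1}}^{p+1} ≤ C ‖f‖_{L^2}^{p+1-d(p-1)/2} ‖(-Δ_γ)^{1/2} f‖_{L^2}^{d(p-1)/2}`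
holds for all radial `f ∈ H^1(ℝ^d)`. -/
def radialGNConstants (d : ℕ) (p γ : ℝ) : Set ℝ :=
  {C | 0 ≤ C ∧ ∀ f : Space d → ℂ, MemH1 f → IsRadial f →
    potentialPow p f ≤
      C * Real.sqrt (massSq f) ^ (p + 1 - (d : ℝ) * (p - 1) / 2)
        * Real.sqrt (kineticSq γ f) ^ ((d : ℝ) * (p - 1) / 2)}

/-- The best constant in the radial Gagliardo–Nirenberg inequality. -/
def radialGNConst (d : ℕ) (p γ : ℝ) : ℝ :=
  sInf (radialGNConstants d p γ)

end NLKG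

end

open MeasureTheory

noncomputable section

namespace NLKG

open Filter Topology ENNReal

variable {d : ℕ}

/-! Write M for the mass, T for `kineticSq`, V for the critical power, m = 1 - ω² and E = mM + T.
The dilation e^{dλ} f(e^{2λ}·) preserves M and multiplies both T and V by e^{4λ}. Hence K = 0 means
T = d/(d+2) · V, and on this set S = (m/2) M (`virial_eq`, `action_eq_of_virial`). Minimizing S
becomes minimizing mass: V ≤ C M^{2/d} T turns the constraint into M ≥ X with X^{2/d} = (d+2)/(dC),
and a suitably rescaled extremal of the inequality attains this bound. The value of r is therefore
(m/2) X once the sharp constant is known to be attained.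

Attainment (`exists_sharp_gagliardoNirenberg`). Maximize V over radial functions with M + T ≤ 1. A
pair (u, ∇u) is encoded as an L² jet whose squared norm is the energy, so a maximizing sequence has
a weakly convergent subsequence. For radial u, the value at x is the pairing of ∇u with the fixed L²
field y/(σ|y|^d) restricted to |y| > |x| (`HasH1Grad.ae_eq_radialValue`). Weak convergence of jets
thus implies pointwise convergence almost everywhere, and Cauchy–Schwarz gives the decay
|x|^{-(d-2)/2}; together they pass V to the limit. Two-parameter scaling, combined with the maximum
of x^{2/d} y on x + y = 1, converts the maximum into the scale-invariant inequality.

Extremals are ground states. In the form V m^{2/d} ≤ C κ E^{1+2/d}, with κ = `profileMax d`, a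
correctly scaled extremal has equality and E = V. The first variation gives the Euler–Lagrange
equation against radial functions, and symmetric criticality (`inner_eq_zero_of_radial`) extends it
to all of H¹.

Ground states are minimizers. A radial critical point satisfies the Nehari identity E = V, so S =
V/(d+2), and the same inequality gives S ≥ (m/2) X. Equality in S forces equality in the arithmetic
inequality behind κ, which fixes the ratio of mM to T and yields K = 0 (`IsSharpGN.le_action`). No
Pohozaev identity is needed. -/

/-- `u` and `g` are square integrable and `g` is the weak gradient of `u`. -/
def HasH1Grad (u : Space d → ℂ) (g : Space d → EuclideanSpace ℂ (Fin d)) : Prop :=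
  MemLp u 2 volume ∧ MemLp g 2 volume ∧ IsWeakGradient u g

/-! ### Weak gradients: uniqueness and linearity -/

lemma hasH1Grad_of_integral {u : Space d → ℂ} {g : Space d → EuclideanSpace ℂ (Fin d)}
    (hu : MemLp u 2 volume) (hg : MemLp g 2 volume)
    (h : ∀ φ : Space d → ℝ, ContDiff ℝ ((⊤ : ℕ∞) : WithTop ℕ∞) φ → HasCompactSupport φ →
      ∀ i : Fin d,
      ∫ x, fderiv ℝ φ x (EuclideanSpace.single i 1) • u x = - ∫ x, φ x • g x i) :
    HasH1Grad u g :=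
  ⟨hu, hg, hu.locallyIntegrable (by norm_num), hg.locallyIntegrable (by norm_num), h⟩

lemma HasH1Grad.memH1 {u : Space d → ℂ} {g : Space d → EuclideanSpace ℂ (Fin d)}
    (h : HasH1Grad u g) : MemH1 u := ⟨h.1, g, h.2.1, h.2.2⟩

lemma MemH1.hasH1Grad {u : Space d → ℂ} (h : MemH1 u) : HasH1Grad u (weakGrad u) := by
  have h2 := h.2
  have : weakGrad u = h2.choose := by
    unfold weakGrad
    rw [dif_pos h2]
  rw [this]
  exact ⟨h.1, h2.choose_spec.1, h2.choose_spec.2⟩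

lemma locallyIntegrable_coord {g : Space d → EuclideanSpace ℂ (Fin d)}
    (hg : LocallyIntegrable g volume) (i : Fin d) :
    LocallyIntegrable (fun x => g x i) volume := by
  intro x
  obtain ⟨s, hs, hi⟩ := hg x
  exact ⟨s, hs, ((EuclideanSpace.proj (𝕜 := ℂ) i).integrable_comp hi :)⟩

/-- The fundamental lemma of the calculus of variations, applied to each coordinate. It makes the
choice inside `weakGrad` immaterial, so any explicit gradient may be used to compute `kineticSq`. -/
lemma IsWeakGradient.ae_eq {u v : Space d → ℂ} {g k : Space d → EuclideanSpace ℂ (Fin d)}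
    (hg : IsWeakGradient u g) (hk : IsWeakGradient v k) (huv : u =ᵐ[volume] v) :
    g =ᵐ[volume] k := by
  have key : ∀ i, ∀ᵐ x, g x i = k x i := by
    intro i
    refine ae_eq_of_integral_contDiff_smul_eq (locallyIntegrable_coord hg.2.1 i)
      (locallyIntegrable_coord hk.2.1 i) ?_
    intro φ hφ hc
    rw [← neg_inj, ← hg.2.2 φ hφ hc i, ← hk.2.2 φ hφ hc i]
    apply integral_congr_ae
    filter_upwards [huv] with x hx
    rw [hx]
  filter_upwards [ae_all_iff.2 key] with x hx
  ext i
  exact hx i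

lemma HasH1Grad.ae_eq {u v : Space d → ℂ} {g k : Space d → EuclideanSpace ℂ (Fin d)}
    (hg : HasH1Grad u g) (hk : HasH1Grad v k) (huv : u =ᵐ[volume] v) :
    g =ᵐ[volume] k := hg.2.2.ae_eq hk.2.2 huv

lemma HasH1Grad.weakGrad_ae_eq {u : Space d → ℂ} {g : Space d → EuclideanSpace ℂ (Fin d)}
    (hg : HasH1Grad u g) : weakGrad u =ᵐ[volume] g :=
  hg.memH1.hasH1Grad.ae_eq hg .rfl

lemma HasH1Grad.congr {u v : Space d → ℂ} {g k : Space d → EuclideanSpace ℂ (Fin d)}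
    (h : HasH1Grad u g) (huv : u =ᵐ[volume] v) (hgk : g =ᵐ[volume] k) : HasH1Grad v k := by
  refine hasH1Grad_of_integral (h.1.ae_eq huv) (h.2.1.ae_eq hgk) fun φ hφ hc i => ?_
  have := h.2.2.2.2 φ hφ hc i
  have e1 : ∫ x, φ x • g x i = ∫ x, φ x • k x i := by
    apply integral_congr_ae
    filter_upwards [hgk] with x hx
    rw [hx]
  rw [← e1, ← this]
  apply integral_congr_ae
  filter_upwards [huv] with x hx
  rw [hx]

lemma continuous_fderiv_apply_const {φ : Space d → ℝ}
    (hφ : ContDiff ℝ ((⊤ : ℕ∞) : WithTop ℕ∞) φ) (v : Space d) :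
    Continuous fun x => fderiv ℝ φ x v :=
  (hφ.continuous_fderiv (by simp)).clm_apply continuous_const

lemma hasCompactSupport_fderiv_apply {φ : Space d → ℝ} (hc : HasCompactSupport φ) (v : Space d) :
    HasCompactSupport fun x => fderiv ℝ φ x v :=
  hc.fderiv_apply ℝ v

lemma HasH1Grad.add_smul {u v : Space d → ℂ} {g k : Space d → EuclideanSpace ℂ (Fin d)}
    (hu : HasH1Grad u g) (hv : HasH1Grad v k) (c : ℂ) :
    HasH1Grad (fun x => u x + c * v x) (fun x => g x + c • k x) := by
  refine hasH1Grad_of_integral (hu.1.add (hv.1.const_mul c)) (hu.2.1.add (hv.2.1.const_smul c))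
    fun φ hφ hc i => ?_
  have e1 := hu.2.2.2.2 φ hφ hc i
  have e2 := hv.2.2.2.2 φ hφ hc i
  have h1 := hu.2.2.1.integrable_smul_left_of_hasCompactSupport
    (continuous_fderiv_apply_const hφ (EuclideanSpace.single i 1))
    (hasCompactSupport_fderiv_apply hc (EuclideanSpace.single i 1))
  have h2 := hv.2.2.1.integrable_smul_left_of_hasCompactSupport
    (continuous_fderiv_apply_const hφ (EuclideanSpace.single i 1))
    (hasCompactSupport_fderiv_apply hc (EuclideanSpace.single i 1))
  have h3 := (locallyIntegrable_coord hu.2.2.2.1 i).integrable_smul_left_of_hasCompactSupport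
    hφ.continuous hc
  have h4 := (locallyIntegrable_coord hv.2.2.2.1 i).integrable_smul_left_of_hasCompactSupport
    hφ.continuous hc
  have a1 : ∀ x, fderiv ℝ φ x (EuclideanSpace.single i 1) • (u x + c * v x) =
      fderiv ℝ φ x (EuclideanSpace.single i 1) • u x +
        c * (fderiv ℝ φ x (EuclideanSpace.single i 1) • v x) := by
    intro x
    rw [smul_add, mul_smul_comm]
  have a2 : ∀ x, φ x • (g x + c • k x) i = φ x • g x i + c * (φ x • k x i) := by
    intro x
    simp [smul_add, mul_left_comm]
  simp_rw [a1, a2]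
  rw [integral_add h1 (h2.const_mul c), integral_add h3 (h4.const_mul c), integral_const_mul,
    integral_const_mul, e1, e2]
  ring

lemma HasH1Grad.const_mul {u : Space d → ℂ} {g : Space d → EuclideanSpace ℂ (Fin d)}
    (hu : HasH1Grad u g) (c : ℂ) : HasH1Grad (fun x => c * u x) (fun x => c • g x) := by
  have := hu.add_smul hu (c - 1)
  refine this.congr (.of_forall fun x => ?_) (.of_forall fun x => ?_)
  · ring
  · simp only [sub_smul, one_smul, add_sub_cancel]

/-! ### Linear changes of variables -/

lemma map_continuousLinearEquiv_volume (A : Space d ≃L[ℝ] Space d) :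
    Measure.map A volume = ENNReal.ofReal |(LinearMap.det (A : Space d →ₗ[ℝ] Space d))⁻¹| •
      (volume : Measure (Space d)) :=
  Measure.map_linearMap_addHaar_eq_smul_addHaar volume
    (f := (A.toLinearEquiv : Space d →ₗ[ℝ] Space d)) (LinearEquiv.isUnit_det' _).ne_zero

lemma integral_comp_continuousLinearEquiv {F : Type*} [NormedAddCommGroup F] [NormedSpace ℝ F]
    (A : Space d ≃L[ℝ] Space d) (f : Space d → F) :
    ∫ x, f (A x) =
      |(LinearMap.det (A : Space d →ₗ[ℝ] Space d))⁻¹| • ∫ x, f x := by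
  have h := integral_map_equiv (μ := volume) A.toHomeomorph.toMeasurableEquiv f
  have e : (A.toHomeomorph.toMeasurableEquiv : Space d → Space d) = A := rfl
  rw [e, map_continuousLinearEquiv_volume, integral_smul_measure,
    ENNReal.toReal_ofReal (abs_nonneg _)] at h
  exact h.symm

lemma quasiMeasurePreserving_continuousLinearEquiv (A : Space d ≃L[ℝ] Space d) :
    Measure.QuasiMeasurePreserving A volume volume := by
  refine ⟨A.continuous.measurable, ?_⟩
  rw [map_continuousLinearEquiv_volume]
  exact Measure.smul_absolutelyContinuous

lemma MemLp.comp_continuousLinearEquiv {F : Type*} [NormedAddCommGroup F]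
    {f : Space d → F} {r : ENNReal} (hf : MemLp f r volume) (A : Space d ≃L[ℝ] Space d) :
    MemLp (fun x => f (A x)) r volume := by
  have h : MemLp f r (Measure.map A volume) := by
    rw [map_continuousLinearEquiv_volume]
    exact hf.smul_measure ENNReal.ofReal_ne_top
  exact (memLp_map_measure_iff h.1 A.continuous.measurable.aemeasurable).1 h

/-- The gradient of `u ∘ A` in terms of the gradient `g` of `u`. -/
def pullGrad (A : Space d ≃L[ℝ] Space d) (z : EuclideanSpace ℂ (Fin d)) :
    EuclideanSpace ℂ (Fin d) :=
  WithLp.toLp 2 fun i => ∑ j, (A (EuclideanSpace.single i 1)) j • z j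

lemma IsWeakGradient.integral_fderiv_smul {u : Space d → ℂ}
    {g : Space d → EuclideanSpace ℂ (Fin d)} (h : IsWeakGradient u g) {φ : Space d → ℝ}
    (hφ : ContDiff ℝ ((⊤ : ℕ∞) : WithTop ℕ∞) φ) (hc : HasCompactSupport φ) (v : Space d) :
    ∫ x, fderiv ℝ φ x v • u x = - ∫ x, φ x • ∑ j, v j • g x j := by
  have hv : v = ∑ j, v j • EuclideanSpace.single j (1 : ℝ) := by
    simpa using ((EuclideanSpace.basisFun (Fin d) ℝ).sum_repr v).symm
  have e : ∀ x, fderiv ℝ φ x v • u x =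
      ∑ j, v j • (fderiv ℝ φ x (EuclideanSpace.single j 1) • u x) := by
    intro x
    conv_lhs => rw [hv]
    simp [map_sum, Finset.sum_mul, mul_assoc]
  have e2 : ∀ x, φ x • ∑ j, v j • g x j = ∑ j, v j • (φ x • g x j) := by
    intro x
    rw [Finset.smul_sum]
    exact Finset.sum_congr rfl fun j _ => smul_comm _ _ _
  simp_rw [e, e2]
  rw [integral_finsetSum, integral_finsetSum, ← Finset.sum_neg_distrib]
  · refine Finset.sum_congr rfl fun j _ => ?_
    rw [integral_smul, integral_smul, h.2.2 φ hφ hc j, smul_neg]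
  · intro j _
    exact Integrable.smul (v j) ((locallyIntegrable_coord h.2.1
      j).integrable_smul_left_of_hasCompactSupport hφ.continuous hc)
  · intro j _
    exact Integrable.smul (v j) (h.1.integrable_smul_left_of_hasCompactSupport
      (continuous_fderiv_apply_const hφ (EuclideanSpace.single j 1))
      (hasCompactSupport_fderiv_apply hc (EuclideanSpace.single j 1)))

lemma MemLp.pullGrad {g : Space d → EuclideanSpace ℂ (Fin d)} (hg : MemLp g 2 volume)
    (A : Space d ≃L[ℝ] Space d) : MemLp (fun x => pullGrad A (g (A x))) 2 volume := by
  refine MemLp.of_eval_piLp fun i => ?_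
  change MemLp (fun x => ∑ j, (A (EuclideanSpace.single i 1)) j • g (A x) j) 2 volume
  refine memLp_finsetSum _ fun j _ => ?_
  exact ((MemLp.comp_continuousLinearEquiv hg A).eval_piLp j).const_smul
    ((A (EuclideanSpace.single i 1)) j)

/-- The substitution y = A x moves A onto the test function, which becomes φ ∘ A⁻¹; the Jacobian
factor is the same on both sides and the derivative is taken in the direction A eᵢ. Used for
dilations and for linear isometries. -/
lemma HasH1Grad.comp_continuousLinearEquiv {u : Space d → ℂ}
    {g : Space d → EuclideanSpace ℂ (Fin d)} (h : HasH1Grad u g) (A : Space d ≃L[ℝ] Space d) :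
    HasH1Grad (fun x => u (A x)) (fun x => pullGrad A (g (A x))) := by
  refine hasH1Grad_of_integral (MemLp.comp_continuousLinearEquiv h.1 A) (MemLp.pullGrad h.2.1 A)
    fun φ hφ hc i => ?_
  set ψ : Space d → ℝ := fun y => φ (A.symm y) with hψ
  have hψs : ContDiff ℝ ((⊤ : ℕ∞) : WithTop ℕ∞) ψ := hφ.comp A.symm.contDiff
  have hψc : HasCompactSupport ψ := hc.comp_homeomorph A.symm.toHomeomorph
  have hd : ∀ x, fderiv ℝ φ x (EuclideanSpace.single i 1) =
      fderiv ℝ ψ (A x) (A (EuclideanSpace.single i 1)) := by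
    intro x
    have : fderiv ℝ ψ (A x) = (fderiv ℝ φ x).comp (A.symm : Space d →L[ℝ] Space d) := by
      have h1 := A.symm.comp_right_fderiv (f := φ) (x := A x)
      rw [A.symm_apply_apply] at h1
      exact h1
    rw [this]
    simp
  have hp : ∀ x, φ x = ψ (A x) := fun x => by simp [hψ]
  simp_rw [hd, hp]
  rw [integral_comp_continuousLinearEquiv A (fun y =>
    fderiv ℝ ψ y (A (EuclideanSpace.single i 1)) • u y),
    h.2.2.integral_fderiv_smul hψs hψc, smul_neg]
  rw [← integral_comp_continuousLinearEquiv A (fun y =>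
    ψ y • ∑ j, (A (EuclideanSpace.single i 1)) j • g y j)]
  rfl

/-- Dilation of the space by `b ≠ 0`. -/
def dilation (d : ℕ) (b : ℝ) (hb : b ≠ 0) : Space d ≃L[ℝ] Space d :=
  ContinuousLinearEquiv.smulLeft (Units.mk0 b hb)

lemma dilation_apply {b : ℝ} (hb : b ≠ 0) (x : Space d) : dilation d b hb x = b • x := rfl

lemma pullGrad_dilation {b : ℝ} (hb : b ≠ 0) (z : EuclideanSpace ℂ (Fin d)) :
    pullGrad (dilation d b hb) z = b • z := by
  ext i
  simp [pullGrad, dilation_apply]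

/-- `a u(b ·)`. -/
lemma HasH1Grad.rescale {u : Space d → ℂ} {g : Space d → EuclideanSpace ℂ (Fin d)}
    (h : HasH1Grad u g) (a : ℂ) {b : ℝ} (hb : b ≠ 0) :
    HasH1Grad (fun x => a * u (b • x)) (fun x => a • b • g (b • x)) := by
  have := (h.comp_continuousLinearEquiv (dilation d b hb)).const_mul a
  simpa only [pullGrad_dilation, dilation_apply] using this

/-! ### Approximation by mollification and cutoff -/

/-- Cauchy–Schwarz for the measure a dμ, applied to the constant 1 and b. It serves both the
averaging bound and the Hardy inequality. -/
lemma lintegral_mul_sq_le {α : Type*} [MeasurableSpace α] {μ : Measure α} {a b : α → ℝ≥0∞}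
    (ha : AEMeasurable a μ) (hb : AEMeasurable b μ) :
    (∫⁻ x, a x * b x ∂μ) ^ 2 ≤ (∫⁻ x, a x ∂μ) * ∫⁻ x, a x * b x ^ 2 ∂μ := by
  have hb' : AEMeasurable b (μ.withDensity a) := hb.mono_ac (withDensity_absolutelyContinuous μ a)
  have h := ENNReal.lintegral_mul_le_Lp_mul_Lq (μ.withDensity a)
    (Real.HolderConjugate.two_two) (f := fun _ => 1) (g := b) aemeasurable_const hb'
  have e1 : ∫⁻ x, ((fun _ => 1 : α → ℝ≥0∞) * b) x ∂(μ.withDensity a) = ∫⁻ x, a x * b x ∂μ := by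
    simpa using lintegral_withDensity_eq_lintegral_mul₀ ha hb
  have e2 : ∫⁻ x, b x ^ (2 : ℝ) ∂(μ.withDensity a) = ∫⁻ x, a x * b x ^ 2 ∂μ := by
    simp_rw [ENNReal.rpow_two]
    exact lintegral_withDensity_eq_lintegral_mul₀ ha (hb.pow_const 2)
  have e3 : ∫⁻ _, (1 : ℝ≥0∞) ^ (2 : ℝ) ∂(μ.withDensity a) = ∫⁻ x, a x ∂μ := by
    simp
  rw [e1, e2, e3] at h
  calc _ ≤ _ := pow_le_pow_left' h 2
    _ = _ := by
      rw [mul_pow, ← ENNReal.rpow_natCast, ← ENNReal.rpow_natCast, ← ENNReal.rpow_mul,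
        ← ENNReal.rpow_mul]
      norm_num

lemma eLpNorm_two_sq {α F : Type*} [MeasurableSpace α] {μ : Measure α} [NormedAddCommGroup F]
    (f : α → F) : eLpNorm f 2 μ ^ 2 = ∫⁻ x, ‖f x‖ₑ ^ 2 ∂μ := by
  have := eLpNorm_nnreal_pow_eq_lintegral (f := f) (μ := μ) (p := 2) (by norm_num)
  simpa using this

/-- Averaging against a probability density contracts L²: Cauchy–Schwarz in y bounds the square of
the average by the average of the square, and Tonelli integrates the kernel out in x. -/
lemma eLpNorm_average_le {F : Type*} [NormedAddCommGroup F] [NormedSpace ℝ F]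
    {ρ : Space d → ℝ} (hρc : Continuous ρ) (hρ0 : ∀ x, 0 ≤ ρ x)
    (hρ1 : ∫⁻ x, ENNReal.ofReal (ρ x) = 1) {f : Space d → F}
    (hf : AEStronglyMeasurable f volume) :
    eLpNorm (fun x => ∫ y, ρ (x - y) • f y) 2 volume ≤ eLpNorm f 2 volume := by
  have hr : ∀ x, ∫⁻ y, ENNReal.ofReal (ρ (x - y)) = 1 := fun x => by
    rw [lintegral_sub_left_eq_self (fun y => ENNReal.ofReal (ρ y)) x, hρ1]
  have hl : ∀ y, ∫⁻ x, ENNReal.ofReal (ρ (x - y)) = 1 := fun y => by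
    rw [lintegral_sub_right_eq_self (fun y => ENNReal.ofReal (ρ y)) y, hρ1]
  have key : eLpNorm (fun x => ∫ y, ρ (x - y) • f y) 2 volume ^ 2 ≤ eLpNorm f 2 volume ^ 2 := by
    rw [eLpNorm_two_sq, eLpNorm_two_sq]
    calc ∫⁻ x, ‖∫ y, ρ (x - y) • f y‖ₑ ^ 2
        ≤ ∫⁻ x, ∫⁻ y, ENNReal.ofReal (ρ (x - y)) * ‖f y‖ₑ ^ 2 := by
          refine lintegral_mono fun x => ?_
          have h1 : ‖∫ y, ρ (x - y) • f y‖ₑ ≤ ∫⁻ y, ENNReal.ofReal (ρ (x - y)) * ‖f y‖ₑ := by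
            refine (enorm_integral_le_lintegral_enorm _).trans (le_of_eq ?_)
            congr 1 with y
            rw [enorm_smul, Real.enorm_of_nonneg (hρ0 _)]
          refine (pow_le_pow_left' h1 2).trans ?_
          refine (lintegral_mul_sq_le (by fun_prop) hf.enorm).trans ?_
          rw [hr, one_mul]
      _ = ∫⁻ y, ∫⁻ x, ENNReal.ofReal (ρ (x - y)) * ‖f y‖ₑ ^ 2 := by
          refine lintegral_lintegral_swap ?_
          have m1 : Measurable fun z : Space d × Space d => ENNReal.ofReal (ρ (z.1 - z.2)) := by
            fun_prop
          have m2 : AEMeasurable (fun z : Space d × Space d => ‖f z.2‖ₑ ^ 2)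
              (volume.prod volume) :=
            (hf.enorm.pow_const 2).comp_quasiMeasurePreserving
              (Measure.quasiMeasurePreserving_snd (μ := volume) (ν := volume))
          exact m1.aemeasurable.mul m2
      _ = ∫⁻ y, ‖f y‖ₑ ^ 2 := by
          congr 1 with y
          rw [lintegral_mul_const _ (by fun_prop), hl, one_mul]
  exact (ENNReal.pow_right_strictMono two_ne_zero).le_iff_le.1 key

lemma norm_le_sum_norm_apply_single (T : Space d →L[ℝ] ℂ) :
    ‖T‖ ≤ ∑ i, ‖T (EuclideanSpace.single i 1)‖ := by
  refine T.opNorm_le_bound (Finset.sum_nonneg fun i _ => norm_nonneg _) fun v => ?_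
  have hv : v = ∑ j, v j • EuclideanSpace.single j (1 : ℝ) := by
    simpa using ((EuclideanSpace.basisFun (Fin d) ℝ).sum_repr v).symm
  conv_lhs => rw [hv]
  rw [map_sum, Finset.sum_mul]
  refine (norm_sum_le _ _).trans (Finset.sum_le_sum fun i _ => ?_)
  rw [map_smul, norm_smul, mul_comm]
  exact mul_le_mul_of_nonneg_left (PiLp.norm_apply_le v i) (norm_nonneg _)

/-- Mollification commutes with the weak gradient. The translate y ↦ ρ(x - y) is an admissible test
function, and the sign from reflecting the variable cancels the sign in the weak identity. -/
lemma fderiv_mollify_apply {u : Space d → ℂ} {g : Space d → EuclideanSpace ℂ (Fin d)}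
    (h : IsWeakGradient u g) {ρ : Space d → ℝ} (hρ : ContDiff ℝ ((⊤ : ℕ∞) : WithTop ℕ∞) ρ)
    (hc : HasCompactSupport ρ) (x : Space d) (i : Fin d) :
    fderiv ℝ (convolution ρ u (ContinuousLinearMap.lsmul ℝ ℝ) volume) x
      (EuclideanSpace.single i 1) = ∫ y, ρ (x - y) • g y i := by
  have hd := hc.hasFDerivAt_convolution_left (ContinuousLinearMap.lsmul ℝ ℝ : ℝ →L[ℝ] ℂ →L[ℝ] ℂ)
    (hρ.of_le (by exact_mod_cast le_top)) h.1 x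
  rw [hd.fderiv]
  have hce := (hc.fderiv ℝ).convolutionExists_left
    ((ContinuousLinearMap.lsmul ℝ ℝ : ℝ →L[ℝ] ℂ →L[ℝ] ℂ).precompL (Space d))
    (hρ.continuous_fderiv (by simp)) h.1 x
  rw [convolution_def, ContinuousLinearMap.integral_apply hce]
  rw [← integral_sub_left_eq_self _ volume x]
  set φ : Space d → ℝ := fun y => ρ (x - y) with hφ
  have hφs : ContDiff ℝ ((⊤ : ℕ∞) : WithTop ℕ∞) φ := hρ.comp (contDiff_const.sub contDiff_id)
  have hφc : HasCompactSupport φ := hc.comp_homeomorph (Homeomorph.subLeft x)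
  have hφd : ∀ y, fderiv ℝ φ y (EuclideanSpace.single i 1) =
      - fderiv ℝ ρ (x - y) (EuclideanSpace.single i 1) := by
    intro y
    have h1 : HasFDerivAt φ ((fderiv ℝ ρ (x - y)).comp
        (-(ContinuousLinearMap.id ℝ (Space d)))) y := by
      refine HasFDerivAt.comp y (hρ.differentiable (by simp) _).hasFDerivAt ?_
      simpa using (hasFDerivAt_id y).const_sub x
    rw [h1.fderiv]
    simp
  have h2 := h.2.2 φ hφs hφc i
  rw [← neg_inj, ← h2, ← integral_neg]
  congr 1 with y
  rw [hφd]
  simp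

/-- The factor d comes from bounding the operator norm by the sum over coordinates. It is not sharp,
but only uniformity over all mollifiers is needed. -/
lemma eLpNorm_fderiv_mollify_le {u : Space d → ℂ} {g : Space d → EuclideanSpace ℂ (Fin d)}
    (h : HasH1Grad u g) {ρ : Space d → ℝ} (hρ : ContDiff ℝ ((⊤ : ℕ∞) : WithTop ℕ∞) ρ)
    (hc : HasCompactSupport ρ) (hρ0 : ∀ x, 0 ≤ ρ x) (hρ1 : ∫⁻ x, ENNReal.ofReal (ρ x) = 1) :
    eLpNorm (fderiv ℝ (convolution ρ u (ContinuousLinearMap.lsmul ℝ ℝ) volume)) 2 volume ≤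
      d * eLpNorm g 2 volume := by
  set w := convolution ρ u (ContinuousLinearMap.lsmul ℝ ℝ) volume with hw
  have hwc : ContDiff ℝ 1 w := hc.contDiff_convolution_left (n := 1) _
    (hρ.of_le (by exact_mod_cast le_top)) h.2.2.1
  have hcont : ∀ i : Fin d, Continuous fun x => fderiv ℝ w x (EuclideanSpace.single i 1) :=
    fun i => (hwc.continuous_fderiv one_ne_zero).clm_apply continuous_const
  calc eLpNorm (fderiv ℝ w) 2 volume
      ≤ eLpNorm (∑ i : Fin d, fun x => ‖fderiv ℝ w x (EuclideanSpace.single i 1)‖) 2 volume := by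
        refine eLpNorm_mono_real fun x => ?_
        simpa using norm_le_sum_norm_apply_single (fderiv ℝ w x)
    _ ≤ ∑ i : Fin d, eLpNorm (fun x => ‖fderiv ℝ w x (EuclideanSpace.single i 1)‖) 2 volume :=
        eLpNorm_sum_le (fun i _ => (hcont i).norm.aestronglyMeasurable) (by norm_num)
    _ ≤ ∑ i : Fin d, eLpNorm g 2 volume := by
        refine Finset.sum_le_sum fun i _ => ?_
        rw [eLpNorm_norm]
        have e : (fun x => fderiv ℝ w x (EuclideanSpace.single i 1)) =
            fun x => ∫ y, ρ (x - y) • g y i := by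
          funext x
          exact fderiv_mollify_apply h.2.2 hρ hc x i
        rw [e]
        refine (eLpNorm_average_le hρ.continuous hρ0 hρ1
          (h.2.1.eval_piLp i).aestronglyMeasurable).trans ?_
        exact eLpNorm_mono fun x => PiLp.norm_apply_le (g x) i
    _ = d * eLpNorm g 2 volume := by simp

lemma eLpNorm_mollify_le {u : Space d → ℂ} (hu : MemLp u 2 volume) {ρ : Space d → ℝ}
    (hρ : Continuous ρ) (hρ0 : ∀ x, 0 ≤ ρ x) (hρ1 : ∫⁻ x, ENNReal.ofReal (ρ x) = 1) :
    eLpNorm (convolution ρ u (ContinuousLinearMap.lsmul ℝ ℝ) volume) 2 volume ≤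
      eLpNorm u 2 volume := by
  have e : convolution ρ u (ContinuousLinearMap.lsmul ℝ ℝ) volume =
      fun x => ∫ y, ρ (x - y) • u y := by
    funext x
    rw [convolution_eq_swap]
    rfl
  rw [e]
  exact eLpNorm_average_le hρ hρ0 hρ1 hu.aestronglyMeasurable

/-- A smooth cutoff function of ball `1` in ball `2`, rescaled to ball `n + 1`. -/
def cutoff (d : ℕ) (n : ℕ) (x : Space d) : ℝ :=
  (⟨1, 2, one_pos, one_lt_two⟩ : ContDiffBump (0 : Space d)) (((n : ℝ) + 1)⁻¹ • x)

lemma cutoff_contDiff (n : ℕ) {k : ℕ∞} : ContDiff ℝ k (cutoff d n) :=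
  (ContDiffBump.contDiff _).comp (contDiff_const_smul _)

lemma cutoff_nonneg (n : ℕ) (x : Space d) : 0 ≤ cutoff d n x := ContDiffBump.nonneg _

lemma cutoff_le_one (n : ℕ) (x : Space d) : cutoff d n x ≤ 1 := ContDiffBump.le_one _

lemma cutoff_eq_one {n : ℕ} {x : Space d} (hx : ‖x‖ ≤ n + 1) : cutoff d n x = 1 := by
  refine ContDiffBump.one_of_mem_closedBall _ ?_
  have hn : (0 : ℝ) < n + 1 := by positivity
  rw [mem_closedBall_zero_iff, norm_smul, norm_inv, Real.norm_of_nonneg hn.le]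
  exact inv_mul_le_one_of_le₀ hx hn.le

lemma cutoff_hasCompactSupport (n : ℕ) : HasCompactSupport (cutoff d n) := by
  have hn : ((n : ℝ) + 1)⁻¹ ≠ 0 := by positivity
  exact (ContDiffBump.hasCompactSupport _).comp_homeomorph 
    (Homeomorph.smulOfNeZero (α := Space d) ((n : ℝ) + 1)⁻¹ hn)

lemma cutoff_tendsto (x : Space d) : Tendsto (fun n => cutoff d n x) atTop (𝓝 1) := by
  refine tendsto_const_nhds.congr' ?_
  filter_upwards [eventually_ge_atTop ⌈‖x‖⌉₊] with n hn
  rw [cutoff_eq_one]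
  have := Nat.ceil_le.1 hn
  linarith

lemma exists_norm_fderiv_cutoff_le (d : ℕ) :
    ∃ C : ℝ, 0 ≤ C ∧ ∀ n x, ‖fderiv ℝ (cutoff d n) x‖ ≤ C * ((n : ℝ) + 1)⁻¹ := by
  set χ : ContDiffBump (0 : Space d) := ⟨1, 2, one_pos, one_lt_two⟩ with hχ
  have hs : ContDiff ℝ 1 χ := χ.contDiff
  obtain ⟨C, hC⟩ := (χ.hasCompactSupport.fderiv ℝ).exists_bound_of_continuous
    (hs.continuous_fderiv one_ne_zero)
  refine ⟨C, (norm_nonneg _).trans (hC 0), fun n x => ?_⟩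
  have h1 : HasFDerivAt (cutoff d n)
      ((fderiv ℝ χ (((n : ℝ) + 1)⁻¹ • x)).comp
        (((n : ℝ) + 1)⁻¹ • ContinuousLinearMap.id ℝ (Space d))) x := by
    refine HasFDerivAt.comp x (hs.differentiable one_ne_zero _).hasFDerivAt ?_
    exact (hasFDerivAt_id x).const_smul (((n : ℝ) + 1)⁻¹)
  rw [h1.fderiv, ContinuousLinearMap.comp_smul, ContinuousLinearMap.comp_id, norm_smul,
    norm_inv, Real.norm_of_nonneg (by positivity : (0 : ℝ) ≤ n + 1), mul_comm]
  exact mul_le_mul_of_nonneg_right (hC _) (by positivity)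

lemma eLpNorm_fderiv_cutoff_mul_le {w : Space d → ℂ} (hw : ContDiff ℝ 1 w) {C : ℝ}
    (hC0 : 0 ≤ C) (hC : ∀ n x, ‖fderiv ℝ (cutoff d n) x‖ ≤ C * ((n : ℝ) + 1)⁻¹) (n : ℕ) :
    eLpNorm (fderiv ℝ fun x => cutoff d n x • w x) 2 volume ≤
      eLpNorm (fderiv ℝ w) 2 volume + ENNReal.ofReal C * eLpNorm w 2 volume := by
  have hd := hw.continuous_fderiv one_ne_zero
  calc eLpNorm (fderiv ℝ fun x => cutoff d n x • w x) 2 volume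
      ≤ eLpNorm ((fun x => ‖fderiv ℝ w x‖) + fun x => C * ‖w x‖) 2 volume := by
        refine eLpNorm_mono_real fun x => ?_
        have h1 : HasFDerivAt (fun x => cutoff d n x • w x)
            (cutoff d n x • fderiv ℝ w x + (fderiv ℝ (cutoff d n) x).smulRight (w x)) x :=
          (((cutoff_contDiff n (k := 1)).differentiable one_ne_zero x).hasFDerivAt).smul
            ((hw.differentiable one_ne_zero x).hasFDerivAt)
        rw [h1.fderiv]
        refine (norm_add_le _ _).trans (add_le_add ?_ ?_)
        · rw [norm_smul, Real.norm_of_nonneg (cutoff_nonneg n x)]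
          exact mul_le_of_le_one_left (norm_nonneg _) (cutoff_le_one n x)
        · rw [ContinuousLinearMap.norm_smulRight_apply]
          refine mul_le_mul_of_nonneg_right ((hC n x).trans ?_) (norm_nonneg _)
          refine mul_le_of_le_one_right hC0 (inv_le_one_of_one_le₀ ?_)
          linarith [(Nat.cast_nonneg n : (0 : ℝ) ≤ n)]
    _ ≤ _ := by
        refine (eLpNorm_add_le hd.norm.aestronglyMeasurable
          (continuous_const.mul hw.continuous.norm).aestronglyMeasurable (by norm_num)).trans ?_
        rw [eLpNorm_norm]
        gcongr
        have := eLpNorm_const_smul C (fun x => ‖w x‖) 2 (volume : Measure (Space d))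
        rw [eLpNorm_norm, Real.enorm_of_nonneg hC0] at this
        exact this.le

/-- Functions in `H¹` are limits almost everywhere of compactly supported `C¹` functions with
bounded Dirichlet energy. -/
lemma HasH1Grad.exists_approx {u : Space d → ℂ} {g : Space d → EuclideanSpace ℂ (Fin d)}
    (h : HasH1Grad u g) :
    ∃ (w : ℕ → Space d → ℂ) (C : ℝ≥0∞), C ≠ ∞ ∧ (∀ n, ContDiff ℝ 1 (w n)) ∧
      (∀ n, HasCompactSupport (w n)) ∧ (∀ n, eLpNorm (fderiv ℝ (w n)) 2 volume ≤ C) ∧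
      ∀ᵐ x, Tendsto (fun n => w n x) atTop (𝓝 (u x)) := by
  obtain ⟨C, hC0, hC⟩ := exists_norm_fderiv_cutoff_le d
  -- The radii shrink to zero with fixed ratio 2, the bounded eccentricity required for almost
  -- everywhere convergence of the mollifications of a merely locally integrable function.
  let φ : ℕ → ContDiffBump (0 : Space d) := fun n =>
    ⟨((n : ℝ) + 1)⁻¹, 2 * ((n : ℝ) + 1)⁻¹, by positivity,
      by linarith [(by positivity : (0 : ℝ) < ((n : ℝ) + 1)⁻¹)]⟩
  have hρ : ∀ n, ContDiff ℝ ((⊤ : ℕ∞) : WithTop ℕ∞) ((φ n).normed volume) :=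
    fun n => (φ n).contDiff_normed
  have hρc : ∀ n, HasCompactSupport ((φ n).normed volume) :=
    fun n => (φ n).hasCompactSupport_normed
  have hρ0 : ∀ n x, 0 ≤ (φ n).normed volume x := fun n x => (φ n).nonneg_normed x
  have hρ1 : ∀ n, ∫⁻ x, ENNReal.ofReal ((φ n).normed volume x) = 1 := fun n => by
    rw [← ofReal_integral_eq_lintegral_ofReal (φ n).integrable_normed
      (.of_forall (hρ0 n)), (φ n).integral_normed, ENNReal.ofReal_one]
  let v : ℕ → Space d → ℂ := fun n =>
    convolution ((φ n).normed volume) u (ContinuousLinearMap.lsmul ℝ ℝ) volume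
  have hv : ∀ n, ContDiff ℝ 1 (v n) := fun n =>
    (hρc n).contDiff_convolution_left (n := 1) _ ((hρ n).of_le (by exact_mod_cast le_top)) h.2.2.1
  have hv2 : ∀ n, eLpNorm (v n) 2 volume ≤ eLpNorm u 2 volume := fun n =>
    eLpNorm_mollify_le h.1 (hρ n).continuous (hρ0 n) (hρ1 n)
  have hv3 : ∀ n, eLpNorm (fderiv ℝ (v n)) 2 volume ≤ d * eLpNorm g 2 volume := fun n =>
    eLpNorm_fderiv_mollify_le h (hρ n) (hρc n) (hρ0 n) (hρ1 n)
  have hv4 : ∀ᵐ x, Tendsto (fun n => v n x) atTop (𝓝 (u x)) := by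
    refine ContDiffBump.ae_convolution_tendsto_right_of_locallyIntegrable (K := 2) ?_ ?_ h.2.2.1
    · have := (tendsto_one_div_add_atTop_nhds_zero_nat (𝕜 := ℝ)).const_mul 2
      simpa [φ] using this
    · exact .of_forall fun n => le_rfl
  refine ⟨fun n x => cutoff d n x • v n x,
    d * eLpNorm g 2 volume + ENNReal.ofReal C * eLpNorm u 2 volume, ?_, ?_, ?_, ?_, ?_⟩
  · have h1 := h.1.2.ne
    have h2 := h.2.1.2.ne
    finiteness
  · exact fun n => (cutoff_contDiff n).smul (hv n)
  · exact fun n => (cutoff_hasCompactSupport n).smul_right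
  · intro n
    refine (eLpNorm_fderiv_cutoff_mul_le (hv n) hC0 hC n).trans ?_
    gcongr
    · exact hv3 n
    · exact hv2 n
  · filter_upwards [hv4] with x hx
    simpa using (cutoff_tendsto x).smul hx

/-! ### Sobolev and Hardy inequalities -/

/-- The Sobolev embedding `H¹ ⊂ L^{2d/(d-2)}`. -/
lemma MemH1.memLp_sobolev {u : Space d → ℂ} (hd : 3 ≤ d) (h : MemH1 u) :
    MemLp u (ENNReal.ofReal (2 * d / (d - 2))) volume := by
  obtain ⟨w, C, hC, hw, hwc, hwb, hlim⟩ := h.hasH1Grad.exists_approx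
  refine ⟨h.1.1, ?_⟩
  have hd' : (3 : ℝ) ≤ d := by exact_mod_cast hd
  set q : NNReal := Real.toNNReal (2 * d / (d - 2)) with hq
  have hq0 : (0 : ℝ) ≤ 2 * d / (d - 2) := div_nonneg (by positivity) (by linarith)
  have hs : ∀ n, eLpNorm (w n) q volume ≤
      SNormLESNormFDerivOfEqConst ℂ (volume : Measure (Space d)) ((2 : NNReal) : ℝ) * C := by
    intro n
    have := eLpNorm_le_eLpNorm_fderiv_of_eq (volume : Measure (Space d)) (hw n) (hwc n)
      (p := 2) (p' := q) (by norm_num) (by simp; omega) (by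
        rw [hq, Real.coe_toNNReal _ hq0]
        have h1 : (d : ℝ) - 2 ≠ 0 := by linarith
        have h2 : (d : ℝ) ≠ 0 := by linarith
        simp only [finrank_euclideanSpace, Fintype.card_fin, NNReal.coe_inv, NNReal.coe_ofNat]
        field_simp
        try ring)
    refine this.trans ?_
    gcongr
    exact hwb n
  -- The inequality for compactly supported C¹ functions passes to u by Fatou, along the almost
  -- everywhere convergent approximations.
  have h1 : eLpNorm u q volume ≤ liminf (fun n => eLpNorm (w n) q volume) atTop :=
    Lp.eLpNorm_lim_le_liminf_eLpNorm (fun n => (hw n).continuous.aestronglyMeasurable) u hlim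
  have h2 : liminf (fun n => eLpNorm (w n) q volume) atTop ≤
      SNormLESNormFDerivOfEqConst ℂ (volume : Measure (Space d)) ((2 : NNReal) : ℝ) * C := by
    refine (liminf_le_liminf (.of_forall hs)).trans ?_
    simp
  exact (h1.trans h2).trans_lt (by finiteness)

/-- Pointwise, |f|^b is at most |f|^a where |f| ≤ 1 and at most |f|^c elsewhere. -/
lemma memLp_of_memLp_of_memLp {α F : Type*} [MeasurableSpace α] {μ : Measure α}
    [NormedAddCommGroup F] {f : α → F} {a b c : ℝ} (ha : 0 < a) (hab : a ≤ b) (hbc : b ≤ c)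
    (h1 : MemLp f (ENNReal.ofReal a) μ) (h2 : MemLp f (ENNReal.ofReal c) μ) :
    MemLp f (ENNReal.ofReal b) μ := by
  have hb : 0 < b := ha.trans_le hab
  have hc : 0 < c := hb.trans_le hbc
  refine ⟨h1.1, ?_⟩
  have e1 := (eLpNorm_lt_top_iff_lintegral_rpow_enorm_lt_top (by simpa using ha)
    ENNReal.ofReal_ne_top).1 h1.2
  have e2 := (eLpNorm_lt_top_iff_lintegral_rpow_enorm_lt_top (by simpa using hc)
    ENNReal.ofReal_ne_top).1 h2.2
  refine (eLpNorm_lt_top_iff_lintegral_rpow_enorm_lt_top (by simpa using hb)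
    ENNReal.ofReal_ne_top).2 ?_
  rw [ENNReal.toReal_ofReal ha.le] at e1
  rw [ENNReal.toReal_ofReal hc.le] at e2
  rw [ENNReal.toReal_ofReal hb.le]
  calc ∫⁻ x, ‖f x‖ₑ ^ b ∂μ ≤ ∫⁻ x, (‖f x‖ₑ ^ a + ‖f x‖ₑ ^ c) ∂μ := by
        refine lintegral_mono fun x => ?_
        rcases le_total ‖f x‖ₑ 1 with h | h
        · exact (ENNReal.rpow_le_rpow_of_exponent_ge h hab).trans le_self_add
        · exact (ENNReal.rpow_le_rpow_of_exponent_le h hbc).trans le_add_self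
    _ = _ := lintegral_add_left' (h1.1.enorm.pow_const a) _
    _ < ∞ := ENNReal.add_lt_top.2 ⟨e1, e2⟩

/-- The embedding `H¹ ⊂ L^{2+4/d}`. -/
lemma MemH1.memLp_power {u : Space d → ℂ} (hd : 3 ≤ d) (h : MemH1 u) :
    MemLp u (ENNReal.ofReal (2 + 4 / d)) volume := by
  have hd' : (3 : ℝ) ≤ d := by exact_mod_cast hd
  refine memLp_of_memLp_of_memLp (a := 2) (c := 2 * d / (d - 2)) two_pos ?_ ?_ ?_
    (h.memLp_sobolev hd)
  · linarith [(by positivity : (0 : ℝ) ≤ 4 / d)]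
  · rw [le_div_iff₀ (by linarith)]
    have : (2 + 4 / (d : ℝ)) * (d - 2) = 2 * d - 8 / d := by field_simp; ring
    rw [this]
    linarith [(by positivity : (0 : ℝ) ≤ 8 / d)]
  · simpa using h.1

lemma lintegral_comp_smul (f : Space d → ℝ≥0∞) (hf : Measurable f) {t : ℝ} (ht : 0 < t) :
    ∫⁻ x, f (t • x) = ENNReal.ofReal (t ^ (-(d : ℝ))) * ∫⁻ x, f x := by
  have h := Measure.map_addHaar_smul (volume : Measure (Space d)) ht.ne'
  have h2 := lintegral_map (μ := volume) hf (measurable_const_smul t (α := Space d))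
  rw [h, lintegral_smul_measure] at h2
  rw [← h2, finrank_euclideanSpace, Fintype.card_fin, abs_of_pos (by positivity),
    Real.rpow_neg ht.le, Real.rpow_natCast, smul_eq_mul]

/-- The fundamental theorem of calculus along the ray from x to infinity, where w vanishes by
compactness of its support. -/
lemma enorm_le_lintegral_ray {w : Space d → ℂ} (hw : ContDiff ℝ 1 w)
    (hc : HasCompactSupport w) {x : Space d} (hx : x ≠ 0) :
    ‖w x‖ₑ ≤ ‖x‖ₑ * ∫⁻ t in Set.Ioi (1 : ℝ), ‖fderiv ℝ w (t • x)‖ₑ := by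
  have hf : ContDiff ℝ 1 fun t : ℝ => w (t • x) := hw.comp (contDiff_id.smul contDiff_const)
  have hfc : HasCompactSupport fun t : ℝ => w (t • x) :=
    hc.comp_isClosedEmbedding (isClosedEmbedding_smul_left hx)
  have h1 := hfc.integral_Ioi_deriv_eq hf 1
  have h2 : ∀ t : ℝ, deriv (fun t : ℝ => w (t • x)) t = fderiv ℝ w (t • x) x := by
    intro t
    have h3 : HasDerivAt (fun t : ℝ => t • x) ((1 : ℝ) • x) t := (hasDerivAt_id t).smul_const x
    have := (hw.differentiable one_ne_zero (t • x)).hasFDerivAt.comp_hasDerivAt t h3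
    rw [one_smul] at this
    exact this.deriv
  simp_rw [h2, one_smul] at h1
  rw [← enorm_neg, ← h1]
  refine (enorm_integral_le_lintegral_enorm _).trans ?_
  rw [← lintegral_const_mul' _ _ (by finiteness)]
  refine lintegral_mono fun t => ?_
  rw [mul_comm]
  exact ContinuousLinearMap.le_opENorm _ _

/-- A Hardy inequality for compactly supported `C¹` functions. -/
lemma lintegral_hardy_le (hd : 3 ≤ d) {w : Space d → ℂ} (hw : ContDiff ℝ 1 w)
    (hc : HasCompactSupport w) :
    ∫⁻ x, ‖‖x‖⁻¹ • w x‖ₑ ^ 2 ≤ (∫⁻ t in Set.Ioi (1 : ℝ), ENNReal.ofReal (t ^ (-(3 / 2) : ℝ))) ^ 2 *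
      ∫⁻ x, ‖fderiv ℝ w x‖ₑ ^ 2 := by
  set K := ∫⁻ t in Set.Ioi (1 : ℝ), ENNReal.ofReal (t ^ (-(3 / 2) : ℝ)) with hK
  have hdw := hw.continuous_fderiv one_ne_zero
  have hpt : ∀ x, ‖‖x‖⁻¹ • w x‖ₑ ^ 2 ≤ K * ∫⁻ t in Set.Ioi (1 : ℝ),
      ENNReal.ofReal (t ^ (3 / 2 : ℝ)) * ‖fderiv ℝ w (t • x)‖ₑ ^ 2 := by
    intro x
    rcases eq_or_ne x 0 with rfl | hx
    · simp
    have h1 : ‖‖x‖⁻¹ • w x‖ₑ ≤ ∫⁻ t in Set.Ioi (1 : ℝ), ‖fderiv ℝ w (t • x)‖ₑ := by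
      rw [enorm_smul, enorm_inv (by simpa using hx), enorm_norm]
      refine (mul_le_mul_right (enorm_le_lintegral_ray hw hc hx) _).trans ?_
      rw [← mul_assoc, ENNReal.inv_mul_cancel (by simpa using hx) (by finiteness), one_mul]
    refine (pow_le_pow_left' h1 2).trans ?_
    have h2 : ∀ t ∈ Set.Ioi (1 : ℝ), ENNReal.ofReal (t ^ (-(3 / 2) : ℝ)) *
        ENNReal.ofReal (t ^ (3 / 2 : ℝ)) = 1 := by
      intro t ht
      have ht0 : (0 : ℝ) < t := one_pos.trans ht
      rw [← ENNReal.ofReal_mul (by positivity), ← Real.rpow_add ht0]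
      norm_num
    have m1 : Measurable fun t : ℝ => ENNReal.ofReal (t ^ (3 / 2 : ℝ)) := by fun_prop
    have m2 : Measurable fun t : ℝ => ‖fderiv ℝ w (t • x)‖ₑ :=
      (hdw.comp (by fun_prop : Continuous fun t : ℝ => t • x)).enorm.measurable
    -- Cauchy–Schwarz in t with the weights t^{-3/2} and t^{3/2}: the first is integrable on (1, ∞),
    -- and the second still loses to the factor t^{-d} produced by the dilation x ↦ t x.
    have h3 := lintegral_mul_sq_le (μ := volume.restrict (Set.Ioi (1 : ℝ)))
      (a := fun t => ENNReal.ofReal (t ^ (-(3 / 2) : ℝ)))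
      (b := fun t => ENNReal.ofReal (t ^ (3 / 2 : ℝ)) * ‖fderiv ℝ w (t • x)‖ₑ)
      (by fun_prop) (m1.mul m2).aemeasurable
    have e1 : ∫⁻ t in Set.Ioi (1 : ℝ), ENNReal.ofReal (t ^ (-(3 / 2) : ℝ)) *
        (ENNReal.ofReal (t ^ (3 / 2 : ℝ)) * ‖fderiv ℝ w (t • x)‖ₑ) =
        ∫⁻ t in Set.Ioi (1 : ℝ), ‖fderiv ℝ w (t • x)‖ₑ := by
      refine setLIntegral_congr_fun measurableSet_Ioi fun t ht => ?_
      rw [← mul_assoc, h2 t ht, one_mul]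
    have e2 : ∫⁻ t in Set.Ioi (1 : ℝ), ENNReal.ofReal (t ^ (-(3 / 2) : ℝ)) *
        (ENNReal.ofReal (t ^ (3 / 2 : ℝ)) * ‖fderiv ℝ w (t • x)‖ₑ) ^ 2 =
        ∫⁻ t in Set.Ioi (1 : ℝ),
          ENNReal.ofReal (t ^ (3 / 2 : ℝ)) * ‖fderiv ℝ w (t • x)‖ₑ ^ 2 := by
      refine setLIntegral_congr_fun measurableSet_Ioi fun t ht => ?_
      rw [mul_pow, ← mul_assoc, sq (ENNReal.ofReal _), ← mul_assoc, h2 t ht, one_mul]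
    rw [e1, e2] at h3
    exact h3
  calc ∫⁻ x, ‖‖x‖⁻¹ • w x‖ₑ ^ 2
      ≤ ∫⁻ x, K * ∫⁻ t in Set.Ioi (1 : ℝ),
          ENNReal.ofReal (t ^ (3 / 2 : ℝ)) * ‖fderiv ℝ w (t • x)‖ₑ ^ 2 := lintegral_mono hpt
    _ = K * ∫⁻ t in Set.Ioi (1 : ℝ), ∫⁻ x,
          ENNReal.ofReal (t ^ (3 / 2 : ℝ)) * ‖fderiv ℝ w (t • x)‖ₑ ^ 2 := by
        have hm : Measurable fun z : Space d × ℝ =>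
            ENNReal.ofReal (z.2 ^ (3 / 2 : ℝ)) * ‖fderiv ℝ w (z.2 • z.1)‖ₑ ^ 2 := by
          have m1 : Measurable fun z : Space d × ℝ => ENNReal.ofReal (z.2 ^ (3 / 2 : ℝ)) := by
            fun_prop
          refine m1.mul (Measurable.pow_const ?_ 2)
          exact (hdw.comp (by fun_prop :
            Continuous fun z : Space d × ℝ => z.2 • z.1)).enorm.measurable
        rw [lintegral_const_mul _ hm.lintegral_prod_right', lintegral_lintegral_swap]
        exact hm.aemeasurable
    _ ≤ K * ∫⁻ t in Set.Ioi (1 : ℝ), ENNReal.ofReal (t ^ (-(3 / 2) : ℝ)) *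
          ∫⁻ x, ‖fderiv ℝ w x‖ₑ ^ 2 := by
        gcongr K * ?_
        refine setLIntegral_mono' measurableSet_Ioi fun t ht => ?_
        have ht0 : (0 : ℝ) < t := one_pos.trans ht
        have hm : Measurable fun x => ‖fderiv ℝ w x‖ₑ ^ 2 := hdw.enorm.measurable.pow_const 2
        have hm' : Measurable fun x => ‖fderiv ℝ w (t • x)‖ₑ ^ 2 :=
          hm.comp (measurable_const_smul t)
        rw [lintegral_const_mul _ hm',
          lintegral_comp_smul (fun x => ‖fderiv ℝ w x‖ₑ ^ 2) hm ht0, ← mul_assoc,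
          ← ENNReal.ofReal_mul (by positivity), ← Real.rpow_add ht0]
        -- What remains is t^{3/2 - d} ≤ t^{-3/2} for t ≥ 1, which is where d ≥ 3 enters.
        gcongr
        · exact le_of_lt ht
        · have hd' : (3 : ℝ) ≤ d := by exact_mod_cast hd
          linarith
    _ = _ := by
        rw [lintegral_mul_const _ (by fun_prop), ← mul_assoc, sq]

/-- The Hardy inequality, qualitatively. -/
lemma MemH1.memLp_hardy {u : Space d → ℂ} (hd : 3 ≤ d) (h : MemH1 u) :
    MemLp (fun x => ‖x‖⁻¹ • u x) 2 volume := by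
  obtain ⟨w, C, hC, hw, hwc, hwb, hlim⟩ := h.hasH1Grad.exists_approx
  have hmeas : ∀ {f : Space d → ℂ}, AEStronglyMeasurable f volume →
      AEStronglyMeasurable (fun x => ‖x‖⁻¹ • f x) volume := fun hf =>
    (measurable_norm.inv.aestronglyMeasurable).smul hf
  refine ⟨hmeas h.1.1, ?_⟩
  set K := ∫⁻ t in Set.Ioi (1 : ℝ), ENNReal.ofReal (t ^ (-(3 / 2) : ℝ)) with hK
  have hKt : K ≠ ∞ := by
    have h1 := integrableOn_Ioi_rpow_of_lt (by norm_num : (-(3 / 2) : ℝ) < -1) one_pos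
    exact ((hasFiniteIntegral_iff_ofReal (ae_restrict_of_forall_mem measurableSet_Ioi
      fun t ht => Real.rpow_nonneg (one_pos.trans ht).le _)).1 h1.2).ne
  have h1 : eLpNorm (fun x => ‖x‖⁻¹ • u x) 2 volume ≤
      liminf (fun n => eLpNorm (fun x => ‖x‖⁻¹ • w n x) 2 volume) atTop := by
    refine Lp.eLpNorm_lim_le_liminf_eLpNorm
      (fun n => hmeas (hw n).continuous.aestronglyMeasurable) _ ?_
    filter_upwards [hlim] with x hx
    exact hx.const_smul _
  have h2 : liminf (fun n => eLpNorm (fun x => ‖x‖⁻¹ • w n x) 2 volume) atTop ≤ K * C := by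
    refine (liminf_le_liminf (v := fun _ => K * C) (.of_forall fun n => ?_)).trans (by simp)
    refine (ENNReal.pow_le_pow_left_iff two_ne_zero).1 ?_
    rw [eLpNorm_two_sq, mul_pow]
    refine (lintegral_hardy_le hd (hw n) (hwc n)).trans ?_
    rw [← eLpNorm_two_sq]
    gcongr
    exact hwb n
  exact (h1.trans h2).trans_lt (by finiteness)

/-! ### Weak compactness and the Hilbert space of jets -/

/-- Sequential Banach–Alaoglu in the dual of a separable space, carried back by the Riesz
isomorphism. Since that isomorphism is conjugate linear, the limits are conjugated at the end. -/
lemma exists_weakly_convergent_subseq {E : Type*} [NormedAddCommGroup E] [InnerProductSpace ℂ E]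
    [CompleteSpace E] [TopologicalSpace.SeparableSpace E] (x : ℕ → E) (r : ℝ)
    (hx : ∀ n, ‖x n‖ ≤ r) :
    ∃ (a : E) (φ : ℕ → ℕ), StrictMono φ ∧ ‖a‖ ≤ r ∧
      ∀ y, Tendsto (fun n => inner ℂ y (x (φ n))) atTop (𝓝 (inner ℂ y a)) := by
  have h := WeakDual.isSeqCompact_closedBall ℂ E 0 r
  let T : ℕ → WeakDual ℂ E := fun n => StrongDual.toWeakDual (InnerProductSpace.toDual ℂ E (x n))
  obtain ⟨a, ha, φ, hφ, hlim⟩ := h (x := T) (fun n => by simp [T, hx n])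
  refine ⟨(InnerProductSpace.toDual ℂ E).symm (WeakDual.toStrongDual a), φ, hφ, ?_, fun y => ?_⟩
  · simpa using ha
  · have h1 : Tendsto (fun n => T (φ n) y) atTop (𝓝 (a y)) :=
      ((WeakDual.eval_continuous y).tendsto a).comp hlim
    have h2 := (Complex.continuous_conj.tendsto _).comp h1
    rw [← inner_conj_symm, InnerProductSpace.toDual_symm_apply]
    refine h2.congr fun n => ?_
    simp [T]

/-- Values of a function together with its gradient. -/
abbrev Jet (d : ℕ) : Type := WithLp 2 (ℂ × EuclideanSpace ℂ (Fin d))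

/-- The Hilbert space of square integrable jets. -/
abbrev JetSpace (d : ℕ) : Type := Lp (Jet d) 2 (volume : Measure (Space d))

instance : Fact ((2 : ℝ≥0∞) ≠ ∞) := ⟨by simp⟩

/-- The weight `(m + γ / |x|²)^{1/2}`. -/
def weight (m γ : ℝ) (x : Space d) : ℝ := Real.sqrt (m + γ / ‖x‖ ^ 2)

section weight

variable {m γ : ℝ}

lemma weight_sq (hm : 0 < m) (hγ : 0 < γ) (x : Space d) :
    weight m γ x ^ 2 = m + γ / ‖x‖ ^ 2 := Real.sq_sqrt (by positivity)

lemma weight_pos (hm : 0 < m) (hγ : 0 < γ) (x : Space d) : 0 < weight m γ x :=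
  Real.sqrt_pos.2 (by positivity)

lemma sqrt_le_weight (hγ : 0 < γ) (x : Space d) : Real.sqrt m ≤ weight m γ x :=
  Real.sqrt_le_sqrt (le_add_of_nonneg_right (by positivity))

lemma weight_le (hm : 0 < m) (hγ : 0 < γ) (x : Space d) :
    weight m γ x ≤ Real.sqrt m + Real.sqrt γ * ‖x‖⁻¹ := by
  refine Real.sqrt_le_iff.2 ⟨by positivity, ?_⟩
  have h1 := Real.sq_sqrt hm.le
  have h2 := Real.sq_sqrt hγ.le
  have : (Real.sqrt m + Real.sqrt γ * ‖x‖⁻¹) ^ 2 =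
      m + γ / ‖x‖ ^ 2 + 2 * Real.sqrt m * (Real.sqrt γ * ‖x‖⁻¹) := by
    rw [add_sq, h1, mul_pow, h2, inv_pow, div_eq_mul_inv]; ring
  rw [this]
  exact le_add_of_nonneg_right (by positivity)

lemma measurable_weight : Measurable (weight m γ : Space d → ℝ) := by
  unfold weight
  fun_prop

lemma MemLp.weight_inv_mul (hm : 0 < m) (hγ : 0 < γ) {f : Space d → ℂ} {r : ℝ≥0∞}
    (hf : MemLp f r volume) : MemLp (fun x => ((weight m γ x)⁻¹ : ℝ) • f x) r volume := by
  refine (hf.const_smul ((Real.sqrt m)⁻¹)).of_le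
    (measurable_weight.inv.aestronglyMeasurable.smul hf.1) (.of_forall fun x => ?_)
  simp only [Pi.smul_apply]
  rw [norm_smul, norm_smul, norm_inv, norm_inv, Real.norm_of_nonneg (weight_pos hm hγ x).le,
    Real.norm_of_nonneg (Real.sqrt_nonneg m)]
  refine mul_le_mul_of_nonneg_right ?_ (norm_nonneg _)
  exact inv_anti₀ (Real.sqrt_pos.2 hm) (sqrt_le_weight hγ x)

lemma MemH1.memLp_weight_mul (hd : 3 ≤ d) (hm : 0 < m) (hγ : 0 < γ) {u : Space d → ℂ}
    (hu : MemH1 u) : MemLp (fun x => weight m γ x • u x) 2 volume := by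
  refine ((hu.1.norm.const_mul (Real.sqrt m)).add
    ((hu.memLp_hardy hd).norm.const_mul (Real.sqrt γ))).of_le
    (measurable_weight.aestronglyMeasurable.smul hu.1.1) (.of_forall fun x => ?_)
  simp only [Pi.add_apply]
  rw [norm_smul, norm_smul, norm_inv, norm_norm, Real.norm_of_nonneg (weight_pos hm hγ x).le,
    Real.norm_of_nonneg (by positivity), ← mul_assoc, ← add_mul]
  exact mul_le_mul_of_nonneg_right (weight_le hm hγ x) (norm_nonneg _)

end weight

/-- The jet of a function `u` with gradient `g`. -/
def jet (m γ : ℝ) (u : Space d → ℂ) (g : Space d → EuclideanSpace ℂ (Fin d)) (x : Space d) :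
    Jet d := WithLp.toLp 2 (weight m γ x • u x, g x)

lemma HasH1Grad.memLp_jet (hd : 3 ≤ d) {m γ : ℝ} (hm : 0 < m) (hγ : 0 < γ)
    {u : Space d → ℂ} {g : Space d → EuclideanSpace ℂ (Fin d)} (h : HasH1Grad u g) :
    MemLp (jet m γ u g) 2 volume :=
  MemLp.of_fst_of_snd_prodLp ⟨h.memH1.memLp_weight_mul hd hm hγ, h.2.1⟩

/-- The quadratic part of the action. -/
def energy (m γ : ℝ) (u : Space d → ℂ) : ℝ := m * massSq u + kineticSq γ u

lemma norm_sq_eq_integral {F : Type*} [NormedAddCommGroup F] [InnerProductSpace ℂ F]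
    {f : Space d → F} (hf : MemLp f 2 volume) : ‖hf.toLp‖ ^ 2 = ∫ x, ‖f x‖ ^ 2 := by
  rw [← inner_self_eq_norm_sq (𝕜 := ℂ), L2.inner_def, ← integral_re (L2.integrable_inner _ _)]
  apply integral_congr_ae
  filter_upwards [hf.coeFn_toLp] with x hx
  rw [hx, inner_self_eq_norm_sq]

lemma MemH1.integrable_potential (hd : 3 ≤ d) {u : Space d → ℂ} (hu : MemH1 u) (γ : ℝ) :
    Integrable (fun x => γ / ‖x‖ ^ 2 * ‖u x‖ ^ 2) volume := by
  have h := (hu.memLp_hardy hd).integrable_norm_pow (p := 2) (by norm_num)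
  refine (h.const_mul γ).congr (.of_forall fun x => ?_)
  simp only
  rw [norm_smul, norm_inv, norm_norm, mul_pow, inv_pow]
  ring

lemma MemH1.integrable_sq {u : Space d → ℂ} (hu : MemH1 u) :
    Integrable (fun x => ‖u x‖ ^ 2) volume := hu.1.integrable_norm_pow (p := 2) (by norm_num)

lemma HasH1Grad.kineticSq_eq {u : Space d → ℂ} {g : Space d → EuclideanSpace ℂ (Fin d)}
    (h : HasH1Grad u g) (γ : ℝ) :
    kineticSq γ u = (∫ x, ‖g x‖ ^ 2) + ∫ x, γ / ‖x‖ ^ 2 * ‖u x‖ ^ 2 := by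
  unfold kineticSq
  congr 1
  apply integral_congr_ae
  filter_upwards [h.weakGrad_ae_eq] with x hx
  rw [hx]

/-- The weight is chosen for this identity: absorbing both the mass and the inverse-square potential
into the zeroth-order component makes the energy a squared L² norm. -/
lemma HasH1Grad.norm_jet_sq (hd : 3 ≤ d) {m γ : ℝ} (hm : 0 < m) (hγ : 0 < γ)
    {u : Space d → ℂ} {g : Space d → EuclideanSpace ℂ (Fin d)} (h : HasH1Grad u g) :
    ‖(h.memLp_jet hd hm hγ).toLp‖ ^ 2 = energy m γ u := by
  rw [norm_sq_eq_integral, energy, h.kineticSq_eq, massSq]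
  have i1 := h.memH1.integrable_sq
  have i2 := h.memH1.integrable_potential hd γ
  have i3 : Integrable (fun x => ‖g x‖ ^ 2) volume :=
    h.2.1.integrable_norm_pow (p := 2) (by norm_num)
  have i4 : Integrable (fun x => ‖g x‖ ^ 2 + γ / ‖x‖ ^ 2 * ‖u x‖ ^ 2) volume := i3.add i2
  rw [← integral_add i3 i2, ← integral_const_mul, ← integral_add (i1.const_mul m) i4]
  congr 1 with x
  rw [jet, WithLp.prod_norm_sq_eq_of_L2]
  change ‖weight m γ x • u x‖ ^ 2 + ‖g x‖ ^ 2 = _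
  rw [norm_smul, mul_pow, Real.norm_of_nonneg (weight_pos hm hγ x).le, weight_sq hm hγ]
  ring

/-- The jet whose pairing with the jet of `u` is zero exactly when the weak gradient identity for
`φ` and the `i`-th coordinate holds. -/
def testJet (m γ : ℝ) (φ : Space d → ℝ) (i : Fin d) (x : Space d) : Jet d :=
  WithLp.toLp 2 ((weight m γ x)⁻¹ • ((fderiv ℝ φ x (EuclideanSpace.single i 1) : ℝ) : ℂ),
    EuclideanSpace.single i ((φ x : ℝ) : ℂ))

lemma memLp_testJet {m γ : ℝ} (hm : 0 < m) (hγ : 0 < γ) {φ : Space d → ℝ}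
    (hφ : ContDiff ℝ ((⊤ : ℕ∞) : WithTop ℕ∞) φ) (hc : HasCompactSupport φ) (i : Fin d) :
    MemLp (testJet m γ φ i) 2 volume := by
  refine MemLp.of_fst_of_snd_prodLp ⟨?_, ?_⟩
  · refine MemLp.weight_inv_mul hm hγ (f := fun x =>
      ((fderiv ℝ φ x (EuclideanSpace.single i 1) : ℝ) : ℂ)) ?_
    exact ((continuous_fderiv_apply_const hφ _).memLp_of_hasCompactSupport
      (hasCompactSupport_fderiv_apply hc _)).ofReal
  · refine MemLp.of_eval_piLp fun j => ?_
    have h1 : MemLp (fun x => ((φ x : ℝ) : ℂ)) 2 (volume : Measure (Space d)) :=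
      (hφ.continuous.memLp_of_hasCompactSupport hc).ofReal
    by_cases hj : j = i
    · subst hj
      simpa [testJet] using h1
    · have : (fun x : Space d => (testJet m γ φ i x).snd j) = fun _ => 0 := by
        funext x
        simp [testJet, hj]
      exact this ▸ MemLp.zero

/-- The closed space of jets of functions in `H¹`. -/
def jetSubmodule (d : ℕ) (m γ : ℝ) : Submodule ℂ (JetSpace d) :=
  (Submodule.span ℂ {F : JetSpace d | ∃ (φ : Space d → ℝ) (i : Fin d),
    ContDiff ℝ ((⊤ : ℕ∞) : WithTop ℕ∞) φ ∧ HasCompactSupport φ ∧ F =ᵐ[volume] testJet m γ φ i})ᗮ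

instance (m γ : ℝ) : CompleteSpace (jetSubmodule d m γ) :=
  inferInstanceAs (CompleteSpace (Submodule.span ℂ _)ᗮ)

/-- The function underlying a jet. -/
def jetFun (m γ : ℝ) (F : Space d → Jet d) (x : Space d) : ℂ := (weight m γ x)⁻¹ • (F x).fst

lemma jetFun_jet {m γ : ℝ} (hm : 0 < m) (hγ : 0 < γ) (u : Space d → ℂ)
    (g : Space d → EuclideanSpace ℂ (Fin d)) : jetFun m γ (jet m γ u g) = u := by
  funext x
  change (weight m γ x)⁻¹ • weight m γ x • u x = u x
  rw [smul_smul, inv_mul_cancel₀ (weight_pos hm hγ x).ne', one_smul]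

lemma jet_jetFun {m γ : ℝ} (hm : 0 < m) (hγ : 0 < γ) (F : Space d → Jet d) :
    jet m γ (jetFun m γ F) (fun x => (F x).snd) = F := by
  funext x
  simp only [jetFun, jet]
  rw [smul_smul, mul_inv_cancel₀ (weight_pos hm hγ x).ne', one_smul]
  rfl

lemma inner_testJet {m γ : ℝ} (φ : Space d → ℝ) (i : Fin d) (F : Space d → Jet d) (x : Space d) :
    inner ℂ (testJet m γ φ i x) (F x) =
      fderiv ℝ φ x (EuclideanSpace.single i 1) • jetFun m γ F x + φ x • (F x).snd i := by
  rw [WithLp.prod_inner_apply]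
  simp only [testJet, jetFun, EuclideanSpace.inner_single_left, RCLike.inner_apply]
  simp
  ring

/-- Pairing with a test jet reproduces the weak gradient identity, the weight cancelling. The jets
of H¹ functions are thus an orthogonal complement, hence closed under weak limits. -/
lemma mem_jetSubmodule_iff {m γ : ℝ} (hm : 0 < m) (hγ : 0 < γ) (F : JetSpace d) :
    F ∈ jetSubmodule d m γ ↔ HasH1Grad (jetFun m γ F) fun x => (F x).snd := by
  have hF := Lp.memLp F
  have h1 : MemLp (jetFun m γ F) 2 volume := MemLp.weight_inv_mul hm hγ hF.prodLp_fst
  have h2 : MemLp (fun x => (F x).snd) 2 volume := hF.prodLp_snd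
  have key : ∀ φ : Space d → ℝ, ContDiff ℝ ((⊤ : ℕ∞) : WithTop ℕ∞) φ → HasCompactSupport φ →
      ∀ i, ∀ G : JetSpace d, G =ᵐ[volume] testJet m γ φ i → inner ℂ G F =
      (∫ x, fderiv ℝ φ x (EuclideanSpace.single i 1) • jetFun m γ F x) +
        ∫ x, φ x • (F x).snd i := by
    intro φ hφ hc i G hG
    rw [L2.inner_def, ← integral_add]
    · apply integral_congr_ae
      filter_upwards [hG] with x hx
      rw [hx, inner_testJet]
    · exact (h1.locallyIntegrable (by norm_num)).integrable_smul_left_of_hasCompactSupport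
        (continuous_fderiv_apply_const hφ _) (hasCompactSupport_fderiv_apply hc _)
    · exact (locallyIntegrable_coord
        (h2.locallyIntegrable (by norm_num)) i).integrable_smul_left_of_hasCompactSupport
        hφ.continuous hc
  constructor
  · intro h
    refine hasH1Grad_of_integral h1 h2 fun φ hφ hc i => ?_
    have hG := (memLp_testJet hm hγ hφ hc i).coeFn_toLp
    have h3 := (Submodule.mem_orthogonal _ _).1 h _ (Submodule.subset_span ⟨φ, i, hφ, hc, hG⟩)
    rw [key φ hφ hc i _ hG] at h3
    exact eq_neg_of_add_eq_zero_left h3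
  · intro h
    rw [jetSubmodule, Submodule.mem_orthogonal]
    intro G hG
    induction hG using Submodule.span_induction with
    | mem G hG =>
      obtain ⟨φ, i, hφ, hc, hG⟩ := hG
      rw [key φ hφ hc i G hG, h.2.2.2.2 φ hφ hc i, neg_add_cancel]
    | zero => simp
    | add x y _ _ hx hy => rw [inner_add_left, hx, hy, add_zero]
    | smul a x _ hx => rw [inner_smul_left, hx, mul_zero]

lemma HasH1Grad.toLp_mem (hd : 3 ≤ d) {m γ : ℝ} (hm : 0 < m) (hγ : 0 < γ)
    {u : Space d → ℂ} {g : Space d → EuclideanSpace ℂ (Fin d)} (h : HasH1Grad u g) :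
    (h.memLp_jet hd hm hγ).toLp ∈ jetSubmodule d m γ := by
  rw [mem_jetSubmodule_iff hm hγ]
  have hF := (h.memLp_jet hd hm hγ).coeFn_toLp
  refine h.congr ?_ ?_
  · filter_upwards [hF] with x hx
    rw [← congrFun (jetFun_jet hm hγ u g) x]
    simp only [jetFun]
    rw [hx]
  · filter_upwards [hF] with x hx
    rw [hx]
    rfl

/-! ### Radial functions: ball averages and radial test functions -/

lemma IsRadial.comp_isometry {u : Space d → ℂ} (hu : IsRadial u) (R : Space d ≃ₗᵢ[ℝ] Space d) :
    (fun x => u (R x)) =ᵐ[volume] u := by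
  obtain ⟨f, hf⟩ := hu
  have h := R.measurePreserving.quasiMeasurePreserving.ae hf
  filter_upwards [hf, h] with x hx hx'
  rw [hx, hx', LinearIsometryEquiv.norm_map]

lemma exists_reflection_apply_eq {x y : Space d} (h : ‖x‖ = ‖y‖) :
    ∃ v : Space d, (ℝ ∙ v)ᗮ.reflection x = y := ⟨x - y, Submodule.reflection_sub h⟩

lemma setIntegral_closedBall_of_comp_isometry {u : Space d → ℂ} {R : Space d ≃ₗᵢ[ℝ] Space d}
    (h : (fun x => u (R x)) =ᵐ[volume] u) (x : Space d) (ε : ℝ) :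
    ∫ z in Metric.closedBall x ε, u z = ∫ z in Metric.closedBall (R x) ε, u z := by
  have h1 := R.measurePreserving.setIntegral_preimage_emb
    R.toHomeomorph.measurableEmbedding u (Metric.closedBall (R x) ε)
  rw [LinearIsometryEquiv.preimage_closedBall, LinearIsometryEquiv.symm_apply_apply] at h1
  rw [← h1]
  exact (integral_congr_ae (ae_restrict_of_ae h)).symm

/-- The integrals of `u` over balls depend only on the radius and the distance of the center to
the origin. -/
def BallSymmetric (u : Space d → ℂ) : Prop :=
  ∀ x y : Space d, ∀ ε : ℝ, ‖x‖ = ‖y‖ →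
    ∫ z in Metric.closedBall x ε, u z = ∫ z in Metric.closedBall y ε, u z

lemma ballSymmetric_of_reflection {u : Space d → ℂ}
    (h : ∀ v : Space d, (fun x => u ((ℝ ∙ v)ᗮ.reflection x)) =ᵐ[volume] u) :
    BallSymmetric u := by
  intro x y ε hxy
  obtain ⟨v, hv⟩ := exists_reflection_apply_eq hxy
  rw [setIntegral_closedBall_of_comp_isometry (h v), hv]

lemma IsRadial.ballSymmetric {u : Space d → ℂ} (hu : IsRadial u) : BallSymmetric u :=
  ballSymmetric_of_reflection fun _ => hu.comp_isometry _

/-- Lebesgue differentiation recovers u at almost every x from averages over small balls, and these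
depend only on |x|. Unlike `IsRadial`, the hypothesis is a family of linear conditions testable by
fixed L² jets, so it survives weak limits. -/
lemma BallSymmetric.isRadial (hd : 0 < d) {u : Space d → ℂ} (hi : LocallyIntegrable u volume)
    (hu : BallSymmetric u) : IsRadial u := by
  set e : Space d := EuclideanSpace.single ⟨0, hd⟩ 1 with he
  have hen : ‖e‖ = 1 := by simp [he]
  let δ : ℕ → ℝ := fun n => 1 / ((n : ℝ) + 1)
  have hδ : Tendsto δ atTop (𝓝[>] 0) := by
    refine tendsto_nhdsWithin_iff.2 ⟨tendsto_one_div_add_atTop_nhds_zero_nat, .of_forall fun n => ?_⟩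
    exact Set.mem_Ioi.2 (by positivity)
  -- The profile is read off along the ray through e. Radii at which the averages diverge receive an
  -- arbitrary value; for almost every x the averages at ‖x‖ • e do converge, to u x.
  refine ⟨fun r => limUnder atTop fun n => ⨍ z in Metric.closedBall (r • e) (δ n), u z, ?_⟩
  filter_upwards [IsUnifLocDoublingMeasure.ae_tendsto_average (μ := volume) hi 1] with x hx
  have h1 := hx (fun _ : ℕ => x) δ hδ (.of_forall fun n => by
    simp only [one_mul]
    exact Metric.mem_closedBall_self (by positivity))
  have h2 : ∀ n, ⨍ z in Metric.closedBall x (δ n), u z =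
      ⨍ z in Metric.closedBall (‖x‖ • e) (δ n), u z := by
    intro n
    rw [setAverage_eq, setAverage_eq, hu x (‖x‖ • e) (δ n) (by rw [norm_smul, hen]; simp)]
    simp only [measureReal_def, Measure.addHaar_closedBall_center]
  simp_rw [h2] at h1
  exact h1.limUnder_eq.symm

/-- Polar coordinates applied to the indicator of {f ≠ 0}: a null set of radii yields a null set of
points. -/
lemma ae_norm_of_integral_eq {f : ℝ → ℂ} (hd : 0 < d) (h : ∀ᵐ r : ℝ, 0 < r → f r = 0) :
    ∀ᵐ x : Space d, f ‖x‖ = 0 := by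
  have : Nontrivial (Space d) := by
    have : Nonempty (Fin d) := ⟨⟨0, hd⟩⟩
    infer_instance
  classical
  let F : ℝ → ℝ := fun r => if f r = 0 then 0 else 1
  have hF : (fun r : ℝ => r ^ (Module.finrank ℝ (Space d) - 1) • F r)
      =ᵐ[volume.restrict (Set.Ioi 0)] 0 := by
    filter_upwards [ae_restrict_of_ae h, ae_restrict_mem measurableSet_Ioi] with r hr hr0
    simp [F, hr hr0]
  have h1 : Integrable (fun x : Space d => F ‖x‖) volume :=
    (integrable_fun_norm_addHaar volume).2 ((integrable_zero _ _ _).congr hF.symm)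
  have h2 : ∫ x : Space d, F ‖x‖ = 0 := by
    rw [integral_fun_norm_addHaar volume F, integral_congr_ae hF]
    simp
  have h3 := (integral_eq_zero_iff_of_nonneg (fun x => by simp only [F]; split_ifs <;> simp) h1).1 h2
  filter_upwards [h3] with x hx
  by_contra hne
  simp [F, hne] at hx

/-- A radial function orthogonal to all smooth radial functions supported away from the origin
vanishes. -/
lemma ae_eq_zero_of_integral_radial {z : Space d → ℂ} (hd : 0 < d)
    (hz : LocallyIntegrable z volume) (hr : IsRadial z)
    (h : ∀ η : ℝ → ℝ, ContDiff ℝ ((⊤ : ℕ∞) : WithTop ℕ∞) η → HasCompactSupport η →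
      tsupport η ⊆ Set.Ioi 0 → ∫ x, η ‖x‖ • z x = 0) : z =ᵐ[volume] 0 := by
  have : Nontrivial (Space d) := by
    have : Nonempty (Fin d) := ⟨⟨0, hd⟩⟩
    infer_instance
  obtain ⟨f, hf⟩ := hr
  have hl : LocallyIntegrableOn (fun r : ℝ => r ^ (Module.finrank ℝ (Space d) - 1) • f r)
      (Set.Ioi 0) volume := by
    intro r hr
    refine ⟨Set.Ioi 0 ∩ Set.Iio (r + 1), inter_mem_nhdsWithin _ (Iio_mem_nhds (by linarith)), ?_⟩
    have h1 : IntegrableOn (fun x : Space d => f ‖x‖) (Metric.ball 0 (r + 1)) volume :=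
      ((hz.integrableOn_isCompact (isCompact_closedBall 0 (r + 1))).mono_set
        Metric.ball_subset_closedBall).congr (ae_restrict_of_ae hf)
    exact (integrableOn_fun_norm_addHaar volume).1 h1
  have h2 : ∀ᵐ r : ℝ, r ∈ Set.Ioi (0 : ℝ) →
      r ^ (Module.finrank ℝ (Space d) - 1) • f r = 0 := by
    refine isOpen_Ioi.ae_eq_zero_of_integral_contDiff_smul_eq_zero hl fun η hη hc hs => ?_
    have h3 : ∫ x : Space d, η ‖x‖ • f ‖x‖ = 0 := by
      rw [← h η hη hc hs]
      apply integral_congr_ae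
      filter_upwards [hf] with x hx
      rw [hx]
    rw [integral_fun_norm_addHaar volume fun r => η r • f r] at h3
    have hne : (volume : Measure (Space d)).real (Metric.ball 0 1) ≠ 0 :=
      
      (ENNReal.toReal_pos (Metric.measure_ball_pos volume 0 one_pos).ne' measure_ball_lt_top.ne).ne'
    have hfin : Module.finrank ℝ (Space d) ≠ 0 := by simp; omega
    rw [smul_eq_zero_iff_right hfin, smul_eq_zero_iff_right hne] at h3
    have h4 : ∫ r, η r • r ^ (Module.finrank ℝ (Space d) - 1) • f r =
        ∫ r in Set.Ioi (0 : ℝ), η r • r ^ (Module.finrank ℝ (Space d) - 1) • f r := by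
      refine (setIntegral_eq_integral_of_forall_compl_eq_zero fun r hr => ?_).symm
      have : η r = 0 := by
        by_contra hne
        exact hr (hs (subset_tsupport _ hne))
      rw [this, zero_smul]
    rw [h4, ← h3]
    congr 1 with r
    rw [smul_comm]
  have h5 : ∀ᵐ r : ℝ, 0 < r → f r = 0 := by
    filter_upwards [h2] with r hr hr0
    exact (smul_eq_zero_iff_right (pow_ne_zero _ hr0.ne')).1 (hr hr0)
  filter_upwards [hf, ae_norm_of_integral_eq hd h5] with x hx hx'
  rw [hx, hx']
  rfl

/-! ### The flux field and the decay of radial functions -/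

/-- The area of the unit sphere. -/
def sphereArea (d : ℕ) : ℝ := d * (volume : Measure (Space d)).real (Metric.ball 0 1)

lemma sphereArea_pos (hd : 0 < d) : 0 < sphereArea d := by
  have : 0 < (volume : Measure (Space d)).real (Metric.ball 0 1) :=
    ENNReal.toReal_pos (Metric.measure_ball_pos volume 0 one_pos).ne' measure_ball_lt_top.ne
  have : (0 : ℝ) < d := by exact_mod_cast hd
  unfold sphereArea
  positivity

lemma nontrivial_space (hd : 0 < d) : Nontrivial (Space d) := by
  have : Nonempty (Fin d) := ⟨⟨0, hd⟩⟩
  infer_instance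

lemma integral_norm_eq (hd : 0 < d) {F : Type*} [NormedAddCommGroup F] [NormedSpace ℝ F]
    (f : ℝ → F) :
    ∫ x : Space d, f ‖x‖ = sphereArea d • ∫ t in Set.Ioi (0 : ℝ), t ^ (d - 1) • f t := by
  have := nontrivial_space hd
  rw [integral_fun_norm_addHaar volume f, finrank_euclideanSpace, Fintype.card_fin, sphereArea,
    mul_smul, Nat.cast_smul_eq_nsmul]

lemma integrable_norm_iff (hd : 0 < d) {F : Type*} [NormedAddCommGroup F] [NormedSpace ℝ F]
    (f : ℝ → F) : Integrable (fun x : Space d => f ‖x‖) volume ↔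
      IntegrableOn (fun t : ℝ => t ^ (d - 1) • f t) (Set.Ioi 0) volume := by
  have := nontrivial_space hd
  rw [integrable_fun_norm_addHaar volume, finrank_euclideanSpace, Fintype.card_fin]

lemma integrableOn_ball_norm_rpow (hd : 0 < d) {s : ℝ} (hs : -(d : ℝ) < s) (R : ℝ) :
    IntegrableOn (fun x : Space d => ‖x‖ ^ s) (Metric.ball 0 R) volume := by
  have := nontrivial_space hd
  refine (integrableOn_fun_norm_addHaar volume (f := fun t : ℝ => t ^ s)).2 ?_
  rw [finrank_euclideanSpace, Fintype.card_fin]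
  rcases le_or_gt R 0 with hR | hR
  · simp [Set.Ioo_eq_empty_of_le hR]
  have h1 : IntegrableOn (fun t : ℝ => t ^ ((d : ℝ) - 1 + s)) (Set.Ioo 0 R) volume :=
    (intervalIntegral.integrableOn_Ioo_rpow_iff hR).2 (by linarith)
  refine h1.congr_fun (fun t ht => ?_) measurableSet_Ioo
  have : (t : ℝ) ^ (d - 1) = t ^ ((d : ℝ) - 1) := by
    rw [← Real.rpow_natCast, Nat.cast_sub hd, Nat.cast_one]
  simp only [smul_eq_mul]
  rw [this, ← Real.rpow_add ht.1]

/-- A real vector as a complex vector. -/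
def toComplex (y : Space d) : EuclideanSpace ℂ (Fin d) := WithLp.toLp 2 fun i => (y i : ℂ)

lemma norm_toComplex (y : Space d) : ‖toComplex y‖ = ‖y‖ := by
  simp [toComplex, EuclideanSpace.norm_eq]

lemma continuous_toComplex : Continuous (toComplex : Space d → _) := by
  unfold toComplex
  fun_prop

lemma inner_toComplex (y : Space d) (z : EuclideanSpace ℂ (Fin d)) :
    inner ℂ (toComplex y) z = ∑ i, y i • z i := by
  simp [toComplex, PiLp.inner_apply, mul_comm]

/-- The vector field `y / (σ |y|^d)` outside the ball of radius `r`. -/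
def fluxField (r : ℝ) (y : Space d) : EuclideanSpace ℂ (Fin d) :=
  if r < ‖y‖ then ((sphereArea d * ‖y‖ ^ d)⁻¹ : ℝ) • toComplex y else 0

/-- The norm of the flux field as a function of the radius. -/
def fluxNorm (d : ℕ) (r t : ℝ) : ℝ := if r < t then (sphereArea d * t ^ d)⁻¹ * t else 0

lemma norm_fluxField (hd : 0 < d) (r : ℝ) (y : Space d) :
    ‖fluxField r y‖ = fluxNorm d r ‖y‖ := by
  unfold fluxField fluxNorm
  split_ifs
  · rw [norm_smul, norm_toComplex, Real.norm_of_nonneg]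
    have := sphereArea_pos hd
    positivity
  · simp

lemma measurable_fluxField : Measurable fun z : ℝ × Space d => fluxField z.1 z.2 := by
  unfold fluxField
  refine Measurable.ite (measurableSet_lt (by fun_prop) (by fun_prop)) ?_ measurable_const
  have m1 : Measurable fun z : ℝ × Space d => (sphereArea d * ‖z.2‖ ^ d)⁻¹ := by fun_prop
  exact m1.smul (continuous_toComplex.measurable.comp measurable_snd)

lemma pow_mul_fluxNorm_sq (hd : 3 ≤ d) {r t : ℝ} (ht : 0 < t) :
    t ^ (d - 1) * fluxNorm d r t ^ 2 =
      Set.indicator (Set.Ioi r) (fun t : ℝ => (sphereArea d ^ 2)⁻¹ * t ^ (1 - (d : ℝ))) t := by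
  unfold fluxNorm
  by_cases h : r < t
  · have e1 : t ^ (1 - (d : ℝ)) = (t ^ (d - 1))⁻¹ := by
      rw [← Real.rpow_natCast, ← Real.rpow_neg ht.le, Nat.cast_sub (by omega)]
      congr 1
      push_cast
      ring
    have e2 : t ^ d = t ^ (d - 1) * t := by rw [← pow_succ]; congr 1; omega
    rw [Set.indicator_of_mem (Set.mem_Ioi.2 h), if_pos h, e1, e2]
    have := sphereArea_pos (d := d) (by omega)
    field_simp
  · rw [Set.indicator_of_notMem (by simpa using h), if_neg h]
    simp

/-- In polar coordinates the squared norm has density proportional to t^{1-d} on t > r. It is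
integrable at infinity because d ≥ 3, and the truncation at r removes the singularity at the origin.
-/
lemma memLp_fluxField (hd : 3 ≤ d) {r : ℝ} (hr : 0 < r) :
    MemLp (fluxField r : Space d → _) 2 volume := by
  have hm : AEStronglyMeasurable (fluxField r : Space d → _) volume :=
    (measurable_fluxField.comp (measurable_const.prodMk measurable_id)).aestronglyMeasurable
  rw [memLp_two_iff_integrable_sq_norm hm]
  simp_rw [norm_fluxField (d := d) (by omega)]
  refine (integrable_norm_iff (by omega) fun t => fluxNorm d r t ^ 2).2 ?_
  have h1 : IntegrableOn (fun t : ℝ => (sphereArea d ^ 2)⁻¹ * t ^ (1 - (d : ℝ))) (Set.Ioi r)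
      volume := by
    refine Integrable.const_mul (integrableOn_Ioi_rpow_of_lt ?_ hr) _
    have : (3 : ℝ) ≤ d := by exact_mod_cast hd
    linarith
  have h2 := (integrable_indicator_iff measurableSet_Ioi).2 h1
  refine h2.integrableOn.congr_fun (fun t ht => ?_) measurableSet_Ioi
  exact (pow_mul_fluxNorm_sq hd ht).symm

lemma integral_norm_fluxField_sq (hd : 3 ≤ d) {r : ℝ} (hr : 0 < r) :
    ∫ y : Space d, ‖fluxField r y‖ ^ 2 = (sphereArea d * (d - 2))⁻¹ * r ^ (2 - (d : ℝ)) := by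
  have hd' : (3 : ℝ) ≤ d := by exact_mod_cast hd
  have hσ := sphereArea_pos (d := d) (by omega)
  simp_rw [norm_fluxField (d := d) (by omega)]
  rw [integral_norm_eq (by omega) fun t => fluxNorm d r t ^ 2]
  have h1 : ∫ t in Set.Ioi (0 : ℝ), t ^ (d - 1) • fluxNorm d r t ^ 2 =
      ∫ t in Set.Ioi (0 : ℝ), Set.indicator (Set.Ioi r)
        (fun t : ℝ => (sphereArea d ^ 2)⁻¹ * t ^ (1 - (d : ℝ))) t :=
    setIntegral_congr_fun measurableSet_Ioi fun t ht => pow_mul_fluxNorm_sq hd ht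
  rw [h1, setIntegral_indicator measurableSet_Ioi, Set.Ioi_inter_Ioi, sup_eq_right.2 hr.le,
    integral_const_mul, integral_Ioi_rpow_of_lt (by linarith) hr]
  have h2 : 1 - (d : ℝ) + 1 = 2 - d := by ring
  have h3 : (d : ℝ) - 2 ≠ 0 := by linarith
  have h4 : 2 - (d : ℝ) ≠ 0 := by linarith
  rw [h2, smul_eq_mul]
  field_simp
  ring

/-- The value at `x` of the radial function with gradient `g`. -/
def radialValue (g : Space d → EuclideanSpace ℂ (Fin d)) (x : Space d) : ℂ :=
  - ∫ y, inner ℂ (fluxField ‖x‖ y) (g y)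

/-- Cauchy–Schwarz against the flux field, whose L² norm is a constant times |x|^{-(d-2)/2}. Only
the gradient norm enters. -/
lemma norm_radialValue_le (hd : 3 ≤ d) {g : Space d → EuclideanSpace ℂ (Fin d)}
    (hg : MemLp g 2 volume) {x : Space d} (hx : x ≠ 0) :
    ‖radialValue g x‖ ≤ Real.sqrt ((sphereArea d * (d - 2))⁻¹ * ∫ y, ‖g y‖ ^ 2) *
      ‖x‖ ^ (-(((d : ℝ) - 2) / 2)) := by
  have hx0 : 0 < ‖x‖ := norm_pos_iff.2 hx
  have hd' : (3 : ℝ) ≤ d := by exact_mod_cast hd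
  have hσ := sphereArea_pos (d := d) (by omega)
  have hf := memLp_fluxField hd hx0
  have e : ∫ y, inner ℂ (fluxField ‖x‖ y) (g y) = inner ℂ hf.toLp hg.toLp := by
    rw [L2.inner_def]
    apply integral_congr_ae
    filter_upwards [hf.coeFn_toLp, hg.coeFn_toLp] with y h1 h2
    rw [h1, h2]
  rw [radialValue, norm_neg, e]
  refine (norm_inner_le_norm _ _).trans (le_of_eq ?_)
  rw [← Real.sqrt_sq (norm_nonneg hf.toLp), ← Real.sqrt_sq (norm_nonneg hg.toLp),
    norm_sq_eq_integral, norm_sq_eq_integral, integral_norm_fluxField_sq hd hx0,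
    ← Real.sqrt_mul (by have : (0 : ℝ) ≤ d - 2 := by linarith
                        positivity)]
  have e2 : ‖x‖ ^ (-(((d : ℝ) - 2) / 2)) = Real.sqrt (‖x‖ ^ (2 - (d : ℝ))) := by
    rw [Real.sqrt_eq_rpow, ← Real.rpow_mul hx0.le]
    congr 1
    ring
  rw [e2, ← Real.sqrt_mul (mul_nonneg (inv_nonneg.2 (mul_nonneg hσ.le (by linarith)))
    (integral_nonneg fun _ => by positivity))]
  congr 1
  ring

/-! ### A divergence identity representing radial functions by their gradients -/

/-- The radial primitive `∫_0^r η(t) t^{d-1} dt`. -/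
def radialPrimitive (d : ℕ) (η : ℝ → ℝ) (r : ℝ) : ℝ := ∫ t in (0 : ℝ)..r, t ^ (d - 1) * η t

section radialPrimitive

variable {η : ℝ → ℝ}

lemma hasDerivAt_radialPrimitive (hη : Continuous η) (r : ℝ) :
    HasDerivAt (radialPrimitive d η) (r ^ (d - 1) * η r) r := by
  have hc : Continuous fun t : ℝ => t ^ (d - 1) * η t := by fun_prop
  exact intervalIntegral.integral_hasDerivAt_right (hc.intervalIntegrable _ _)
    (hc.stronglyMeasurableAtFilter _ _) hc.continuousAt

lemma contDiff_radialPrimitive (hη : ContDiff ℝ ((⊤ : ℕ∞) : WithTop ℕ∞) η) :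
    ContDiff ℝ ((⊤ : ℕ∞) : WithTop ℕ∞) (radialPrimitive d η) := by
  rw [contDiff_infty_iff_deriv]
  refine ⟨fun r => (hasDerivAt_radialPrimitive hη.continuous r).differentiableAt, ?_⟩
  have : deriv (radialPrimitive d η) = fun r => r ^ (d - 1) * η r :=
    funext fun r => (hasDerivAt_radialPrimitive hη.continuous r).deriv
  rw [this]
  exact (contDiff_id.pow _).mul hη

lemma abs_radialPrimitive_le (hη : Continuous η) (hc : HasCompactSupport η) (r : ℝ) :
    |radialPrimitive d η r| ≤ ∫ t, |t ^ (d - 1) * η t| := by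
  have hi : Integrable (fun t : ℝ => t ^ (d - 1) * η t) volume :=
    Continuous.integrable_of_hasCompactSupport (by fun_prop) hc.mul_left
  refine (intervalIntegral.norm_integral_le_integral_norm_uIoc
    (f := fun t : ℝ => t ^ (d - 1) * η t)).trans ?_
  exact setIntegral_le_integral hi.norm (.of_forall fun t => norm_nonneg _)

lemma radialPrimitive_eq_zero {a : ℝ} (h : ∀ t, t ≤ a → η t = 0) {r : ℝ} (hr0 : 0 ≤ r)
    (hr : r ≤ a) : radialPrimitive d η r = 0 := by
  refine intervalIntegral.integral_zero_ae (.of_forall fun t ht => ?_)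
  rw [Set.uIoc_of_le hr0] at ht
  rw [h t (ht.2.trans hr), mul_zero]

lemma exists_pos_eq_zero_of_tsupport_subset (hs : tsupport η ⊆ Set.Ioi 0) :
    ∃ a : ℝ, 0 < a ∧ ∀ t, t ≤ a → η t = 0 := by
  have h0 : (tsupport η)ᶜ ∈ 𝓝 (0 : ℝ) :=
    (isClosed_tsupport η).isOpen_compl.mem_nhds fun h => lt_irrefl (0 : ℝ) (hs h)
  obtain ⟨ε, hε, hb⟩ := Metric.mem_nhds_iff.1 h0
  refine ⟨ε / 2, by positivity, fun t ht => ?_⟩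
  by_contra hne
  have h1 : t ∈ tsupport η := subset_tsupport _ hne
  have h2 : 0 < t := hs h1
  refine hb (?_ : t ∈ Metric.ball 0 ε) h1
  rw [mem_ball_zero_iff, Real.norm_of_nonneg h2.le]
  linarith

/-- The vector field `y ↦ y θ(y)` has divergence `η(|y|)`. -/
def radialPotential (d : ℕ) (η : ℝ → ℝ) (y : Space d) : ℝ :=
  radialPrimitive d η ‖y‖ / ‖y‖ ^ d

lemma radialPotential_eq_zero {a : ℝ} (h : ∀ t, t ≤ a → η t = 0) {y : Space d} (hy : ‖y‖ ≤ a) :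
    radialPotential d η y = 0 := by
  rw [radialPotential, radialPrimitive_eq_zero h (norm_nonneg _) hy, zero_div]

lemma contDiff_radialPotential (hη : ContDiff ℝ ((⊤ : ℕ∞) : WithTop ℕ∞) η) {a : ℝ} (ha : 0 < a)
    (h : ∀ t, t ≤ a → η t = 0) :
    ContDiff ℝ ((⊤ : ℕ∞) : WithTop ℕ∞) (radialPotential d η) := by
  rw [contDiff_iff_contDiffAt]
  intro y
  by_cases hy : y = 0
  · have h1 : radialPotential d η =ᶠ[𝓝 y] fun _ => 0 := by
      filter_upwards [Metric.ball_mem_nhds y ha] with z hz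
      rw [hy, mem_ball_zero_iff] at hz
      exact radialPotential_eq_zero h hz.le
    exact contDiffAt_const.congr_of_eventuallyEq h1
  · have h1 : ContDiffAt ℝ ((⊤ : ℕ∞) : WithTop ℕ∞) (fun y : Space d => ‖y‖) y :=
      contDiffAt_norm ℝ hy
    exact ((contDiff_radialPrimitive hη).contDiffAt.comp y h1).div (h1.pow d)
      (pow_ne_zero _ (norm_ne_zero_iff.2 hy))

/-- The left side is the divergence of y θ(y). The radial derivative of θ is computed along the ray
s ↦ s y, where θ is an explicit quotient; differentiating the denominator produces the term -d θ,
which cancels. -/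
lemma divergence_radialPotential (hη : ContDiff ℝ ((⊤ : ℕ∞) : WithTop ℕ∞) η) {a : ℝ} (ha : 0 < a)
    (h : ∀ t, t ≤ a → η t = 0) (hd : 0 < d) (y : Space d) :
    d * radialPotential d η y + fderiv ℝ (radialPotential d η) y y = η ‖y‖ := by
  by_cases hy : y = 0
  · subst hy
    rw [radialPotential_eq_zero h (by simpa using ha.le), h ‖(0 : Space d)‖ (by simpa using ha.le)]
    simp
  have hy0 : 0 < ‖y‖ := norm_pos_iff.2 hy
  have hdiff := ((contDiff_radialPotential (d := d) hη ha h).differentiable (by simp) y).hasFDerivAt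
  have h1 : HasDerivAt (fun s : ℝ => radialPotential d η (s • y))
      (fderiv ℝ (radialPotential d η) y y) 1 := by
    have h2 : HasDerivAt (fun s : ℝ => s • y) ((1 : ℝ) • y) 1 := (hasDerivAt_id 1).smul_const y
    rw [one_smul] at h2
    have h3 : HasFDerivAt (radialPotential d η) (fderiv ℝ (radialPotential d η) y)
        ((1 : ℝ) • y) := by rwa [one_smul]
    exact h3.comp_hasDerivAt 1 h2
  have h4 : HasDerivAt (fun s : ℝ => radialPrimitive d η (s * ‖y‖) / (s * ‖y‖) ^ d)
      (η ‖y‖ - d * radialPotential d η y) 1 := by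
    have h5 : HasDerivAt (fun s : ℝ => s * ‖y‖) ‖y‖ 1 := by
      simpa using (hasDerivAt_id (1 : ℝ)).mul_const ‖y‖
    have h6 : HasDerivAt (radialPrimitive d η) ((1 * ‖y‖) ^ (d - 1) * η (1 * ‖y‖)) (1 * ‖y‖) :=
      hasDerivAt_radialPrimitive hη.continuous _
    have h7 := (h6.comp (1 : ℝ) h5).div (h5.fun_pow d) (by rw [one_mul]; positivity)
    refine h7.congr_deriv ?_
    have e2 : ‖y‖ ^ d = ‖y‖ ^ (d - 1) * ‖y‖ := by rw [← pow_succ]; congr 1; omega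
    simp only [one_mul, Function.comp]
    rw [radialPotential, e2]
    field_simp
  have h8 : (fun s : ℝ => radialPotential d η (s • y)) =ᶠ[𝓝 1]
      fun s : ℝ => radialPrimitive d η (s * ‖y‖) / (s * ‖y‖) ^ d := by
    filter_upwards [lt_mem_nhds (zero_lt_one (α := ℝ))] with s hs
    rw [radialPotential, norm_smul, Real.norm_of_nonneg hs.le]
  have := h1.unique (h4.congr_of_eventuallyEq h8)
  rw [this]
  ring

/-- The field y θ(y) need not have compact support, but it is dominated by a flux field and hence
lies in L². This is what makes the cutoff argument for the divergence theorem work. -/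
lemma norm_smul_radialPotential_le (hd : 0 < d) (hη : Continuous η) (hc : HasCompactSupport η)
    {a : ℝ} (h : ∀ t, t ≤ a → η t = 0) (y : Space d) :
    |radialPotential d η y| * ‖y‖ ≤
      (sphereArea d * ∫ t, |t ^ (d - 1) * η t|) * ‖fluxField a y‖ := by
  have hσ := sphereArea_pos hd
  rw [norm_fluxField hd, fluxNorm]
  split_ifs with hy
  · rw [radialPotential, abs_div, abs_of_nonneg (by positivity : 0 ≤ ‖y‖ ^ d), mul_inv]
    have := abs_radialPrimitive_le (d := d) hη hc ‖y‖
    calc _ = (|radialPrimitive d η ‖y‖|) * ((‖y‖ ^ d)⁻¹ * ‖y‖) := by rw [div_eq_mul_inv, mul_assoc]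
      _ ≤ (∫ t, |t ^ (d - 1) * η t|) * ((‖y‖ ^ d)⁻¹ * ‖y‖) := by gcongr
      _ = _ := by field_simp
  · rw [radialPotential_eq_zero h (not_lt.1 hy)]
    simp

lemma integral_lt_norm (hd : 0 < d) (η : ℝ → ℝ) (R : ℝ) (hR : 0 ≤ R) :
    ∫ x : Space d, (if ‖x‖ < R then η ‖x‖ else 0) = sphereArea d * radialPrimitive d η R := by
  rw [integral_norm_eq hd fun t => if t < R then η t else 0, smul_eq_mul, radialPrimitive,
    intervalIntegral.integral_of_le hR, integral_Ioc_eq_integral_Ioo]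
  congr 1
  have : ∀ t : ℝ, t ^ (d - 1) • (if t < R then η t else 0) =
      Set.indicator (Set.Iio R) (fun t => t ^ (d - 1) * η t) t := by
    intro t
    by_cases ht : t < R
    · rw [Set.indicator_of_mem (Set.mem_Iio.2 ht), if_pos ht, smul_eq_mul]
    · rw [Set.indicator_of_notMem (by simpa using ht), if_neg ht, smul_zero]
  simp_rw [this]
  rw [setIntegral_indicator measurableSet_Iio, Set.Ioi_inter_Iio]

end radialPrimitive

lemma sum_coord_mul_apply_single (T : Space d →L[ℝ] ℝ) (y : Space d) :
    ∑ i, y i * T (EuclideanSpace.single i 1) = T y := by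
  have hy : y = ∑ j, y j • EuclideanSpace.single j (1 : ℝ) := by
    simpa using ((EuclideanSpace.basisFun (Fin d) ℝ).sum_repr y).symm
  conv_rhs => rw [hy]
  rw [map_sum]
  exact Finset.sum_congr rfl fun i _ => by rw [map_smul, smul_eq_mul]

/-- The weak gradient identities for the test functions ψ(y) yᵢ, summed over i. -/
lemma IsWeakGradient.integral_divergence {u : Space d → ℂ}
    {g : Space d → EuclideanSpace ℂ (Fin d)} (h : IsWeakGradient u g) {ψ : Space d → ℝ}
    (hψ : ContDiff ℝ ((⊤ : ℕ∞) : WithTop ℕ∞) ψ) (hc : HasCompactSupport ψ) :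
    ∫ y, (d * ψ y + fderiv ℝ ψ y y) • u y = - ∫ y, ψ y • inner ℂ (toComplex y) (g y) := by
  have hs : ∀ i : Fin d, ContDiff ℝ ((⊤ : ℕ∞) : WithTop ℕ∞) fun y : Space d => ψ y * y i :=
    fun i => hψ.mul (EuclideanSpace.proj (𝕜 := ℝ) i).contDiff
  have hcs : ∀ i : Fin d, HasCompactSupport fun y : Space d => ψ y * y i := fun i => hc.mul_right
  have hd : ∀ (i : Fin d) (y : Space d), fderiv ℝ (fun y : Space d => ψ y * y i) y
      (EuclideanSpace.single i 1) = ψ y + y i * fderiv ℝ ψ y (EuclideanSpace.single i 1) := by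
    intro i y
    have h1 : HasFDerivAt (fun y : Space d => ψ y * y i)
        (ψ y • (EuclideanSpace.proj (𝕜 := ℝ) i : Space d →L[ℝ] ℝ) + y i • fderiv ℝ ψ y) y :=
      (hψ.differentiable (by simp) y).hasFDerivAt.mul
        (EuclideanSpace.proj (𝕜 := ℝ) i : Space d →L[ℝ] ℝ).hasFDerivAt
    rw [h1.fderiv]
    simp
  have e1 : ∀ y, (d * ψ y + fderiv ℝ ψ y y) • u y =
      ∑ i, fderiv ℝ (fun y : Space d => ψ y * y i) y (EuclideanSpace.single i 1) • u y := by
    intro y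
    simp_rw [hd]
    rw [← Finset.sum_smul, Finset.sum_add_distrib, sum_coord_mul_apply_single]
    simp
  have e2 : ∀ y, ψ y • inner ℂ (toComplex y) (g y) = ∑ i, (ψ y * y i) • g y i := by
    intro y
    rw [inner_toComplex, Finset.smul_sum]
    simp_rw [smul_smul]
  simp_rw [e1, e2]
  rw [integral_finsetSum, integral_finsetSum, ← Finset.sum_neg_distrib]
  · exact Finset.sum_congr rfl fun i _ => h.2.2 _ (hs i) (hcs i) i
  · intro i _
    exact (locallyIntegrable_coord h.2.1 i).integrable_smul_left_of_hasCompactSupport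
      (hs i).continuous (hcs i)
  · intro i _
    exact h.1.integrable_smul_left_of_hasCompactSupport
      (continuous_fderiv_apply_const (hs i) _) (hasCompactSupport_fderiv_apply (hcs i) _)

lemma tendsto_integral_of_norm_le_inv {f : ℕ → Space d → ℂ} {b : Space d → ℝ}
    (hb : Integrable b volume) {C : ℝ}
    (h : ∀ n x, ‖f n x‖ ≤ C * ((n : ℝ) + 1)⁻¹ * b x) :
    Tendsto (fun n => ∫ x, f n x) atTop (𝓝 0) := by
  have h1 : Tendsto (fun n : ℕ => C * ((n : ℝ) + 1)⁻¹ * ∫ x, b x) atTop (𝓝 0) := by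
    have := (tendsto_one_div_add_atTop_nhds_zero_nat (𝕜 := ℝ)).const_mul C
    simpa using this.mul_const (∫ x, b x)
  refine squeeze_zero_norm (fun n => ?_) h1
  rw [← integral_const_mul]
  exact norm_integral_le_of_norm_le (hb.const_mul _) (.of_forall (h n))

lemma integrable_cutoff_smul {f : Space d → ℂ} (hf : Integrable f volume) (n : ℕ) :
    Integrable (fun y => cutoff d n y • f y) volume := by
  refine hf.mono ((cutoff_contDiff n (k := 1)).continuous.aestronglyMeasurable.smul hf.1)
    (.of_forall fun y => ?_)
  rw [norm_smul, Real.norm_of_nonneg (cutoff_nonneg n y)]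
  exact mul_le_of_le_one_left (norm_nonneg _) (cutoff_le_one n y)

lemma tendsto_integral_cutoff_smul {f : Space d → ℂ} (hf : Integrable f volume) :
    Tendsto (fun n => ∫ y, cutoff d n y • f y) atTop (𝓝 (∫ y, f y)) := by
  refine tendsto_integral_of_dominated_convergence (fun y => ‖f y‖)
    (fun n => (integrable_cutoff_smul hf n).1) hf.norm (fun n => .of_forall fun y => ?_)
    (.of_forall fun y => ?_)
  · rw [norm_smul, Real.norm_of_nonneg (cutoff_nonneg n y)]
    exact mul_le_of_le_one_left (norm_nonneg _) (cutoff_le_one n y)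
  · simpa using (cutoff_tendsto y).smul_const (f y)

lemma hasCompactSupport_comp_norm {η : ℝ → ℝ} (hc : HasCompactSupport η) :
    HasCompactSupport fun y : Space d => η ‖y‖ := by
  obtain ⟨R, hR⟩ := hc.isCompact.isBounded.subset_closedBall 0
  refine HasCompactSupport.intro (isCompact_closedBall 0 R) fun y hy => ?_
  by_contra hne
  have h1 := hR (subset_tsupport _ hne)
  rw [mem_closedBall_zero_iff, norm_norm] at h1
  exact hy (mem_closedBall_zero_iff.2 h1)

lemma integrable_comp_norm_smul {u : Space d → ℂ} (hu : LocallyIntegrable u volume) {η : ℝ → ℝ}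
    (hη : ContDiff ℝ ((⊤ : ℕ∞) : WithTop ℕ∞) η) (hc : HasCompactSupport η) :
    Integrable (fun y => η ‖y‖ • u y) volume :=
  hu.integrable_smul_left_of_hasCompactSupport (hη.continuous.comp continuous_norm)
    (hasCompactSupport_comp_norm hc)

section

variable {u : Space d → ℂ} {g : Space d → EuclideanSpace ℂ (Fin d)} {η : ℝ → ℝ}

lemma integrable_norm_fluxField_mul (hd : 3 ≤ d) {F : Type*} [NormedAddCommGroup F]
    {f : Space d → F} (hf : MemLp f 2 volume) {a : ℝ} (ha : 0 < a) :
    Integrable (fun y => ‖fluxField a y‖ * ‖f y‖) volume :=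
  (memLp_fluxField hd ha).norm.integrable_mul hf.norm

/-- The divergence theorem for the potential with divergence `η(|y|)`. -/
lemma HasH1Grad.integral_radial_smul (hd : 3 ≤ d) (h : HasH1Grad u g)
    (hη : ContDiff ℝ ((⊤ : ℕ∞) : WithTop ℕ∞) η) (hc : HasCompactSupport η) {a : ℝ} (ha : 0 < a)
    (h0 : ∀ t, t ≤ a → η t = 0) :
    ∫ y, η ‖y‖ • u y = - ∫ y, radialPotential d η y • inner ℂ (toComplex y) (g y) := by
  have hd0 : 0 < d := by omega
  set θ := radialPotential d η with hθ
  have hθs : ContDiff ℝ ((⊤ : ℕ∞) : WithTop ℕ∞) θ := contDiff_radialPotential hη ha h0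
  set C₁ := sphereArea d * ∫ t, |t ^ (d - 1) * η t| with hC₁
  have hθb : ∀ y, |θ y| * ‖y‖ ≤ C₁ * ‖fluxField a y‖ :=
    norm_smul_radialPotential_le hd0 hη.continuous hc h0
  obtain ⟨C, hC0, hC⟩ := exists_norm_fderiv_cutoff_le d
  have hχ : ∀ n, ContDiff ℝ ((⊤ : ℕ∞) : WithTop ℕ∞) (cutoff d n) := fun n => cutoff_contDiff n
  have hint := integrable_comp_norm_smul h.2.2.1 hη hc
  have hi1 := integrable_norm_fluxField_mul hd h.1 ha
  have hi2 := integrable_norm_fluxField_mul hd h.2.1 ha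
  -- The error from differentiating the cutoff: its gradient is O(1/(n+1)), and the remaining factor
  -- is a product of two L² functions, so the error vanishes in the limit.
  have hbound : ∀ n y, ‖(θ y * fderiv ℝ (cutoff d n) y y) • u y‖ ≤
      C * C₁ * ((n : ℝ) + 1)⁻¹ * (‖fluxField a y‖ * ‖u y‖) := by
    intro n y
    rw [norm_smul, Real.norm_eq_abs, abs_mul]
    calc |θ y| * |fderiv ℝ (cutoff d n) y y| * ‖u y‖
        ≤ |θ y| * (C * ((n : ℝ) + 1)⁻¹ * ‖y‖) * ‖u y‖ := by
          gcongr
          exact ((fderiv ℝ (cutoff d n) y).le_opNorm y).trans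
            (mul_le_mul_of_nonneg_right (hC n y) (norm_nonneg _))
      _ = (C * ((n : ℝ) + 1)⁻¹) * (|θ y| * ‖y‖) * ‖u y‖ := by ring
      _ ≤ (C * ((n : ℝ) + 1)⁻¹) * (C₁ * ‖fluxField a y‖) * ‖u y‖ := by
          gcongr C * _ * ?_ * _
          exact hθb y
      _ = _ := by ring
  have hint2 : Integrable (fun y => θ y • inner ℂ (toComplex y) (g y)) volume := by
    refine (hi2.const_mul C₁).mono' (hθs.continuous.aestronglyMeasurable.smul
      (continuous_toComplex.aestronglyMeasurable.inner h.2.1.1)) (.of_forall fun y => ?_)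
    rw [norm_smul, ← mul_assoc]
    calc ‖θ y‖ * ‖inner ℂ (toComplex y) (g y)‖ ≤ |θ y| * (‖y‖ * ‖g y‖) := by
          rw [Real.norm_eq_abs]
          gcongr
          exact (norm_inner_le_norm _ _).trans (by rw [norm_toComplex])
      _ = (|θ y| * ‖y‖) * ‖g y‖ := by ring
      _ ≤ _ := mul_le_mul_of_nonneg_right (hθb y) (norm_nonneg _)
  have key : ∀ n, (∫ y, cutoff d n y • (η ‖y‖ • u y)) +
      (∫ y, (θ y * fderiv ℝ (cutoff d n) y y) • u y) =
      - ∫ y, cutoff d n y • (θ y • inner ℂ (toComplex y) (g y)) := by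
    intro n
    have h1 := h.2.2.integral_divergence ((hχ n).mul hθs) (cutoff_hasCompactSupport n).mul_right
    have e1 : ∀ y, (d * (cutoff d n y * θ y) + fderiv ℝ (fun y => cutoff d n y * θ y) y y) • u y =
        cutoff d n y • (η ‖y‖ • u y) + (θ y * fderiv ℝ (cutoff d n) y y) • u y := by
      intro y
      have h2 : HasFDerivAt (fun y => cutoff d n y * θ y)
          (cutoff d n y • fderiv ℝ θ y + θ y • fderiv ℝ (cutoff d n) y) y :=
        ((hχ n).differentiable (by simp) y).hasFDerivAt.mul
          (hθs.differentiable (by simp) y).hasFDerivAt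
      rw [h2.fderiv, ← divergence_radialPotential hη ha h0 hd0 y, smul_smul, ← _root_.add_smul]
      congr 1
      simp only [add_apply, smul_apply, smul_eq_mul]
      ring
    have e2 : ∀ y, (cutoff d n y * θ y) • inner ℂ (toComplex y) (g y) =
        cutoff d n y • (θ y • inner ℂ (toComplex y) (g y)) := fun y => mul_smul _ _ _
    simp_rw [e1, e2] at h1
    rw [← h1, integral_add]
    · exact integrable_cutoff_smul hint n
    · exact (hi1.const_mul _).mono' ((hθs.continuous.mul (((hχ n).continuous_fderiv
        (by simp)).clm_apply continuous_id)).aestronglyMeasurable.smul h.1.1)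
        (.of_forall (hbound n))
  have t4 := (tendsto_integral_cutoff_smul hint).add
    (tendsto_integral_of_norm_le_inv hi1 hbound)
  simp_rw [key, add_zero] at t4
  exact tendsto_nhds_unique t4 (tendsto_integral_cutoff_smul hint2).neg

lemma aestronglyMeasurable_inner_fluxField (hg : MemLp g 2 volume) :
    AEStronglyMeasurable (fun z : Space d × Space d => inner ℂ (fluxField ‖z.1‖ z.2) (g z.2))
      (volume.prod volume) := by
  have h1 : Measurable fun z : Space d × Space d => fluxField ‖z.1‖ z.2 :=
    measurable_fluxField.comp ((measurable_norm.comp measurable_fst).prodMk measurable_snd)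
  have h2 : AEStronglyMeasurable (fun z : Space d × Space d => g z.2) (volume.prod volume) :=
    hg.1.comp_snd
  exact h1.aestronglyMeasurable.inner h2

lemma aestronglyMeasurable_radialValue (hg : MemLp g 2 volume) :
    AEStronglyMeasurable (radialValue g) volume :=
  (aestronglyMeasurable_inner_fluxField hg).integral_prod_right'.neg

/-- Fubini: exchanging the integrals leaves the integral of η(|x|) over |x| < |y|, which is the
sphere area times the radial primitive at |y|. The right side is exactly the one obtained for u from
the divergence theorem, so `radialValue g` and u have the same radial moments. -/
lemma integral_radial_smul_radialValue (hd : 3 ≤ d) (hg : MemLp g 2 volume)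
    (hη : ContDiff ℝ ((⊤ : ℕ∞) : WithTop ℕ∞) η) (hc : HasCompactSupport η) {a : ℝ} (ha : 0 < a)
    (h0 : ∀ t, t ≤ a → η t = 0) :
    ∫ x, η ‖x‖ • radialValue g x =
      - ∫ y, radialPotential d η y • inner ℂ (toComplex y) (g y) := by
  have hd0 : 0 < d := by omega
  have hηi : Integrable (fun x : Space d => η ‖x‖) volume :=
    (hη.continuous.comp continuous_norm).integrable_of_hasCompactSupport
      (hasCompactSupport_comp_norm hc)
  have hi := integrable_norm_fluxField_mul hd hg ha
  have hprod : Integrable (Function.uncurry fun x y : Space d =>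
      η ‖x‖ • inner ℂ (fluxField ‖x‖ y) (g y)) (volume.prod volume) := by
    refine (hηi.norm.mul_prod hi).mono' ?_ (.of_forall fun z => ?_)
    · have m1 : Continuous fun z : Space d × Space d => η ‖z.1‖ :=
        (hη.continuous.comp continuous_norm).comp continuous_fst
      exact m1.aestronglyMeasurable.smul (aestronglyMeasurable_inner_fluxField hg)
    · obtain ⟨x, y⟩ := z
      simp only [Function.uncurry]
      rw [norm_smul]
      by_cases hx : ‖x‖ ≤ a
      · rw [h0 _ hx]
        simp
      · refine mul_le_mul_of_nonneg_left ((norm_inner_le_norm _ _).trans ?_) (norm_nonneg _)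
        refine mul_le_mul_of_nonneg_right ?_ (norm_nonneg _)
        -- On the support of η(|x|) one has |x| > a, so the field truncated at |x| is dominated by
        -- the one truncated at a; this bounds the double integrand by a product.
        rw [norm_fluxField hd0, norm_fluxField hd0, fluxNorm, fluxNorm]
        have hσ := sphereArea_pos hd0
        split_ifs with h1 h2
        · exact le_rfl
        · exact absurd ((not_le.1 hx).trans h1) h2
        · positivity
        · exact le_rfl
  have e1 : ∀ x, η ‖x‖ • radialValue g x =
      - ∫ y, η ‖x‖ • inner ℂ (fluxField ‖x‖ y) (g y) := by
    intro x
    rw [radialValue, smul_neg, integral_smul]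
  simp_rw [e1]
  rw [integral_neg, integral_integral_swap hprod]
  congr 2 with y
  have e2 : ∀ x : Space d, η ‖x‖ • inner ℂ (fluxField ‖x‖ y) (g y) =
      (if ‖x‖ < ‖y‖ then η ‖x‖ else 0) •
        ((sphereArea d * ‖y‖ ^ d)⁻¹ • inner ℂ (toComplex y) (g y)) := by
    intro x
    unfold fluxField
    split_ifs with h
    · congr 1
      rw [← Complex.coe_smul, inner_smul_left, Complex.conj_ofReal, Complex.real_smul]
    · simp
  simp_rw [e2]
  rw [integral_smul_const, integral_lt_norm hd0 η ‖y‖ (norm_nonneg _), smul_smul]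
  congr 1
  have hσ := sphereArea_pos hd0
  rw [radialPotential, mul_inv]
  field_simp

/-- A radial function in `H¹` is almost everywhere determined by the flux of its gradient. -/
lemma HasH1Grad.ae_eq_radialValue (hd : 3 ≤ d) (h : HasH1Grad u g) (hr : IsRadial u) :
    u =ᵐ[volume] radialValue g := by
  have hd0 : 0 < d := by omega
  have hd' : (3 : ℝ) ≤ d := by exact_mod_cast hd
  have hv : LocallyIntegrable (radialValue g) volume := by
    intro x
    refine ⟨Metric.ball 0 (‖x‖ + 1), Metric.isOpen_ball.mem_nhds (by simp), ?_⟩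
    have h1 := (integrableOn_ball_norm_rpow (d := d) hd0
      (s := -(((d : ℝ) - 2) / 2)) (by linarith) (‖x‖ + 1)).const_mul
      (Real.sqrt ((sphereArea d * (d - 2))⁻¹ * ∫ y, ‖g y‖ ^ 2))
    refine h1.mono' (aestronglyMeasurable_radialValue h.2.1).restrict ?_
    have := nontrivial_space hd0
    have h2 : ∀ᵐ y : Space d, y ≠ 0 := by
      simp [ae_iff]
    filter_upwards [ae_restrict_of_ae h2] with y hy
    exact norm_radialValue_le hd h.2.1 hy
  have hz : (fun x => u x - radialValue g x) =ᵐ[volume] 0 := by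
    refine ae_eq_zero_of_integral_radial hd0 (h.2.2.1.sub hv) ?_ fun η hη hc hs => ?_
    · obtain ⟨f, hf⟩ := hr
      refine ⟨fun r => f r - (- ∫ y, inner ℂ (fluxField r y) (g y)), ?_⟩
      filter_upwards [hf] with x hx
      rw [hx, radialValue]
    · obtain ⟨a, ha, h0⟩ := exists_pos_eq_zero_of_tsupport_subset hs
      simp_rw [smul_sub]
      rw [integral_sub (integrable_comp_norm_smul h.2.2.1 hη hc)
        (integrable_comp_norm_smul hv hη hc), h.integral_radial_smul hd hη hc ha h0,
        integral_radial_smul_radialValue hd h.2.1 hη hc ha h0, sub_self]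
  filter_upwards [hz] with x hx
  exact sub_eq_zero.1 hx

end

lemma ae_ne_zero (hd : 0 < d) : ∀ᵐ y : Space d, y ≠ 0 := by
  have := nontrivial_space hd
  simp [ae_iff]

/-! ### Compactness in the critical Lebesgue space and an energy maximizer -/

/-- The exponent `2 + 4/d` of the critical Gagliardo–Nirenberg inequality. -/
def critExp (d : ℕ) : ℝ := 2 + 4 / d

lemma critExp_gt_two (hd : 0 < d) : 2 < critExp d := by
  have : (0 : ℝ) < d := by exact_mod_cast hd
  have : (0 : ℝ) < 4 / d := by positivity
  unfold critExp
  linarith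

lemma MemH1.integrable_rpow (hd : 3 ≤ d) {u : Space d → ℂ} (hu : MemH1 u) :
    Integrable (fun x => ‖u x‖ ^ critExp d) volume := by
  have h := (hu.memLp_power hd).integrable_norm_rpow (by
    have := critExp_gt_two (d := d) (by omega)
    rw [critExp] at this
    simpa using (by linarith : (0 : ℝ) < 2 + 4 / d)) ENNReal.ofReal_ne_top
  have := critExp_gt_two (d := d) (by omega)
  rw [critExp] at this
  rwa [ENNReal.toReal_ofReal (by linarith)] at h

/-- Split the power 2 + 4/d: the factor |u|^{4/d} is uniformly small outside a large ball by the
radial decay, and |u|² is controlled by the mass. -/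
lemma setIntegral_compl_ball_le (hd : 3 ≤ d) {u : Space d → ℂ} (hu : MemH1 u) {C : ℝ} (hC : 0 ≤ C)
    (hb : ∀ᵐ x, ‖u x‖ ≤ C * ‖x‖ ^ (-(((d : ℝ) - 2) / 2))) {R : ℝ} (hR : 0 < R) :
    ∫ x in (Metric.ball 0 R)ᶜ, ‖u x‖ ^ critExp d ≤
      (C * R ^ (-(((d : ℝ) - 2) / 2))) ^ (4 / (d : ℝ)) * massSq u := by
  have hd' : (3 : ℝ) ≤ d := by exact_mod_cast hd
  rw [massSq, ← integral_const_mul]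
  have hi := hu.integrable_sq.const_mul ((C * R ^ (-(((d : ℝ) - 2) / 2))) ^ (4 / (d : ℝ)))
  refine (setIntegral_mono_on_ae (hu.integrable_rpow hd).integrableOn hi.integrableOn
    Metric.isOpen_ball.measurableSet.compl ?_).trans
    (setIntegral_le_integral hi (.of_forall fun x => by positivity))
  filter_upwards [hb] with x hx hxR
  have hxR' : R ≤ ‖x‖ := by simpa using hxR
  have e : ‖u x‖ ^ critExp d = ‖u x‖ ^ (4 / (d : ℝ)) * ‖u x‖ ^ 2 := by
    rw [critExp, ← Real.rpow_natCast, ← Real.rpow_add_of_nonneg (norm_nonneg _) (by positivity)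
      (by positivity), add_comm]
    norm_num
  rw [e]
  gcongr
  refine hx.trans ?_
  gcongr ?_ * ?_
  exact Real.rpow_le_rpow_of_nonpos hR hxR' (by linarith)

/-- Radially decaying sequences bounded in `L²` which converge almost everywhere converge in the
critical Lebesgue space. -/
lemma tendsto_integral_rpow (hd : 3 ≤ d) {v : ℕ → Space d → ℂ} {w : Space d → ℂ} {C M : ℝ}
    (hC : 0 ≤ C) (hv : ∀ n, MemH1 (v n)) (hw : MemH1 w)
    (hvb : ∀ n, ∀ᵐ x, ‖v n x‖ ≤ C * ‖x‖ ^ (-(((d : ℝ) - 2) / 2)))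
    (hwb : ∀ᵐ x, ‖w x‖ ≤ C * ‖x‖ ^ (-(((d : ℝ) - 2) / 2)))
    (hvM : ∀ n, massSq (v n) ≤ M) (hwM : massSq w ≤ M)
    (hlim : ∀ᵐ x, Tendsto (fun n => v n x) atTop (𝓝 (w x))) :
    Tendsto (fun n => ∫ x, ‖v n x‖ ^ critExp d) atTop (𝓝 (∫ x, ‖w x‖ ^ critExp d)) := by
  have hd' : (3 : ℝ) ≤ d := by exact_mod_cast hd
  have hq := critExp_gt_two (d := d) (by omega)
  set s := -(((d : ℝ) - 2) / 2) with hs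
  have htail : Tendsto (fun R : ℝ => (C * R ^ s) ^ (4 / (d : ℝ)) * M) atTop (𝓝 0) := by
    have h1 : Tendsto (fun R : ℝ => R ^ s) atTop (𝓝 0) :=
      tendsto_rpow_neg_atTop (by linarith : 0 < ((d : ℝ) - 2) / 2)
    have h2 := (h1.const_mul C).rpow_const (p := 4 / (d : ℝ)) (Or.inr (by positivity))
    rw [mul_zero, Real.zero_rpow (by positivity)] at h2
    simpa using h2.mul_const M
  have hin : ∀ R : ℝ, Tendsto (fun n => ∫ x in Metric.ball 0 R, ‖v n x‖ ^ critExp d) atTop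
      (𝓝 (∫ x in Metric.ball 0 R, ‖w x‖ ^ critExp d)) := by
    intro R
    refine tendsto_integral_of_dominated_convergence
      (fun x => C ^ critExp d * ‖x‖ ^ (s * critExp d))
      (fun n => ((hv n).integrable_rpow hd).1.restrict) ?_ (fun n => ?_) ?_
    · refine (integrableOn_ball_norm_rpow (by omega) ?_ R).const_mul _
      -- The dominating power of |x| exceeds -d by 4/d, so it is integrable near the origin: the
      -- decay bound alone controls the singularity there.
      have : s * critExp d = -(d : ℝ) + 4 / d := by
        rw [hs, critExp]
        field_simp
        ring
      rw [this]
      have : (0 : ℝ) < 4 / d := by positivity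
      linarith
    · filter_upwards [ae_restrict_of_ae (hvb n)] with x hx
      rw [Real.norm_of_nonneg (by positivity), Real.rpow_mul (norm_nonneg _),
        ← Real.mul_rpow hC (by positivity)]
      exact Real.rpow_le_rpow (norm_nonneg _) hx (by linarith)
    · filter_upwards [ae_restrict_of_ae hlim] with x hx
      exact hx.norm.rpow_const (Or.inr (by linarith))
  have hout : ∀ {u : Space d → ℂ}, MemH1 u → (∀ᵐ x, ‖u x‖ ≤ C * ‖x‖ ^ s) → massSq u ≤ M →
      ∀ R > 0, |(∫ x, ‖u x‖ ^ critExp d) - ∫ x in Metric.ball 0 R, ‖u x‖ ^ critExp d| ≤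
        (C * R ^ s) ^ (4 / (d : ℝ)) * M := by
    intro u hu hub huM R hR
    rw [← integral_add_compl Metric.isOpen_ball.measurableSet (hu.integrable_rpow hd) (s := Metric.ball 0 R),
      add_sub_cancel_left, abs_of_nonneg (integral_nonneg fun x => by positivity)]
    exact (setIntegral_compl_ball_le hd hu hC hub hR).trans (by gcongr)
  rw [Metric.tendsto_atTop]
  intro ε hε
  obtain ⟨R, hR0, hR⟩ : ∃ R : ℝ, 0 < R ∧ (C * R ^ s) ^ (4 / (d : ℝ)) * M < ε / 3 := by
    have := (htail.eventually (gt_mem_nhds (by positivity : 0 < ε / 3))).and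
      (eventually_gt_atTop 0)
    obtain ⟨R, h1, h2⟩ := this.exists
    exact ⟨R, h2, h1⟩
  obtain ⟨N, hN⟩ := Metric.tendsto_atTop.1 (hin R) (ε / 3) (by positivity)
  refine ⟨N, fun n hn => ?_⟩
  have h1 := hN n hn
  have h2 := hout (hv n) (hvb n) (hvM n) R hR0
  have h3 := hout hw hwb hwM R hR0
  rw [Real.dist_eq] at h1 ⊢
  rw [abs_lt] at h1 ⊢
  rw [abs_le] at h2 h3
  constructor <;> linarith [h1.1, h1.2, h2.1, h2.2, h3.1, h3.2]

section jets

variable {m γ : ℝ}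

/-- Jets of radial functions. -/
def IsRadialJet (m γ : ℝ) (F : JetSpace d) : Prop :=
  F ∈ jetSubmodule d m γ ∧ BallSymmetric (jetFun m γ F)

lemma IsRadialJet.hasH1Grad (hm : 0 < m) (hγ : 0 < γ) {F : JetSpace d}
    (hF : IsRadialJet m γ F) : HasH1Grad (jetFun m γ F) fun x => (F x).snd :=
  (mem_jetSubmodule_iff hm hγ F).1 hF.1

lemma IsRadialJet.isRadial (hd : 0 < d) (hm : 0 < m) (hγ : 0 < γ) {F : JetSpace d}
    (hF : IsRadialJet m γ F) : IsRadial (jetFun m γ F) :=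
  hF.2.isRadial hd (hF.hasH1Grad hm hγ).2.2.1

lemma energy_jetFun (hd : 3 ≤ d) (hm : 0 < m) (hγ : 0 < γ) {F : JetSpace d}
    (hF : F ∈ jetSubmodule d m γ) : energy m γ (jetFun m γ F) = ‖F‖ ^ 2 := by
  have h := (mem_jetSubmodule_iff hm hγ F).1 hF
  rw [← h.norm_jet_sq hd hm hγ]
  congr 2
  refine Lp.ext ?_
  filter_upwards [(h.memLp_jet hd hm hγ).coeFn_toLp] with x hx
  rw [hx, jet_jetFun hm hγ]

lemma integral_norm_snd_sq_le (F : JetSpace d) : ∫ x, ‖(F x).snd‖ ^ 2 ≤ ‖F‖ ^ 2 := by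
  have h := norm_sq_eq_integral (Lp.memLp F)
  rw [Lp.toLp_coeFn] at h
  rw [h]
  refine integral_mono ((Lp.memLp F).prodLp_snd.integrable_norm_pow (p := 2) (by norm_num))
    ((Lp.memLp F).integrable_norm_pow (p := 2) (by norm_num)) fun x => ?_
  simp only
  rw [WithLp.prod_norm_sq_eq_of_L2]
  exact le_add_of_nonneg_left (by positivity)

lemma massSq_nonneg (u : Space d → ℂ) : 0 ≤ massSq u := integral_nonneg fun _ => by positivity

lemma kineticSq_nonneg (hγ : 0 < γ) (u : Space d → ℂ) : 0 ≤ kineticSq γ u :=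
  add_nonneg (integral_nonneg fun _ => by positivity) (integral_nonneg fun _ => by positivity)

lemma massSq_le_energy (hm : 0 < m) (hγ : 0 < γ) (u : Space d → ℂ) :
    massSq u ≤ m⁻¹ * energy m γ u := by
  rw [energy, mul_add, inv_mul_cancel_left₀ hm.ne']
  exact le_add_of_nonneg_right (mul_nonneg (by positivity) (kineticSq_nonneg hγ u))

/-- The constant in the pointwise bound for radial functions. -/
def decayConst (d : ℕ) : ℝ := Real.sqrt (sphereArea d * (d - 2))⁻¹

lemma IsRadialJet.norm_le (hd : 3 ≤ d) (hm : 0 < m) (hγ : 0 < γ) {F : JetSpace d}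
    (hF : IsRadialJet m γ F) : ∀ᵐ x, ‖jetFun m γ F x‖ ≤
      decayConst d * ‖F‖ * ‖x‖ ^ (-(((d : ℝ) - 2) / 2)) := by
  have h := hF.hasH1Grad hm hγ
  have hd' : (3 : ℝ) ≤ d := by exact_mod_cast hd
  have hσ := sphereArea_pos (d := d) (by omega)
  filter_upwards [h.ae_eq_radialValue hd (hF.isRadial (by omega) hm hγ), ae_ne_zero (by omega)]
    with x hx hx0
  rw [hx]
  refine (norm_radialValue_le hd h.2.1 hx0).trans ?_
  gcongr
  rw [decayConst, ← Real.sqrt_sq (norm_nonneg F), ← Real.sqrt_mul (inv_nonneg.2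
    (mul_nonneg hσ.le (by linarith)))]
  refine Real.sqrt_le_sqrt ?_
  refine mul_le_mul_of_nonneg_left ?_ (inv_nonneg.2 (mul_nonneg hσ.le (by linarith)))
  exact integral_norm_snd_sq_le F

lemma memLp_fluxJet (hd : 3 ≤ d) {r : ℝ} (hr : 0 < r) :
    MemLp (fun x => (WithLp.toLp 2 (0, fluxField r x) : Jet d)) 2 volume :=
  MemLp.of_fst_of_snd_prodLp ⟨MemLp.zero, memLp_fluxField hd hr⟩

/-- Evaluation at a point x ≠ 0 is the pairing with a fixed L² jet, so weakly convergent radial jets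
converge pointwise almost everywhere. -/
lemma radialValue_eq_inner (hd : 3 ≤ d) {x : Space d} (hx : x ≠ 0) (F : JetSpace d) :
    radialValue (fun y => (F y).snd) x =
      - inner ℂ (memLp_fluxJet hd (norm_pos_iff.2 hx)).toLp F := by
  rw [radialValue, L2.inner_def]
  congr 1
  apply integral_congr_ae
  filter_upwards [(memLp_fluxJet hd (norm_pos_iff.2 hx)).coeFn_toLp] with y hy
  rw [hy, WithLp.prod_inner_apply]
  simp

lemma memLp_ballJet (hm : 0 < m) (hγ : 0 < γ) (x : Space d) (ε : ℝ) :
    MemLp (fun y => (WithLp.toLp 2 ((weight m γ y)⁻¹ •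
      (Metric.closedBall x ε).indicator (fun _ => (1 : ℂ)) y, 0) : Jet d)) 2 volume := by
  refine MemLp.of_fst_of_snd_prodLp ⟨?_, MemLp.zero⟩
  refine MemLp.weight_inv_mul hm hγ (f := (Metric.closedBall x ε).indicator fun _ => (1 : ℂ)) ?_
  exact memLp_indicator_const 2 Metric.isClosed_closedBall.measurableSet 1
    (Or.inr measure_closedBall_lt_top.ne)

lemma setIntegral_jetFun_eq_inner (hm : 0 < m) (hγ : 0 < γ) (x : Space d) (ε : ℝ)
    (F : JetSpace d) : ∫ y in Metric.closedBall x ε, jetFun m γ F y =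
      inner ℂ (memLp_ballJet hm hγ x ε).toLp F := by
  rw [L2.inner_def, ← integral_indicator Metric.isClosed_closedBall.measurableSet]
  apply integral_congr_ae
  filter_upwards [(memLp_ballJet hm hγ x ε).coeFn_toLp] with y hy
  rw [hy, WithLp.prod_inner_apply]
  by_cases hyx : y ∈ Metric.closedBall x ε
  · rw [Set.indicator_of_mem hyx, Set.indicator_of_mem hyx]
    simp [jetFun, mul_comm]
  · rw [Set.indicator_of_notMem hyx, Set.indicator_of_notMem hyx]
    simp

/-- Both conditions are equations between pairings with fixed jets: test jets for the weak gradient,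
weighted indicators of balls for radial symmetry. -/
lemma IsRadialJet.of_tendsto (hm : 0 < m) (hγ : 0 < γ) {F : ℕ → JetSpace d} {G : JetSpace d}
    (hF : ∀ n, IsRadialJet m γ (F n))
    (hlim : ∀ y, Tendsto (fun n => inner ℂ y (F n)) atTop (𝓝 (inner ℂ y G))) :
    IsRadialJet m γ G := by
  constructor
  · rw [jetSubmodule, Submodule.mem_orthogonal]
    intro y hy
    refine tendsto_nhds_unique (hlim y) ?_
    have : ∀ n, inner ℂ y (F n) = 0 := fun n => (Submodule.mem_orthogonal _ _).1 (hF n).1 y hy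
    simp_rw [this]
    exact tendsto_const_nhds
  · intro x y ε hxy
    have h1 := hlim (memLp_ballJet hm hγ x ε).toLp
    have h2 := hlim (memLp_ballJet hm hγ y ε).toLp
    simp_rw [← setIntegral_jetFun_eq_inner hm hγ] at h1 h2
    refine tendsto_nhds_unique h1 (h2.congr fun n => ?_)
    exact ((hF n).2 x y ε hxy).symm

/-- The critical Lebesgue norm is weakly continuous on bounded sets of radial jets. -/
lemma IsRadialJet.tendsto_integral_rpow (hd : 3 ≤ d) (hm : 0 < m) (hγ : 0 < γ)
    {F : ℕ → JetSpace d} {G : JetSpace d} (hF : ∀ n, IsRadialJet m γ (F n)) {r : ℝ}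
    (hFr : ∀ n, ‖F n‖ ≤ r) (hGr : ‖G‖ ≤ r)
    (hlim : ∀ y, Tendsto (fun n => inner ℂ y (F n)) atTop (𝓝 (inner ℂ y G))) :
    Tendsto (fun n => ∫ x, ‖jetFun m γ (F n) x‖ ^ critExp d) atTop
      (𝓝 (∫ x, ‖jetFun m γ G x‖ ^ critExp d)) := by
  have hG := IsRadialJet.of_tendsto hm hγ hF hlim
  have hr : 0 ≤ r := (norm_nonneg _).trans hGr
  have hb : ∀ F : JetSpace d, IsRadialJet m γ F → ‖F‖ ≤ r →
      ∀ᵐ x, ‖jetFun m γ F x‖ ≤ decayConst d * r * ‖x‖ ^ (-(((d : ℝ) - 2) / 2)) := by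
    intro F hF hFr
    filter_upwards [hF.norm_le hd hm hγ] with x hx
    refine hx.trans ?_
    have : 0 ≤ decayConst d := Real.sqrt_nonneg _
    gcongr
  have hM : ∀ F : JetSpace d, IsRadialJet m γ F → ‖F‖ ≤ r →
      massSq (jetFun m γ F) ≤ m⁻¹ * r ^ 2 := by
    intro F hF hFr
    refine (massSq_le_energy hm hγ _).trans ?_
    rw [energy_jetFun hd hm hγ hF.1]
    gcongr
  refine NLKG.tendsto_integral_rpow hd (mul_nonneg (Real.sqrt_nonneg _) hr)
    (fun n => ((hF n).hasH1Grad hm hγ).memH1) (hG.hasH1Grad hm hγ).memH1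
    (fun n => hb _ (hF n) (hFr n)) (hb _ hG hGr) (fun n => hM _ (hF n) (hFr n)) (hM _ hG hGr) ?_
  have h1 : ∀ᵐ x, ∀ n, jetFun m γ (F n) x = radialValue (fun y => (F n y).snd) x :=
    ae_all_iff.2 fun n =>
      ((hF n).hasH1Grad hm hγ).ae_eq_radialValue hd ((hF n).isRadial (by omega) hm hγ)
  filter_upwards [h1, (hG.hasH1Grad hm hγ).ae_eq_radialValue hd (hG.isRadial (by omega) hm hγ),
    ae_ne_zero (by omega)] with x hx hxG hx0
  rw [hxG]
  simp_rw [hx, radialValue_eq_inner hd hx0]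
  exact (hlim _).neg

end jets

/-- The critical power `∫ |u|^{2+4/d}`. -/
def critPow (u : Space d → ℂ) : ℝ := ∫ x, ‖u x‖ ^ critExp d

lemma critPow_nonneg (u : Space d → ℂ) : 0 ≤ critPow u := integral_nonneg fun _ => by positivity

lemma critPow_congr {u v : Space d → ℂ} (h : u =ᵐ[volume] v) : critPow u = critPow v := by
  apply integral_congr_ae
  filter_upwards [h] with x hx
  rw [hx]

section

variable {m γ : ℝ}

lemma BallSymmetric.congr {u v : Space d → ℂ} (hu : BallSymmetric u) (h : u =ᵐ[volume] v) :
    BallSymmetric v := by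
  intro x y ε hxy
  rw [← setIntegral_congr_ae (g := v) (f := u) Metric.isClosed_closedBall.measurableSet
    (h.mono fun z hz _ => hz), ← setIntegral_congr_ae (g := v) (f := u)
    Metric.isClosed_closedBall.measurableSet (h.mono fun z hz _ => hz)]
  exact hu x y ε hxy

lemma isRadialJet_zero (hm : 0 < m) (hγ : 0 < γ) : IsRadialJet m γ (0 : JetSpace d) := by
  refine ⟨Submodule.zero_mem _, fun x y ε _ => ?_⟩
  rw [setIntegral_jetFun_eq_inner hm hγ, setIntegral_jetFun_eq_inner hm hγ]
  simp

lemma HasH1Grad.jetFun_toLp (hd : 3 ≤ d) (hm : 0 < m) (hγ : 0 < γ) {u : Space d → ℂ}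
    {g : Space d → EuclideanSpace ℂ (Fin d)} (h : HasH1Grad u g) :
    jetFun m γ (h.memLp_jet hd hm hγ).toLp =ᵐ[volume] u := by
  filter_upwards [(h.memLp_jet hd hm hγ).coeFn_toLp] with x hx
  rw [← congrFun (jetFun_jet hm hγ u g) x]
  simp only [jetFun]
  rw [hx]

lemma HasH1Grad.isRadialJet (hd : 3 ≤ d) (hm : 0 < m) (hγ : 0 < γ) {u : Space d → ℂ}
    {g : Space d → EuclideanSpace ℂ (Fin d)} (h : HasH1Grad u g) (hr : IsRadial u) :
    IsRadialJet m γ (h.memLp_jet hd hm hγ).toLp :=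
  ⟨h.toLp_mem hd hm hγ, hr.ballSymmetric.congr (h.jetFun_toLp hd hm hγ).symm⟩

/-- The direct method: the closed unit ball is weakly sequentially compact and the critical power is
weakly continuous on its radial part. -/
lemma exists_isRadialJet_max (hd : 3 ≤ d) (hm : 0 < m) (hγ : 0 < γ) :
    ∃ G : JetSpace d, IsRadialJet m γ G ∧ ‖G‖ ≤ 1 ∧
      ∀ F : JetSpace d, IsRadialJet m γ F → ‖F‖ ≤ 1 →
        critPow (jetFun m γ F) ≤ critPow (jetFun m γ G) := by
  set S : Set ℝ := {s | ∃ F : JetSpace d, IsRadialJet m γ F ∧ ‖F‖ ≤ 1 ∧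
    s = critPow (jetFun m γ F)} with hS
  have key : ∀ F : ℕ → JetSpace d, (∀ n, IsRadialJet m γ (F n)) → (∀ n, ‖F n‖ ≤ 1) →
      ∃ (G : JetSpace d) (φ : ℕ → ℕ), StrictMono φ ∧ IsRadialJet m γ G ∧ ‖G‖ ≤ 1 ∧
        Tendsto (fun n => critPow (jetFun m γ (F (φ n)))) atTop (𝓝 (critPow (jetFun m γ G))) := by
    intro F hF hF1
    obtain ⟨G, φ, hφ, hG, hlim⟩ := exists_weakly_convergent_subseq F 1 hF1
    exact ⟨G, φ, hφ, IsRadialJet.of_tendsto hm hγ (fun n => hF (φ n)) hlim, hG,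
      IsRadialJet.tendsto_integral_rpow hd hm hγ (fun n => hF (φ n)) (fun n => hF1 _) hG hlim⟩
  have hne : S.Nonempty := ⟨_, 0, isRadialJet_zero hm hγ, by simp, rfl⟩
  -- Boundedness comes from the same compactness: along a sequence with V > n, some subsequence
  -- would have convergent V.
  have hbdd : BddAbove S := by
    by_contra hnb
    have h1 : ∀ n : ℕ, ∃ F : JetSpace d, IsRadialJet m γ F ∧ ‖F‖ ≤ 1 ∧
        (n : ℝ) < critPow (jetFun m γ F) := by
      intro n
      obtain ⟨s, ⟨F, hF, hF1, rfl⟩, hs⟩ := not_bddAbove_iff.1 hnb n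
      exact ⟨F, hF, hF1, hs⟩
    choose F hF hF1 hFn using h1
    obtain ⟨G, φ, hφ, -, -, hlim⟩ := key F hF hF1
    refine not_tendsto_atTop_of_tendsto_nhds hlim (tendsto_atTop_mono (fun n => (hFn (φ n)).le) ?_)
    exact tendsto_natCast_atTop_atTop.comp hφ.tendsto_atTop
  obtain ⟨s, -, hs, hsS⟩ := exists_seq_tendsto_sSup hne hbdd
  choose F hF hF1 hFs using hsS
  obtain ⟨G, φ, hφ, hG, hG1, hlim⟩ := key F hF hF1
  have hsup : critPow (jetFun m γ G) = sSup S := by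
    refine tendsto_nhds_unique hlim ((hs.comp hφ.tendsto_atTop).congr fun n => ?_)
    exact hFs _
  exact ⟨G, hG, hG1, fun F hF hF1 => hsup ▸ le_csSup hbdd ⟨F, hF, hF1, rfl⟩⟩

/-- The critical power is maximized on the unit ball of the energy. -/
lemma exists_energy_maximizer (hd : 3 ≤ d) (hm : 0 < m) (hγ : 0 < γ) :
    ∃ w : Space d → ℂ, MemH1 w ∧ IsRadial w ∧ energy m γ w ≤ 1 ∧
      ∀ u : Space d → ℂ, MemH1 u → IsRadial u → energy m γ u ≤ 1 → critPow u ≤ critPow w := by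
  obtain ⟨G, hG, hG1, hmax⟩ := exists_isRadialJet_max hd hm hγ
  refine ⟨jetFun m γ G, (hG.hasH1Grad hm hγ).memH1, hG.isRadial (by omega) hm hγ, ?_, ?_⟩
  · rw [energy_jetFun hd hm hγ hG.1]
    exact pow_le_one₀ (norm_nonneg _) hG1
  · intro u hu hr hu1
    have h := hu.hasH1Grad
    rw [← critPow_congr (h.jetFun_toLp hd hm hγ)]
    refine hmax _ (h.isRadialJet hd hm hγ hr) ?_
    rw [← h.norm_jet_sq hd hm hγ] at hu1
    exact (sq_le_one_iff₀ (norm_nonneg _)).1 hu1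

end

/-! ### Scaling laws and positivity -/

section scaling

variable {u : Space d → ℂ} {b : ℝ}

lemma integral_comp_smul_space {F : Type*} [NormedAddCommGroup F] [NormedSpace ℝ F]
    (f : Space d → F) (hb : 0 < b) : ∫ x, f (b • x) = (b ^ d)⁻¹ • ∫ x, f x := by
  rw [Measure.integral_comp_smul, finrank_euclideanSpace, Fintype.card_fin,
    abs_of_pos (by positivity)]

lemma massSq_rescale (u : Space d → ℂ) (a : ℂ) (hb : 0 < b) :
    massSq (fun x => a * u (b • x)) = ‖a‖ ^ 2 * (b ^ d)⁻¹ * massSq u := by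
  unfold massSq
  simp_rw [norm_mul, mul_pow]
  rw [integral_const_mul, integral_comp_smul_space (fun x => ‖u x‖ ^ 2) hb, smul_eq_mul, mul_assoc]

lemma critPow_rescale (u : Space d → ℂ) (a : ℂ) (hb : 0 < b) :
    critPow (fun x => a * u (b • x)) = ‖a‖ ^ critExp d * (b ^ d)⁻¹ * critPow u := by
  unfold critPow
  simp_rw [norm_mul, Real.mul_rpow (norm_nonneg a) (norm_nonneg _)]
  rw [integral_const_mul, integral_comp_smul_space (fun x => ‖u x‖ ^ critExp d) hb, smul_eq_mul,
    mul_assoc]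

/-- The inverse-square potential has the same homogeneity as the squared gradient, so both parts of
T pick up the same factor. At the origin both potential terms are zero by the convention for
division by zero. -/
lemma kineticSq_rescale (hu : MemH1 u) (γ : ℝ) (a : ℂ) (hb : 0 < b) :
    kineticSq γ (fun x => a * u (b • x)) = ‖a‖ ^ 2 * b ^ 2 * (b ^ d)⁻¹ * kineticSq γ u := by
  rw [(hu.hasH1Grad.rescale a hb.ne').kineticSq_eq γ, kineticSq]
  have e1 : ∀ x, ‖a • b • weakGrad u (b • x)‖ ^ 2 =
      (‖a‖ ^ 2 * b ^ 2) * ‖weakGrad u (b • x)‖ ^ 2 := by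
    intro x
    rw [norm_smul, norm_smul, Real.norm_of_nonneg hb.le]
    ring
  have e2 : ∀ x : Space d, γ / ‖x‖ ^ 2 * ‖a * u (b • x)‖ ^ 2 =
      (‖a‖ ^ 2 * b ^ 2) * (γ / ‖b • x‖ ^ 2 * ‖u (b • x)‖ ^ 2) := by
    intro x
    rw [norm_mul, norm_smul, Real.norm_of_nonneg hb.le]
    rcases eq_or_ne x 0 with rfl | hx
    · simp
    have := norm_ne_zero_iff.2 hx
    field_simp
  simp_rw [e1, e2]
  rw [integral_const_mul, integral_const_mul,
    integral_comp_smul_space (fun x => ‖weakGrad u x‖ ^ 2) hb,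
    integral_comp_smul_space (fun x => γ / ‖x‖ ^ 2 * ‖u x‖ ^ 2) hb, smul_eq_mul, smul_eq_mul]
  ring

lemma MemH1.rescale (hu : MemH1 u) (a : ℂ) (hb : 0 < b) : MemH1 fun x => a * u (b • x) :=
  (hu.hasH1Grad.rescale a hb.ne').memH1

lemma IsRadial.rescale (hu : IsRadial u) (a : ℂ) (hb : 0 < b) :
    IsRadial fun x => a * u (b • x) := by
  obtain ⟨f, hf⟩ := hu
  refine ⟨fun r => a * f (b * r), ?_⟩
  have h := (quasiMeasurePreserving_continuousLinearEquiv (dilation d b hb.ne')).ae hf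
  filter_upwards [h] with x hx
  rw [dilation_apply] at hx
  rw [hx, norm_smul, Real.norm_of_nonneg hb.le]

lemma massSq_eq_zero_iff (hu : MemH1 u) : massSq u = 0 ↔ u =ᵐ[volume] 0 := by
  rw [massSq, integral_eq_zero_iff_of_nonneg (fun x => by positivity) hu.integrable_sq]
  constructor
  · intro h
    filter_upwards [h] with x hx
    simpa using hx
  · intro h
    filter_upwards [h] with x hx
    simp [hx]

lemma critPow_eq_zero_iff (hd : 3 ≤ d) (hu : MemH1 u) : critPow u = 0 ↔ u =ᵐ[volume] 0 := by
  have hq := critExp_gt_two (d := d) (by omega)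
  rw [critPow, integral_eq_zero_iff_of_nonneg (fun x => by positivity) (hu.integrable_rpow hd)]
  constructor
  · intro h
    filter_upwards [h] with x hx
    have := (Real.rpow_eq_zero (norm_nonneg (u x)) (by linarith)).1 hx
    simpa using this
  · intro h
    filter_upwards [h] with x hx
    rw [hx]
    simp [Real.zero_rpow (by linarith : critExp d ≠ 0)]

lemma kineticSq_pos (hd : 3 ≤ d) {γ : ℝ} (hγ : 0 < γ) (hu : MemH1 u)
    (h0 : ¬ u =ᵐ[volume] 0) : 0 < kineticSq γ u := by
  refine (kineticSq_nonneg hγ u).lt_of_ne fun h => h0 ?_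
  have h1 : (∫ x, γ / ‖x‖ ^ 2 * ‖u x‖ ^ 2) = 0 := by
    have i1 : 0 ≤ ∫ x, ‖weakGrad u x‖ ^ 2 := integral_nonneg fun _ => by positivity
    have i2 : 0 ≤ ∫ x, γ / ‖x‖ ^ 2 * ‖u x‖ ^ 2 := integral_nonneg fun _ => by positivity
    rw [kineticSq] at h
    linarith
  rw [integral_eq_zero_iff_of_nonneg (fun x => by positivity) (hu.integrable_potential hd γ)] at h1
  filter_upwards [h1, ae_ne_zero (by omega)] with x hx hx0
  have := norm_ne_zero_iff.2 hx0
  simpa [hγ.ne', hx0] using hx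

lemma MemH1RadNonzero.massSq_pos (h : MemH1RadNonzero u) : 0 < massSq u :=
  (massSq_nonneg u).lt_of_ne fun h0 => h.2.2 ((massSq_eq_zero_iff h.1).1 h0.symm)

lemma MemH1RadNonzero.critPow_pos (hd : 3 ≤ d) (h : MemH1RadNonzero u) : 0 < critPow u :=
  (critPow_nonneg u).lt_of_ne fun h0 => h.2.2 ((critPow_eq_zero_iff hd h.1).1 h0.symm)

lemma MemH1RadNonzero.rescale (h : MemH1RadNonzero u) {a : ℂ} (ha : a ≠ 0) (hb : 0 < b) :
    MemH1RadNonzero fun x => a * u (b • x) := by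
  refine ⟨h.1.rescale a hb, h.2.1.rescale a hb, fun h0 => ?_⟩
  have h1 := (massSq_eq_zero_iff (h.1.rescale a hb)).2 h0
  rw [massSq_rescale u a hb] at h1
  have := h.massSq_pos
  have : 0 < ‖a‖ := norm_pos_iff.2 ha
  have : 0 < ‖a‖ ^ 2 * (b ^ d)⁻¹ * massSq u := by positivity
  linarith

end scaling

lemma hasH1Grad_ofReal {ψ : Space d → ℝ} (hψ : ContDiff ℝ ((⊤ : ℕ∞) : WithTop ℕ∞) ψ)
    (hc : HasCompactSupport ψ) :
    HasH1Grad (fun x => (ψ x : ℂ)) fun x =>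
      WithLp.toLp 2 fun i => ((fderiv ℝ ψ x (EuclideanSpace.single i 1) : ℝ) : ℂ) := by
  have hd := fun i : Fin d => continuous_fderiv_apply_const hψ (EuclideanSpace.single i 1)
  have hdc := fun i : Fin d => hasCompactSupport_fderiv_apply hc (EuclideanSpace.single i 1)
  refine hasH1Grad_of_integral (hψ.continuous.memLp_of_hasCompactSupport hc).ofReal
    (MemLp.of_eval_piLp fun i => ((hd i).memLp_of_hasCompactSupport (hdc i)).ofReal)
    fun φ hφ hφc i => ?_
  have hφd := continuous_fderiv_apply_const hφ (EuclideanSpace.single i 1)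
  have h := integral_mul_fderiv_eq_neg_fderiv_mul_of_integrable (𝕜 := ℝ)
    (μ := (volume : Measure (Space d))) (f := ψ) (g := φ) (v := EuclideanSpace.single i 1)
    (((hd i).mul hφ.continuous).integrable_of_hasCompactSupport hφc.mul_left)
    ((hψ.continuous.mul hφd).integrable_of_hasCompactSupport hc.mul_right)
    ((hψ.continuous.mul hφ.continuous).integrable_of_hasCompactSupport hc.mul_right)
    (fun x _ => hψ.differentiable (by simp) x) (fun x _ => hφ.differentiable (by simp) x)
  have e1 : ∀ x, fderiv ℝ φ x (EuclideanSpace.single i 1) • (ψ x : ℂ) =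
      ((ψ x * fderiv ℝ φ x (EuclideanSpace.single i 1) : ℝ) : ℂ) := by
    intro x
    rw [Complex.real_smul]
    push_cast
    ring
  have e2 : ∀ x, φ x • ((fderiv ℝ ψ x (EuclideanSpace.single i 1) : ℝ) : ℂ) =
      ((fderiv ℝ ψ x (EuclideanSpace.single i 1) * φ x : ℝ) : ℂ) := by
    intro x
    rw [Complex.real_smul]
    push_cast
    ring
  simp_rw [e1, e2]
  rw [integral_complex_ofReal, integral_complex_ofReal, h]
  push_cast
  rfl

/-- There are nonzero radial functions in `H¹`. -/
lemma exists_memH1RadNonzero (d : ℕ) : ∃ u : Space d → ℂ, MemH1RadNonzero u := by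
  set ψ : Space d → ℝ := fun x => Real.smoothTransition (2 - ‖x‖ ^ 2) with hψ
  have hs : ContDiff ℝ ((⊤ : ℕ∞) : WithTop ℕ∞) ψ :=
    Real.smoothTransition.contDiff.comp (contDiff_const.sub (contDiff_norm_sq ℝ))
  have hc : HasCompactSupport ψ := by
    refine HasCompactSupport.intro (isCompact_closedBall 0 2) fun x hx => ?_
    have hx' : 2 < ‖x‖ := by simpa using hx
    exact Real.smoothTransition.zero_of_nonpos (by nlinarith)
  refine ⟨fun x => (ψ x : ℂ), (hasH1Grad_ofReal hs hc).memH1,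
    ⟨fun r => ((Real.smoothTransition (2 - r ^ 2) : ℝ) : ℂ), .rfl⟩, fun h => ?_⟩
  have hcont : Continuous fun x => (ψ x : ℂ) := Complex.continuous_ofReal.comp hs.continuous
  have h1 := congrFun (hcont.ae_eq_iff_eq volume continuous_zero |>.1 h) 0
  simp [hψ, Real.smoothTransition.one_of_one_le] at h1

/-! ### The weighted arithmetic–geometric inequality -/

/-- The maximum of `x^{2/d} y` subject to `x + y = 1`. -/
def profileMax (d : ℕ) : ℝ := (2 / ((d : ℝ) + 2)) ^ (2 / (d : ℝ)) * (d / ((d : ℝ) + 2))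

lemma profileMax_pos (hd : 0 < d) : 0 < profileMax d := by
  have : (0 : ℝ) < d := by exact_mod_cast hd
  unfold profileMax
  positivity

/-- Normalizing x and y by their optimal shares of x + y writes the deficit as one exponential, so
the inequality and its equality case both reduce to log t ≤ t - 1. -/
lemma rpow_mul_eq_profile (hd : 0 < d) {x y : ℝ} (hx : 0 < x) (hy : 0 < y) :
    x ^ (2 / (d : ℝ)) * y = profileMax d * (x + y) ^ (1 + 2 / (d : ℝ)) *
      Real.exp (2 / d * Real.log (((d : ℝ) + 2) / 2 * (x / (x + y))) +
        Real.log (((d : ℝ) + 2) / d * (y / (x + y)))) := by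
  have hd' : (0 : ℝ) < d := by exact_mod_cast hd
  have hs : 0 < x + y := by positivity
  rw [Real.exp_add, Real.exp_log (by positivity), mul_comm (2 / (d : ℝ)) (Real.log _),
    Real.exp_mul, Real.exp_log (by positivity), Real.mul_rpow (by positivity) (by positivity),
    Real.div_rpow hx.le hs.le, profileMax, Real.rpow_add hs, Real.rpow_one,
    Real.div_rpow zero_le_two (by positivity), Real.div_rpow (by positivity) zero_le_two]
  have h1 : (x + y) ^ (2 / (d : ℝ)) ≠ 0 := by positivity
  have h2 : ((d : ℝ) + 2) ^ (2 / (d : ℝ)) ≠ 0 := by positivity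
  have h3 : (2 : ℝ) ^ (2 / (d : ℝ)) ≠ 0 := by positivity
  field_simp

/-- The bound log t ≤ t - 1 is spent on y only, the linear terms cancelling because the shares sum
to 1. The logarithm in x is kept so that strictness can be used when x is not at its optimal share.
-/
lemma profile_exponent_le (hd : 0 < d) {x y : ℝ} (hx : 0 < x) (hy : 0 < y) :
    2 / d * Real.log (((d : ℝ) + 2) / 2 * (x / (x + y))) +
        Real.log (((d : ℝ) + 2) / d * (y / (x + y))) ≤
      2 / d * (Real.log (((d : ℝ) + 2) / 2 * (x / (x + y))) -
        (((d : ℝ) + 2) / 2 * (x / (x + y)) - 1)) := by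
  have hd' : (0 : ℝ) < d := by exact_mod_cast hd
  have hs : 0 < x + y := by positivity
  have h := Real.log_le_sub_one_of_pos (by positivity : 0 < ((d : ℝ) + 2) / d * (y / (x + y)))
  have e : 2 / d * (((d : ℝ) + 2) / 2 * (x / (x + y)) - 1) +
      (((d : ℝ) + 2) / d * (y / (x + y)) - 1) = 0 := by
    field_simp
    ring
  linarith

lemma rpow_mul_le_profile (hd : 0 < d) {x y : ℝ} (hx : 0 < x) (hy : 0 < y) :
    x ^ (2 / (d : ℝ)) * y ≤ profileMax d * (x + y) ^ (1 + 2 / (d : ℝ)) := by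
  have hd' : (0 : ℝ) < d := by exact_mod_cast hd
  have := profileMax_pos hd
  rw [rpow_mul_eq_profile hd hx hy]
  refine mul_le_of_le_one_right (by positivity) (Real.exp_le_one_iff.2 ?_)
  refine (profile_exponent_le hd hx hy).trans (mul_nonpos_of_nonneg_of_nonpos (by positivity) ?_)
  linarith [Real.log_le_sub_one_of_pos (by positivity : 0 < ((d : ℝ) + 2) / 2 * (x / (x + y)))]

lemma eq_of_profile_le (hd : 0 < d) {x y : ℝ} (hx : 0 < x) (hy : 0 < y)
    (h : profileMax d * (x + y) ^ (1 + 2 / (d : ℝ)) ≤ x ^ (2 / (d : ℝ)) * y) :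
    x = 2 / ((d : ℝ) + 2) * (x + y) := by
  have hd' : (0 : ℝ) < d := by exact_mod_cast hd
  have hs : 0 < x + y := by positivity
  have hp := profileMax_pos hd
  by_contra hne
  rw [rpow_mul_eq_profile hd hx hy] at h
  have h1 := le_of_mul_le_mul_left ((mul_one _).le.trans h) (by positivity)
  rw [Real.one_le_exp_iff] at h1
  have h2 := h1.trans (profile_exponent_le hd hx hy)
  have h3 := Real.log_lt_sub_one_of_pos
    (by positivity : 0 < ((d : ℝ) + 2) / 2 * (x / (x + y))) (by
      intro h4
      apply hne
      field_simp at h4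
      field_simp
      linarith)
  have h5 : 2 / (d : ℝ) * (Real.log (((d : ℝ) + 2) / 2 * (x / (x + y))) -
        (((d : ℝ) + 2) / 2 * (x / (x + y)) - 1)) < 0 :=
    mul_neg_of_pos_of_neg (by positivity) (by linarith)
  linarith

/-! ### The sharp radial Gagliardo–Nirenberg inequality -/

section gagliardoNirenberg

variable {γ : ℝ}

/-- The family a u(b·) reaches every pair of positive values of M and T and preserves V / (M^{2/d}
T). The dilation b is fixed by the ratio T/M, the amplitude a then by M. -/
lemma MemH1RadNonzero.exists_rescale (hd : 3 ≤ d) (hγ : 0 < γ) {u : Space d → ℂ}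
    (hu : MemH1RadNonzero u) {M T : ℝ} (hM : 0 < M) (hT : 0 < T) :
    ∃ v : Space d → ℂ, MemH1RadNonzero v ∧ massSq v = M ∧ kineticSq γ v = T ∧
      critPow v * (massSq u ^ (2 / (d : ℝ)) * kineticSq γ u) =
        critPow u * (M ^ (2 / (d : ℝ)) * T) := by
  have hd' : (0 : ℝ) < d := by exact_mod_cast (by omega : 0 < d)
  have hM0 := hu.massSq_pos
  have hT0 := kineticSq_pos hd hγ hu.1 hu.2.2
  set M₀ := massSq u
  set T₀ := kineticSq γ u
  set b := Real.sqrt (T * M₀ / (T₀ * M)) with hb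
  have hbp : 0 < b := Real.sqrt_pos.2 (by positivity)
  have hb2 : b ^ 2 = T * M₀ / (T₀ * M) := Real.sq_sqrt (by positivity)
  set a := Real.sqrt (M * b ^ d / M₀) with ha
  have hap : 0 < a := Real.sqrt_pos.2 (by positivity)
  have ha2 : a ^ 2 = M * b ^ d / M₀ := Real.sq_sqrt (by positivity)
  have hna : ‖(a : ℂ)‖ = a := by rw [Complex.norm_real, Real.norm_of_nonneg hap.le]
  have hbd : b ^ d ≠ 0 := by positivity
  refine ⟨fun x => (a : ℂ) * u (b • x), hu.rescale (by exact_mod_cast hap.ne') hbp, ?_, ?_, ?_⟩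
  · rw [massSq_rescale u _ hbp, hna, ha2]
    change M * b ^ d / M₀ * (b ^ d)⁻¹ * M₀ = M
    field_simp
  · rw [kineticSq_rescale hu.1 γ _ hbp, hna, ha2, hb2]
    change M * b ^ d / M₀ * (T * M₀ / (T₀ * M)) * (b ^ d)⁻¹ * T₀ = T
    field_simp
  · rw [critPow_rescale u _ hbp, hna]
    have e1 : a ^ critExp d = (M / M₀) ^ (2 / (d : ℝ)) * (M / M₀) * (b ^ d * b ^ 2) := by
      have h1 : critExp d = 2 * (1 + 2 / (d : ℝ)) := by unfold critExp; ring
      have h2 : M * b ^ d / M₀ = M / M₀ * b ^ d := by ring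
      rw [h1, Real.rpow_mul hap.le, Real.rpow_two, ha2, h2,
        Real.mul_rpow (by positivity) (by positivity), add_comm, Real.rpow_add (by positivity),
        Real.rpow_one]
      congr 1
      rw [Real.rpow_add (by positivity), Real.rpow_one, mul_comm, ← Real.rpow_natCast b d,
        ← Real.rpow_mul hbp.le]
      have : (d : ℝ) * (2 / d) = 2 := by field_simp
      rw [this, Real.rpow_two]
    rw [e1, hb2, Real.div_rpow hM.le hM0.le]
    have h3 : M₀ ^ (2 / (d : ℝ)) ≠ 0 := by positivity
    field_simp

/-- The sharp Gagliardo–Nirenberg inequality for radial functions. -/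
lemma exists_sharp_gagliardoNirenberg (hd : 3 ≤ d) (hγ : 0 < γ) :
    ∃ C : ℝ, 0 < C ∧
      (∀ u : Space d → ℂ, MemH1 u → IsRadial u →
        critPow u ≤ C * (massSq u ^ (2 / (d : ℝ)) * kineticSq γ u)) ∧
      ∃ w : Space d → ℂ, MemH1RadNonzero w ∧
        critPow w = C * (massSq w ^ (2 / (d : ℝ)) * kineticSq γ w) := by
  have hd0 : 0 < d := by omega
  have hd' : (0 : ℝ) < d := by exact_mod_cast hd0
  have hκ := profileMax_pos hd0
  obtain ⟨w, hw, hwr, hw1, hmax⟩ := exists_energy_maximizer (d := d) hd one_pos hγ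
  have hmax' : ∀ u : Space d → ℂ, MemH1RadNonzero u → massSq u + kineticSq γ u ≤ 1 →
      critPow u ≤ critPow w := fun u hu h =>
    hmax u hu.1 hu.2.1 (by rw [energy, one_mul]; exact h)
  rw [energy, one_mul] at hw1
  have hVw : 0 < critPow w := by
    obtain ⟨u, hu⟩ := exists_memH1RadNonzero d
    obtain ⟨v, hv, hvM, hvT, -⟩ := hu.exists_rescale hd hγ one_half_pos one_half_pos
    exact (hv.critPow_pos hd).trans_le (hmax' v hv (by rw [hvM, hvT]; norm_num))
  have hw0 : MemH1RadNonzero w :=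
    ⟨hw, hwr, fun h => hVw.ne' ((critPow_eq_zero_iff hd hw).2 h)⟩
  have key : ∀ u : Space d → ℂ, MemH1RadNonzero u →
      critPow u * profileMax d ≤ critPow w * (massSq u ^ (2 / (d : ℝ)) * kineticSq γ u) := by
    intro u hu
    -- Rescale u to the optimal shares M = 2/(d+2), T = d/(d+2): then M + T = 1, so v competes with
    -- w, and M^{2/d} T equals `profileMax d`.
    obtain ⟨v, hv, hvM, hvT, hvV⟩ := hu.exists_rescale hd hγ
      (by positivity : 0 < 2 / ((d : ℝ) + 2)) (by positivity : 0 < (d : ℝ) / ((d : ℝ) + 2))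
    rw [profileMax, ← hvV]
    have h1 := hmax' v hv (by rw [hvM, hvT]; apply le_of_eq; field_simp; ring)
    exact mul_le_mul_of_nonneg_right h1
      (mul_nonneg (Real.rpow_nonneg (massSq_nonneg _) _) (kineticSq_nonneg hγ _))
  refine ⟨critPow w / profileMax d, by positivity, fun u hu hr => ?_, w, hw0, ?_⟩
  · by_cases h0 : u =ᵐ[volume] 0
    · rw [(critPow_eq_zero_iff hd hu).2 h0]
      exact mul_nonneg (by positivity)
        (mul_nonneg (Real.rpow_nonneg (massSq_nonneg _) _) (kineticSq_nonneg hγ _))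
    · rw [div_mul_eq_mul_div, le_div_iff₀ hκ]
      exact key u ⟨hu, hr, h0⟩
  -- For w itself M + T ≤ 1 gives M^{2/d} T ≤ κ, while the inequality just proved, applied to w,
  -- gives the reverse; hence w is an extremal.
  · have h1 := key w hw0
    have hM := hw0.massSq_pos
    have hT := kineticSq_pos hd hγ hw hw0.2.2
    have h2 := rpow_mul_le_profile hd0 hM hT
    have h3 : (massSq w + kineticSq γ w) ^ (1 + 2 / (d : ℝ)) ≤ 1 :=
      Real.rpow_le_one (by positivity) hw1 (by positivity)
    have h4 : massSq w ^ (2 / (d : ℝ)) * kineticSq γ w ≤ profileMax d :=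
      h2.trans (mul_le_of_le_one_right hκ.le h3)
    have h5 : profileMax d ≤ massSq w ^ (2 / (d : ℝ)) * kineticSq γ w :=
      le_of_mul_le_mul_left h1 hVw
    rw [le_antisymm h4 h5]
    field_simp

end gagliardoNirenberg

/-! ### First variation of the action -/

section firstVariation

variable {m γ : ℝ} {u v : Space d → ℂ} {g k : Space d → EuclideanSpace ℂ (Fin d)}

lemma MemH1.add_smul (hu : MemH1 u) (hv : MemH1 v) (c : ℂ) : MemH1 fun x => u x + c * v x :=
  (hu.hasH1Grad.add_smul hv.hasH1Grad c).memH1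

lemma IsRadial.add_smul (hu : IsRadial u) (hv : IsRadial v) (c : ℂ) :
    IsRadial fun x => u x + c * v x := by
  obtain ⟨f, hf⟩ := hu
  obtain ⟨f', hf'⟩ := hv
  refine ⟨fun r => f r + c * f' r, ?_⟩
  filter_upwards [hf, hf'] with x hx hx'
  rw [hx, hx']

lemma energy_add_smul (hd : 3 ≤ d) (hm : 0 < m) (hγ : 0 < γ) (hu : HasH1Grad u g)
    (hv : HasH1Grad v k) (s : ℝ) :
    energy m γ (fun x => u x + (s : ℂ) * v x) = energy m γ u +
      s * (2 * (inner ℂ (hu.memLp_jet hd hm hγ).toLp (hv.memLp_jet hd hm hγ).toLp).re) +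
      s ^ 2 * energy m γ v := by
  have h := hu.add_smul hv (s : ℂ)
  have e : (h.memLp_jet hd hm hγ).toLp =
      (hu.memLp_jet hd hm hγ).toLp + (s : ℂ) • (hv.memLp_jet hd hm hγ).toLp := by
    rw [← MemLp.toLp_const_smul, ← MemLp.toLp_add]
    refine MemLp.toLp_congr _ _ (.of_forall fun x => ?_)
    refine congrArg (WithLp.toLp 2) (Prod.ext ?_ rfl)
    change weight m γ x • (u x + s * v x) = weight m γ x • u x + (s : ℂ) • weight m γ x • v x
    rw [smul_add, smul_comm (s : ℂ), smul_eq_mul]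
  rw [← h.norm_jet_sq hd hm hγ, ← hu.norm_jet_sq hd hm hγ, ← hv.norm_jet_sq hd hm hγ, e,
    norm_add_sq (𝕜 := ℂ), inner_smul_right, norm_smul, mul_pow]
  simp
  ring

lemma hasDerivAt_energy_line (hd : 3 ≤ d) (hm : 0 < m) (hγ : 0 < γ) (hu : HasH1Grad u g)
    (hv : HasH1Grad v k) :
    HasDerivAt (fun s : ℝ => energy m γ (fun x => u x + (s : ℂ) * v x))
      (2 * (inner ℂ (hu.memLp_jet hd hm hγ).toLp (hv.memLp_jet hd hm hγ).toLp).re) 0 := by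
  simp_rw [energy_add_smul hd hm hγ hu hv]
  set c := 2 * (inner ℂ (hu.memLp_jet hd hm hγ).toLp (hv.memLp_jet hd hm hγ).toLp).re
  have h1 := (((hasDerivAt_id (0 : ℝ)).mul_const c).const_add (energy m γ u)).add
    (((hasDerivAt_id (0 : ℝ)).fun_pow 2).mul_const (energy m γ v))
  refine h1.congr_deriv ?_
  simp

lemma hasDerivAt_norm_rpow_line {q : ℝ} (hq : 1 < q) (a b : ℂ) (s : ℝ) :
    HasDerivAt (fun s : ℝ => ‖a + (s : ℂ) * b‖ ^ q)
      (q * ‖a + (s : ℂ) * b‖ ^ (q - 2) * inner ℝ (a + (s : ℂ) * b) b) s := by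
  have h1 : HasDerivAt (fun s : ℝ => a + (s : ℂ) * b) b s := by
    have := ((hasDerivAt_id s).ofReal_comp.mul_const b).const_add a
    simpa using this
  have h2 := (hasFDerivAt_norm_rpow (a + (s : ℂ) * b) hq).comp_hasDerivAt s h1
  refine h2.congr_deriv ?_
  rw [_root_.smul_apply, innerSL_apply_apply, smul_eq_mul]

lemma norm_rpow_line_deriv_le {q : ℝ} (hq : 2 < q) (a b : ℂ) {s : ℝ} (hs : |s| ≤ 1) :
    ‖q * ‖a + (s : ℂ) * b‖ ^ (q - 2) * inner ℝ (a + (s : ℂ) * b) b‖ ≤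
      q * (‖a‖ + ‖b‖) ^ q := by
  have h1 : ‖a + (s : ℂ) * b‖ ≤ ‖a‖ + ‖b‖ := by
    refine (norm_add_le _ _).trans (add_le_add le_rfl ?_)
    rw [norm_mul, Complex.norm_real, Real.norm_eq_abs]
    exact mul_le_of_le_one_left (norm_nonneg _) hs
  have h0 : 0 ≤ ‖a‖ + ‖b‖ := by positivity
  rw [norm_mul, Real.norm_of_nonneg (by positivity : 0 ≤ q * ‖a + (s : ℂ) * b‖ ^ (q - 2)),
    mul_assoc]
  refine mul_le_mul_of_nonneg_left ?_ (by linarith)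
  calc ‖a + (s : ℂ) * b‖ ^ (q - 2) * ‖inner ℝ (a + (s : ℂ) * b) b‖
      ≤ (‖a‖ + ‖b‖) ^ (q - 2) * ((‖a‖ + ‖b‖) * (‖a‖ + ‖b‖)) := by
        refine mul_le_mul (Real.rpow_le_rpow (norm_nonneg _) h1 (by linarith)) ?_
          (norm_nonneg _) (by positivity)
        refine (norm_inner_le_norm _ _).trans (mul_le_mul h1 ?_ (norm_nonneg _) h0)
        linarith [norm_nonneg a]
    _ = (‖a‖ + ‖b‖) ^ q := by
        rw [← sq, ← Real.rpow_natCast, ← Real.rpow_add_of_nonneg h0 (by linarith) (by norm_num)]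
        norm_num

/-- Differentiation under the integral for |s| < 1; the derivative is dominated by q (|u| + |v|)^q
with q = 2 + 4/d, integrable by the embedding of H¹. -/
lemma hasDerivAt_critPow_line (hd : 3 ≤ d) (hu : MemH1 u) (hv : MemH1 v) :
    HasDerivAt (fun s : ℝ => critPow (fun x => u x + (s : ℂ) * v x))
      (∫ x, critExp d * ‖u x‖ ^ (critExp d - 2) * inner ℝ (u x) (v x)) 0 := by
  have hq := critExp_gt_two (d := d) (by omega)
  have hm : ∀ s : ℝ, AEStronglyMeasurable (fun x => u x + (s : ℂ) * v x) volume := fun s =>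
    (hu.add_smul hv s).1.1
  have hpow : MemLp (fun x => ‖u x‖ + ‖v x‖) (ENNReal.ofReal (critExp d)) volume :=
    (hu.memLp_power hd).norm.add (hv.memLp_power hd).norm
  have hb : Integrable (fun x => critExp d * (‖u x‖ + ‖v x‖) ^ critExp d) volume := by
    have h1 := hpow.integrable_norm_rpow (by simpa using (by linarith : 0 < critExp d))
      ENNReal.ofReal_ne_top
    rw [ENNReal.toReal_ofReal (by linarith)] at h1
    refine (h1.const_mul (critExp d)).congr (.of_forall fun x => ?_)
    simp only
    rw [Real.norm_of_nonneg (by positivity)]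
  have h := hasDerivAt_integral_of_dominated_loc_of_deriv_le (μ := (volume : Measure (Space d)))
    (F := fun (s : ℝ) x => ‖u x + (s : ℂ) * v x‖ ^ critExp d)
    (F' := fun (s : ℝ) x => critExp d * ‖u x + (s : ℂ) * v x‖ ^ (critExp d - 2) *
      inner ℝ (u x + (s : ℂ) * v x) (v x)) (x₀ := 0) (s := Metric.ball 0 1)
    (Metric.ball_mem_nhds 0 one_pos)
    (.of_forall fun s => ((hu.add_smul hv s).integrable_rpow hd).1)
    ((hu.add_smul hv ((0 : ℝ) : ℂ)).integrable_rpow hd)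
    (by
      have h1 : AEStronglyMeasurable
          (fun x => ‖u x + ((0 : ℝ) : ℂ) * v x‖ ^ (critExp d - 2)) volume :=
        (Real.continuous_rpow_const (by linarith)).comp_aestronglyMeasurable (hm 0).norm
      exact (h1.const_mul _).mul ((hm 0).inner hv.1.1))
    (.of_forall fun x s hs => norm_rpow_line_deriv_le hq (u x) (v x) (by
      rw [mem_ball_zero_iff, Real.norm_eq_abs] at hs
      exact hs.le)) hb
    (.of_forall fun x s _ => hasDerivAt_norm_rpow_line (by linarith) (u x) (v x) s)
  refine h.2.congr_deriv ?_
  simp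

lemma potentialPow_eq {p : ℝ} (hp : p = 1 + 4 / (d : ℝ)) (u : Space d → ℂ) :
    potentialPow p u = critPow u := by
  have : p + 1 = critExp d := by rw [hp, critExp]; ring
  rw [potentialPow, critPow, this]

lemma action_eq {p ω : ℝ} (hp : p = 1 + 4 / (d : ℝ)) (u : Space d → ℂ) :
    action p γ ω u = 1 / 2 * energy (1 - ω ^ 2) γ u - 1 / critExp d * critPow u := by
  have : p + 1 = critExp d := by rw [hp, critExp]; ring
  rw [action, potentialPow_eq hp, this, energy]
  ring

lemma hasDerivAt_action_line (hd : 3 ≤ d) {p ω : ℝ} (hp : p = 1 + 4 / (d : ℝ)) (hγ : 0 < γ)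
    (hω : 0 < 1 - ω ^ 2) (hu : HasH1Grad u g) (hv : HasH1Grad v k) :
    HasDerivAt (fun s : ℝ => action p γ ω (fun x => u x + (s : ℂ) * v x))
      ((inner ℂ (hu.memLp_jet hd hω hγ).toLp (hv.memLp_jet hd hω hγ).toLp).re -
        ∫ x, ‖u x‖ ^ (critExp d - 2) * inner ℝ (u x) (v x)) 0 := by
  have hq := critExp_gt_two (d := d) (by omega)
  simp_rw [action_eq hp]
  have h := ((hasDerivAt_energy_line hd hω hγ hu hv).const_mul (1 / 2)).sub
    ((hasDerivAt_critPow_line hd hu.memH1 hv.memH1).const_mul (1 / critExp d))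
  refine h.congr_deriv ?_
  simp_rw [mul_assoc]
  rw [integral_const_mul]
  field_simp

end firstVariation

/-! ### Symmetric criticality -/

section symmetricCriticality

variable {m γ : ℝ} {u v : Space d → ℂ} {g k : Space d → EuclideanSpace ℂ (Fin d)}

lemma pullGrad_sub (A : Space d ≃L[ℝ] Space d) (z w : EuclideanSpace ℂ (Fin d)) :
    pullGrad A (z - w) = pullGrad A z - pullGrad A w := by
  ext i
  simp [pullGrad, mul_sub]

lemma sum_sq_inner_isometry (R : Space d ≃ₗᵢ[ℝ] Space d) (a : Fin d → ℝ) :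
    ∑ i, (∑ j, (R (EuclideanSpace.single i 1)) j * a j) ^ 2 = ∑ i, a i ^ 2 := by
  have h : ∀ i, ∑ j, (R (EuclideanSpace.single i 1)) j * a j = R.symm (WithLp.toLp 2 a) i := by
    intro i
    have h1 : inner ℝ (R (EuclideanSpace.single i 1)) (WithLp.toLp 2 a) =
        inner ℝ (EuclideanSpace.single i (1 : ℝ)) (R.symm (WithLp.toLp 2 a)) := by
      rw [← R.inner_map_map _ (R.symm _), R.apply_symm_apply]
    rw [EuclideanSpace.inner_single_left] at h1
    simp only [map_one, one_mul] at h1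
    rw [← h1, PiLp.inner_apply]
    refine Finset.sum_congr rfl fun j _ => ?_
    simp [mul_comm]
  simp_rw [h]
  have h2 := R.symm.norm_map (WithLp.toLp 2 a)
  have h3 := EuclideanSpace.real_norm_sq_eq (R.symm (WithLp.toLp 2 a))
  rw [h2, EuclideanSpace.real_norm_sq_eq] at h3
  exact h3.symm

lemma norm_pullGrad (R : Space d ≃ₗᵢ[ℝ] Space d) (z : EuclideanSpace ℂ (Fin d)) :
    ‖pullGrad R.toContinuousLinearEquiv z‖ = ‖z‖ := by
  have key : ∀ y : EuclideanSpace ℂ (Fin d),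
      ‖y‖ ^ 2 = ∑ i, (y i).re ^ 2 + ∑ i, (y i).im ^ 2 := by
    intro y
    rw [EuclideanSpace.norm_sq_eq, ← Finset.sum_add_distrib]
    refine Finset.sum_congr rfl fun i _ => ?_
    rw [Complex.sq_norm, Complex.normSq_apply]
    ring
  rw [← sq_eq_sq₀ (norm_nonneg _) (norm_nonneg _), key, key,
    ← sum_sq_inner_isometry R fun i => (z i).re, ← sum_sq_inner_isometry R fun i => (z i).im]
  congr 1 <;> refine Finset.sum_congr rfl fun i _ => ?_ <;> simp [pullGrad]

/-- The jet of `u ∘ R` in terms of the jet of `u`. -/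
def pullJet (R : Space d ≃ₗᵢ[ℝ] Space d) (F : Space d → Jet d) (x : Space d) : Jet d :=
  WithLp.toLp 2 ((F (R x)).fst, pullGrad R.toContinuousLinearEquiv (F (R x)).snd)

lemma memLp_pullJet (R : Space d ≃ₗᵢ[ℝ] Space d) {F : Space d → Jet d} (hF : MemLp F 2 volume) :
    MemLp (pullJet R F) 2 volume :=
  MemLp.of_fst_of_snd_prodLp
    ⟨MemLp.comp_continuousLinearEquiv hF.prodLp_fst R.toContinuousLinearEquiv,
      MemLp.pullGrad hF.prodLp_snd R.toContinuousLinearEquiv⟩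

lemma norm_pullJet_sub (R : Space d ≃ₗᵢ[ℝ] Space d) (F G : Space d → Jet d) (x : Space d) :
    ‖pullJet R F x - pullJet R G x‖ = ‖F (R x) - G (R x)‖ := by
  rw [← sq_eq_sq₀ (norm_nonneg _) (norm_nonneg _), WithLp.prod_norm_sq_eq_of_L2,
    WithLp.prod_norm_sq_eq_of_L2]
  change ‖(F (R x)).fst - (G (R x)).fst‖ ^ 2 + ‖pullGrad R.toContinuousLinearEquiv (F (R x)).snd -
    pullGrad R.toContinuousLinearEquiv (G (R x)).snd‖ ^ 2 = _
  rw [← pullGrad_sub, norm_pullGrad]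
  rfl

lemma norm_toLp_pullJet_sub (R : Space d ≃ₗᵢ[ℝ] Space d) (F G : JetSpace d) :
    ‖(memLp_pullJet R (Lp.memLp F)).toLp - (memLp_pullJet R (Lp.memLp G)).toLp‖ = ‖F - G‖ := by
  rw [← MemLp.toLp_sub (memLp_pullJet R (Lp.memLp F)), ← sq_eq_sq₀ (norm_nonneg _) (norm_nonneg _), norm_sq_eq_integral]
  have h : F - G = ((Lp.memLp F).sub (Lp.memLp G)).toLp := by
    rw [MemLp.toLp_sub (Lp.memLp F) (Lp.memLp G), Lp.toLp_coeFn, Lp.toLp_coeFn]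
  rw [h, norm_sq_eq_integral]
  simp only [Pi.sub_apply, norm_pullJet_sub]
  exact R.measurePreserving.integral_comp R.toHomeomorph.measurableEmbedding
    fun x => ‖F x - G x‖ ^ 2

lemma weight_isometry (R : Space d ≃ₗᵢ[ℝ] Space d) (x : Space d) :
    weight m γ (R x) = weight m γ x := by
  simp only [weight, R.norm_map]

lemma jetFun_pullJet (R : Space d ≃ₗᵢ[ℝ] Space d) (F : Space d → Jet d) :
    jetFun m γ (pullJet R F) = fun x => jetFun m γ F (R x) := by
  funext x
  rw [jetFun, jetFun, weight_isometry]
  rfl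

lemma jetFun_congr {F G : Space d → Jet d} (h : F =ᵐ[volume] G) :
    jetFun m γ F =ᵐ[volume] jetFun m γ G := by
  filter_upwards [h] with x hx
  rw [jetFun, jetFun, hx]

lemma toLp_pullJet_mem (hm : 0 < m) (hγ : 0 < γ) (R : Space d ≃ₗᵢ[ℝ] Space d) {F : JetSpace d}
    (hF : F ∈ jetSubmodule d m γ) :
    (memLp_pullJet R (Lp.memLp F)).toLp ∈ jetSubmodule d m γ := by
  rw [mem_jetSubmodule_iff hm hγ] at hF ⊢
  have h := (memLp_pullJet R (Lp.memLp F)).coeFn_toLp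
  refine (hF.comp_continuousLinearEquiv R.toContinuousLinearEquiv).congr ?_ ?_
  · filter_upwards [jetFun_congr (m := m) (γ := γ) h] with x hx
    rw [hx, jetFun_pullJet]
    rfl
  · filter_upwards [h] with x hx
    rw [hx]
    rfl

/-- The principle of symmetric criticality. -/
lemma inner_eq_zero_of_radial (hm : 0 < m) (hγ : 0 < γ) {B : JetSpace d}
    (hB : ∀ R : Space d ≃ₗᵢ[ℝ] Space d, pullJet R B =ᵐ[volume] B)
    (h : ∀ F : JetSpace d, IsRadialJet m γ F → (inner ℂ B F).re = 0)
    {F : JetSpace d} (hF : F ∈ jetSubmodule d m γ) : inner ℂ B F = 0 := by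
  -- W is the point of the H¹ jets nearest to B. Linear isometries preserve distances and this
  -- subspace and fix B, so they fix W by uniqueness of the nearest point.
  set W : JetSpace d := (jetSubmodule d m γ).starProjection B with hW
  have hWm : W ∈ jetSubmodule d m γ := Submodule.starProjection_apply_mem _ _
  have horth : ∀ G ∈ jetSubmodule d m γ, inner ℂ (B - W) G = 0 := fun G hG =>
    Submodule.starProjection_inner_eq_zero B G hG
  have hpyth : ∀ G ∈ jetSubmodule d m γ, ‖B - G‖ ^ 2 = ‖B - W‖ ^ 2 + ‖W - G‖ ^ 2 := by
    intro G hG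
    have h1 : B - G = (B - W) + (W - G) := by abel
    rw [h1, norm_add_sq (𝕜 := ℂ), horth _ (Submodule.sub_mem _ hWm hG)]
    simp
  have hTW : ∀ R : Space d ≃ₗᵢ[ℝ] Space d, pullJet R W =ᵐ[volume] W := by
    intro R
    have h1 := norm_toLp_pullJet_sub R B W
    have h2 : (memLp_pullJet R (Lp.memLp B)).toLp = B := by
      refine Lp.ext ?_
      filter_upwards [(memLp_pullJet R (Lp.memLp B)).coeFn_toLp, hB R] with x hx hx'
      rw [hx, hx']
    have h3 := hpyth _ (toLp_pullJet_mem hm hγ R hWm)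
    rw [h2] at h1
    rw [h1] at h3
    have h4 : ‖W - (memLp_pullJet R (Lp.memLp W)).toLp‖ ^ 2 = 0 := by linarith
    have h5 := sub_eq_zero.1 (norm_eq_zero.1 (pow_eq_zero_iff two_ne_zero |>.1 h4))
    have h6 := (memLp_pullJet R (Lp.memLp W)).coeFn_toLp
    rw [← h5] at h6
    exact h6.symm
  have hWr : IsRadialJet m γ W := by
    refine ⟨hWm, ballSymmetric_of_reflection fun v => ?_⟩
    have h1 := jetFun_congr (m := m) (γ := γ) (hTW (ℝ ∙ v)ᗮ.reflection)
    rwa [jetFun_pullJet] at h1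
  -- Being invariant, W is itself an admissible radial test jet; the hypothesis at W reads ‖W‖² = 0,
  -- so B is orthogonal to all H¹ jets.
  have h1 : inner ℂ B W = inner ℂ W W := by
    have := horth W hWm
    rwa [inner_sub_left, sub_eq_zero] at this
  have h2 := h W hWr
  rw [h1, inner_self_eq_norm_sq_to_K] at h2
  have h3 : ‖W‖ ^ 2 = 0 := by exact_mod_cast h2
  have h4 : W = 0 := norm_eq_zero.1 (pow_eq_zero_iff two_ne_zero |>.1 h3)
  have h5 := horth F hF
  rwa [h4, sub_zero] at h5

lemma rpow_neg_le_one_add {r s : ℝ} (hr : 0 < r) (hs0 : 0 ≤ s) (hs2 : s ≤ 2) :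
    r ^ (-s) ≤ 1 + (r ^ 2)⁻¹ := by
  rcases le_total 1 r with h | h
  · have := Real.rpow_le_one_of_one_le_of_nonpos h (by linarith : -s ≤ 0)
    have : 0 ≤ (r ^ 2)⁻¹ := by positivity
    linarith
  · have := Real.rpow_le_rpow_of_exponent_ge hr h (by linarith : -2 ≤ -s)
    rw [Real.rpow_neg hr.le 2, Real.rpow_two] at this
    linarith

/-- The radial decay bounds |u|^{4/d} by a multiple of |x|^{-2(d-2)/d}. Its exponent lies between -2
and 0, so 1 + |x|^{-2}, and hence the squared weight, dominates. This puts the nonlinearity into the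
L² jet space, where the projection argument takes place. -/
lemma exists_rpow_le_weight_sq (hd : 3 ≤ d) (hm : 0 < m) (hγ : 0 < γ) (hu : HasH1Grad u g)
    (hr : IsRadial u) : ∃ K : ℝ, 0 ≤ K ∧
      ∀ᵐ x, ‖u x‖ ^ (critExp d - 2) ≤ K * weight m γ x ^ 2 := by
  have hd' : (3 : ℝ) ≤ d := by exact_mod_cast hd
  set F := (hu.memLp_jet hd hm hγ).toLp with hF
  have hFr : IsRadialJet m γ F := hu.isRadialJet hd hm hγ hr
  have hq := critExp_gt_two (d := d) (by omega)
  have hD : 0 ≤ decayConst d * ‖F‖ := mul_nonneg (Real.sqrt_nonneg _) (norm_nonneg _)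
  refine ⟨(decayConst d * ‖F‖) ^ (critExp d - 2) * (m⁻¹ + γ⁻¹), by positivity, ?_⟩
  filter_upwards [hFr.norm_le hd hm hγ, hu.jetFun_toLp hd hm hγ, ae_ne_zero (by omega)]
    with x hx hx' hx0
  rw [hx'] at hx
  have hxp : 0 < ‖x‖ := norm_pos_iff.2 hx0
  have h1 := Real.rpow_le_rpow (norm_nonneg _) hx (by linarith : 0 ≤ critExp d - 2)
  rw [Real.mul_rpow hD (by positivity), ← Real.rpow_mul hxp.le] at h1
  refine h1.trans ?_
  rw [mul_assoc]
  refine mul_le_mul_of_nonneg_left ?_ (by positivity)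
  have h2 : -(((d : ℝ) - 2) / 2) * (critExp d - 2) = -(2 * (d - 2) / d) := by
    unfold critExp
    field_simp
    ring
  rw [h2, weight_sq hm hγ]
  refine (rpow_neg_le_one_add hxp (by apply div_nonneg <;> linarith)
    (by rw [div_le_iff₀ (by linarith)]; linarith)).trans ?_
  have e : (m⁻¹ + γ⁻¹) * (m + γ / ‖x‖ ^ 2) =
      1 + (‖x‖ ^ 2)⁻¹ + (m⁻¹ * γ * (‖x‖ ^ 2)⁻¹ + γ⁻¹ * m) := by
    field_simp
    ring
  rw [e]
  exact le_add_of_nonneg_right (by positivity)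

/-- The jet representing the nonlinearity. -/
def nonlinearJet (m γ : ℝ) (u : Space d → ℂ) (x : Space d) : Jet d :=
  WithLp.toLp 2 (‖u x‖ ^ (critExp d - 2) • (weight m γ x)⁻¹ • u x, 0)

lemma memLp_nonlinearJet (hd : 3 ≤ d) (hm : 0 < m) (hγ : 0 < γ) (hu : HasH1Grad u g)
    (hr : IsRadial u) : MemLp (nonlinearJet m γ u) 2 volume := by
  have hq := critExp_gt_two (d := d) (by omega)
  obtain ⟨K, hK, hle⟩ := exists_rpow_le_weight_sq hd hm hγ hu hr
  refine MemLp.of_fst_of_snd_prodLp ⟨?_, MemLp.zero⟩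
  refine ((hu.memH1.memLp_weight_mul hd hm hγ).const_smul K).of_le ?_ ?_
  · have h1 : AEStronglyMeasurable (fun x => ‖u x‖ ^ (critExp d - 2)) volume :=
      (Real.continuous_rpow_const (by linarith)).comp_aestronglyMeasurable hu.1.1.norm
    exact h1.smul (measurable_weight.inv.aestronglyMeasurable.smul hu.1.1)
  · filter_upwards [hle] with x hx
    have hw := weight_pos hm hγ x
    change ‖‖u x‖ ^ (critExp d - 2) • (weight m γ x)⁻¹ • u x‖ ≤ ‖K • weight m γ x • u x‖
    rw [norm_smul, norm_smul, norm_smul, norm_smul, norm_inv, Real.norm_of_nonneg hw.le,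
      Real.norm_of_nonneg hK, Real.norm_of_nonneg (by positivity), ← mul_assoc, ← mul_assoc]
    refine mul_le_mul_of_nonneg_right ?_ (norm_nonneg _)
    rw [← div_eq_mul_inv, div_le_iff₀ hw]
    linarith [hx]

lemma re_inner_nonlinearJet (hd : 3 ≤ d) (hm : 0 < m) (hγ : 0 < γ) (hu : HasH1Grad u g)
    (hr : IsRadial u) (F : JetSpace d) :
    (inner ℂ (memLp_nonlinearJet hd hm hγ hu hr).toLp F).re =
      ∫ x, ‖u x‖ ^ (critExp d - 2) * inner ℝ (u x) (jetFun m γ F x) := by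
  rw [L2.inner_def]
  have h := integral_re (L2.integrable_inner (𝕜 := ℂ)
    (memLp_nonlinearJet hd hm hγ hu hr).toLp F)
  rw [RCLike.re_eq_complex_re] at h
  rw [← h]
  apply integral_congr_ae
  filter_upwards [(memLp_nonlinearJet hd hm hγ hu hr).coeFn_toLp] with x hx
  rw [hx, WithLp.prod_inner_apply]
  simp [nonlinearJet, jetFun, Complex.inner]
  ring

/-- A radial function solving the Euler–Lagrange equation against radial test functions solves
it against all test functions. -/
lemma eulerLagrange_of_radial (hd : 3 ≤ d) (hm : 0 < m) (hγ : 0 < γ) (hu : HasH1Grad u g)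
    (hr : IsRadial u)
    (h : ∀ (v : Space d → ℂ) (k : Space d → EuclideanSpace ℂ (Fin d)) (hv : HasH1Grad v k),
      IsRadial v →
      (inner ℂ (hu.memLp_jet hd hm hγ).toLp (hv.memLp_jet hd hm hγ).toLp).re =
        ∫ x, ‖u x‖ ^ (critExp d - 2) * inner ℝ (u x) (v x)) (hv : HasH1Grad v k) :
    (inner ℂ (hu.memLp_jet hd hm hγ).toLp (hv.memLp_jet hd hm hγ).toLp).re =
      ∫ x, ‖u x‖ ^ (critExp d - 2) * inner ℝ (u x) (v x) := by
  set N := (memLp_nonlinearJet hd hm hγ hu hr).toLp with hN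
  set U := (hu.memLp_jet hd hm hγ).toLp with hU
  have hinv : ∀ R : Space d ≃ₗᵢ[ℝ] Space d,
      pullJet R (U - N : JetSpace d) =ᵐ[volume] (U - N : JetSpace d) := by
    intro R
    have hB : (U - N : JetSpace d) =ᵐ[volume]
        fun x => jet m γ u g x - nonlinearJet m γ u x := by
      filter_upwards [Lp.coeFn_sub U N, (hu.memLp_jet hd hm hγ).coeFn_toLp,
        (memLp_nonlinearJet hd hm hγ hu hr).coeFn_toLp] with x h1 h2 h3
      rw [h1, Pi.sub_apply, h2, h3]
    have hur := hr.comp_isometry R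
    have hgr := (hu.comp_continuousLinearEquiv R.toContinuousLinearEquiv).ae_eq hu hur
    have hB' := R.measurePreserving.quasiMeasurePreserving.ae hB
    filter_upwards [hB, hB', hur, hgr] with x h1 h2 h3 h4
    rw [h1, pullJet, h2]
    refine congrArg (WithLp.toLp 2) (Prod.ext ?_ ?_)
    · change weight m γ (R x) • u (R x) -
        ‖u (R x)‖ ^ (critExp d - 2) • (weight m γ (R x))⁻¹ • u (R x) = weight m γ x • u x -
        ‖u x‖ ^ (critExp d - 2) • (weight m γ x)⁻¹ • u x
      rw [h3, weight_isometry]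
    · change pullGrad R.toContinuousLinearEquiv (g (R x) - 0) = g x - 0
      rw [sub_zero, sub_zero]
      exact h4
  have hrad : ∀ F : JetSpace d, IsRadialJet m γ F → (inner ℂ (U - N) F).re = 0 := by
    intro F hF
    have hF1 := hF.hasH1Grad hm hγ
    have h1 := h _ _ hF1 (hF.isRadial (by omega) hm hγ)
    have h2 : (hF1.memLp_jet hd hm hγ).toLp = F := by
      refine Lp.ext ?_
      filter_upwards [(hF1.memLp_jet hd hm hγ).coeFn_toLp] with x hx
      rw [hx, jet_jetFun hm hγ]
    rw [h2] at h1
    rw [inner_sub_left, Complex.sub_re, h1, hN, re_inner_nonlinearJet hd hm hγ hu hr, sub_self]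
  have h3 := inner_eq_zero_of_radial hm hγ hinv hrad (hv.toLp_mem hd hm hγ)
  rw [inner_sub_left, sub_eq_zero] at h3
  rw [h3, hN, re_inner_nonlinearJet hd hm hγ hu hr]
  apply integral_congr_ae
  filter_upwards [hv.jetFun_toLp hd hm hγ] with x hx
  rw [hx]

end symmetricCriticality

/-! ### The sharp constant, the action and the ground states -/

/-- `C` is the sharp constant of the radial Gagliardo–Nirenberg inequality, and it is attained. -/
structure IsSharpGN (d : ℕ) (γ C : ℝ) : Prop where
  pos : 0 < C
  le : ∀ u : Space d → ℂ, MemH1 u → IsRadial u →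
    critPow u ≤ C * (massSq u ^ (2 / (d : ℝ)) * kineticSq γ u)
  exists_eq : ∃ w : Space d → ℂ, MemH1RadNonzero w ∧
    critPow w = C * (massSq w ^ (2 / (d : ℝ)) * kineticSq γ w)

/-- The mass of the extremal functions whose potential term is one. -/
def extremalMass (d : ℕ) (C : ℝ) : ℝ := (((d : ℝ) + 2) / (d * C)) ^ ((d : ℝ) / 2)

section sharpConstant

variable {m γ ω p C : ℝ} {u : Space d → ℂ}

lemma extremalMass_pos (hd : 0 < d) (hC : 0 < C) : 0 < extremalMass d C := by
  have : (0 : ℝ) < d := by exact_mod_cast hd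
  unfold extremalMass
  positivity

lemma extremalMass_rpow (hd : 0 < d) (hC : 0 < C) :
    extremalMass d C ^ (2 / (d : ℝ)) = ((d : ℝ) + 2) / (d * C) := by
  have : (0 : ℝ) < d := by exact_mod_cast hd
  rw [extremalMass, ← Real.rpow_mul (by positivity)]
  have : (d : ℝ) / 2 * (2 / d) = 1 := by field_simp
  rw [this, Real.rpow_one]

/-- Matches the two normalizations: X comes from the constraint K = 0, κ from the bound for critical
points. Their agreement makes the two action levels coincide. -/
lemma mul_profileMax_mul (hd : 0 < d) (hC : 0 < C) :
    C * profileMax d * (((d : ℝ) + 2) / 2 * extremalMass d C) ^ (2 / (d : ℝ)) = 1 := by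
  have hd' : (0 : ℝ) < d := by exact_mod_cast hd
  rw [Real.mul_rpow (by positivity) (extremalMass_pos hd hC).le, extremalMass_rpow hd hC,
    profileMax, Real.div_rpow zero_le_two (by positivity),
    Real.div_rpow (by positivity) zero_le_two]
  have h2 : ((d : ℝ) + 2) ^ (2 / (d : ℝ)) ≠ 0 := by positivity
  have h3 : (2 : ℝ) ^ (2 / (d : ℝ)) ≠ 0 := by positivity
  field_simp

lemma energy_nonneg (hm : 0 < m) (hγ : 0 < γ) (u : Space d → ℂ) : 0 ≤ energy m γ u :=
  add_nonneg (mul_nonneg hm.le (massSq_nonneg u)) (kineticSq_nonneg hγ u)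

/-- Gagliardo–Nirenberg combined with the profile inequality at (mM, T). This form bounds V by the
quadratic energy alone, as is suited to first variations and to the Nehari identity. -/
lemma IsSharpGN.critPow_mul_le (hC : IsSharpGN d γ C) (hd : 3 ≤ d) (hm : 0 < m) (hγ : 0 < γ)
    (hu : MemH1 u) (hr : IsRadial u) :
    critPow u * m ^ (2 / (d : ℝ)) ≤ C * profileMax d * energy m γ u ^ (1 + 2 / (d : ℝ)) := by
  have hd0 : 0 < d := by omega
  have hκ := profileMax_pos hd0
  by_cases h0 : u =ᵐ[volume] 0
  · rw [(critPow_eq_zero_iff hd hu).2 h0, zero_mul]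
    exact mul_nonneg (mul_nonneg hC.pos.le hκ.le) (Real.rpow_nonneg (energy_nonneg hm hγ u) _)
  · have hM := MemH1RadNonzero.massSq_pos ⟨hu, hr, h0⟩
    have hT := kineticSq_pos hd hγ hu h0
    have h1 := rpow_mul_le_profile hd0 (mul_pos hm hM) hT
    rw [Real.mul_rpow hm.le hM.le] at h1
    have h2 := mul_le_mul_of_nonneg_right (hC.le u hu hr)
      (by positivity : 0 ≤ m ^ (2 / (d : ℝ)))
    have h3 := mul_le_mul_of_nonneg_left h1 hC.pos.le
    refine h2.trans (le_of_eq_of_le ?_ (h3.trans_eq ?_))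
    · ring
    · rw [energy]
      ring

/-- Along u + s v the difference of the two sides of the energy inequality is nonnegative and
vanishes at s = 0, so its derivative is zero. The normalization E = V makes the Lagrange multiplier
equal to 1. -/
lemma eulerLagrange_of_extremal (hC : IsSharpGN d γ C) (hd : 3 ≤ d) (hm : 0 < m) (hγ : 0 < γ)
    {g k : Space d → EuclideanSpace ℂ (Fin d)} {v : Space d → ℂ} (hu : HasH1Grad u g)
    (hr : IsRadial u) (hv : HasH1Grad v k) (hvr : IsRadial v) (hE : energy m γ u = critPow u)
    (h0 : 0 < critPow u)
    (heq : critPow u * m ^ (2 / (d : ℝ)) = C * profileMax d * energy m γ u ^ (1 + 2 / (d : ℝ))) :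
    (inner ℂ (hu.memLp_jet hd hm hγ).toLp (hv.memLp_jet hd hm hγ).toLp).re =
      ∫ x, ‖u x‖ ^ (critExp d - 2) * inner ℝ (u x) (v x) := by
  have hd' : (0 : ℝ) < d := by exact_mod_cast (by omega : 0 < d)
  set a := (inner ℂ (hu.memLp_jet hd hm hγ).toLp (hv.memLp_jet hd hm hγ).toLp).re
  set b := ∫ x, ‖u x‖ ^ (critExp d - 2) * inner ℝ (u x) (v x) with hb
  have hz : (fun x => u x + ((0 : ℝ) : ℂ) * v x) = u := by
    funext x
    simp
  have h1 := hasDerivAt_energy_line hd hm hγ hu hv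
  have h2 := hasDerivAt_critPow_line hd hu.memH1 hv.memH1
  have h3 : (∫ x, critExp d * ‖u x‖ ^ (critExp d - 2) * inner ℝ (u x) (v x)) = critExp d * b := by
    simp_rw [mul_assoc]
    rw [integral_const_mul]
  rw [h3] at h2
  have hE0 : 0 < energy m γ u := hE ▸ h0
  have h4 := ((h1.rpow_const (p := 1 + 2 / (d : ℝ)) (by
    left
    rw [hz]
    exact hE0.ne')).const_mul (C * profileMax d)).sub (h2.mul_const (m ^ (2 / (d : ℝ))))
  have hmin : IsLocalMin ((fun s : ℝ => C * profileMax d *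
      energy m γ (fun x => u x + (s : ℂ) * v x) ^ (1 + 2 / (d : ℝ))) -
      fun s : ℝ => critPow (fun x => u x + (s : ℂ) * v x) * m ^ (2 / (d : ℝ))) 0 := by
    refine .of_forall fun s => ?_
    simp only [Pi.sub_apply]
    rw [hz, heq, sub_self, sub_nonneg]
    exact hC.critPow_mul_le hd hm hγ (hu.memH1.add_smul hv.memH1 s) (hr.add_smul hvr s)
  have h5 := hmin.hasDerivAt_eq_zero h4
  rw [hz, add_sub_cancel_left] at h5
  have h6 : C * profileMax d * energy m γ u ^ (2 / (d : ℝ)) = m ^ (2 / (d : ℝ)) := by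
    rw [add_comm, Real.rpow_add hE0, Real.rpow_one, ← hE] at heq
    refine mul_left_cancel₀ hE0.ne' ?_
    rw [heq]
    ring
  have h7 : m ^ (2 / (d : ℝ)) * critExp d * (a - b) = 0 := by
    rw [← h5, critExp, mul_sub, ← h6]
    ring
  have hq := critExp_gt_two (d := d) (by omega)
  have h8 : m ^ (2 / (d : ℝ)) * critExp d ≠ 0 := by positivity
  exact sub_eq_zero.1 ((mul_eq_zero.1 h7).resolve_left h8)

lemma IsSharpGN.isCriticalPoint (hC : IsSharpGN d γ C) (hd : 3 ≤ d) (hp : p = 1 + 4 / (d : ℝ))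
    (hω : 0 < 1 - ω ^ 2) (hγ : 0 < γ) (hu : MemH1RadNonzero u)
    (hM : (1 - ω ^ 2) * massSq u = 2 / ((d : ℝ) + 2) * critPow u)
    (hT : kineticSq γ u = d / ((d : ℝ) + 2) * critPow u)
    (heq : critPow u = C * (massSq u ^ (2 / (d : ℝ)) * kineticSq γ u)) :
    IsCriticalPoint p γ ω u := by
  have hd' : (0 : ℝ) < d := by exact_mod_cast (by omega : 0 < d)
  have hV := hu.critPow_pos hd
  have hE : energy (1 - ω ^ 2) γ u = critPow u := by
    rw [energy, hM, hT]
    field_simp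
    ring
  have h1 : critPow u * (1 - ω ^ 2) ^ (2 / (d : ℝ)) =
      C * profileMax d * energy (1 - ω ^ 2) γ u ^ (1 + 2 / (d : ℝ)) := by
    have e : critPow u * (1 - ω ^ 2) ^ (2 / (d : ℝ)) =
        C * (((1 - ω ^ 2) * massSq u) ^ (2 / (d : ℝ)) * kineticSq γ u) := by
      rw [Real.mul_rpow hω.le (massSq_nonneg u)]
      nth_rewrite 1 [heq]
      ring
    rw [e, hM, hT, hE, profileMax, Real.mul_rpow (by positivity) hV.le, Real.rpow_add hV,
      Real.rpow_one]
    ring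
  intro v hv
  refine (hasDerivAt_action_line hd hp hγ hω hu.1.hasH1Grad hv.hasH1Grad).congr_deriv ?_
  rw [sub_eq_zero]
  exact eulerLagrange_of_radial hd hω hγ hu.1.hasH1Grad hu.2.1 (fun w k hw hwr =>
    eulerLagrange_of_extremal hC hd hω hγ hu.1.hasH1Grad hu.2.1 hw hwr hE hV h1) hv.hasH1Grad

/-- The Nehari identity. -/
lemma IsCriticalPoint.energy_eq (hd : 3 ≤ d) (hp : p = 1 + 4 / (d : ℝ)) (hω : 0 < 1 - ω ^ 2)
    (hγ : 0 < γ) (hu : MemH1 u) (h : IsCriticalPoint p γ ω u) :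
    energy (1 - ω ^ 2) γ u = critPow u := by
  have hq := critExp_gt_two (d := d) (by omega)
  have h1 := (hasDerivAt_action_line hd hp hγ hω hu.hasH1Grad hu.hasH1Grad).unique (h u hu)
  rw [inner_self_eq_norm_sq_to_K, sub_eq_zero] at h1
  rw [← hu.hasH1Grad.norm_jet_sq hd hω hγ]
  refine Eq.trans ?_ (h1.trans ?_)
  · norm_cast
  · unfold critPow
    congr 1 with x
    rw [real_inner_self_eq_norm_sq, ← Real.rpow_natCast,
      ← Real.rpow_add_of_nonneg (norm_nonneg _) (by linarith) (by norm_num)]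
    norm_num

lemma inv_critExp (hd : 0 < d) : 1 / critExp d = d / (2 * ((d : ℝ) + 2)) := by
  have hd' : (0 : ℝ) < d := by exact_mod_cast hd
  unfold critExp
  field_simp
  ring

lemma action_eq' (hd : 0 < d) (hp : p = 1 + 4 / (d : ℝ)) (u : Space d → ℂ) :
    action p γ ω u = (1 - ω ^ 2) / 2 * massSq u +
      1 / 2 * (kineticSq γ u - d / ((d : ℝ) + 2) * critPow u) := by
  rw [action_eq hp, inv_critExp hd, energy]
  have hd' : (0 : ℝ) < d := by exact_mod_cast hd
  field_simp
  ring

/-- The action along the dilation is a constant mass term plus e^{4l} times a fixed quantity, since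
the mass-critical power scales exactly like the kinetic term. -/
lemma virial_eq (hd : 0 < d) (hp : p = 1 + 4 / (d : ℝ)) (hu : MemH1 u) :
    virial p γ ω d 2 u = 2 * (kineticSq γ u - d / ((d : ℝ) + 2) * critPow u) := by
  have hd' : (0 : ℝ) < d := by exact_mod_cast hd
  have h1 : ∀ l : ℝ, action p γ ω
      (fun x => (Real.exp (d * l) : ℂ) * u (Real.exp (2 * l) • x)) =
      (1 - ω ^ 2) / 2 * massSq u + Real.exp (4 * l) *
        (1 / 2 * (kineticSq γ u - d / ((d : ℝ) + 2) * critPow u)) := by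
    intro l
    have hb := Real.exp_pos (2 * l)
    have hn : ‖(Real.exp (d * l) : ℂ)‖ = Real.exp (d * l) := by
      rw [Complex.norm_real, Real.norm_of_nonneg (Real.exp_pos _).le]
    rw [action_eq' hd hp, massSq_rescale u _ hb, kineticSq_rescale hu γ _ hb,
      critPow_rescale u _ hb, hn, ← Real.exp_mul, ← Real.exp_nat_mul, ← Real.exp_nat_mul,
      ← Real.exp_nat_mul, ← Real.exp_neg, ← Real.exp_add, ← Real.exp_add, ← Real.exp_add,
      ← Real.exp_add]
    have e1 : ((2 : ℕ) : ℝ) * (d * l) + -(d * (2 * l)) = 0 := by push_cast; ring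
    have e2 : ((2 : ℕ) : ℝ) * (d * l) + ((2 : ℕ) : ℝ) * (2 * l) + -(d * (2 * l)) = 4 * l := by
      push_cast; ring
    have e3 : d * l * critExp d + -(d * (2 * l)) = 4 * l := by
      unfold critExp
      field_simp
      ring
    rw [e1, e2, e3, Real.exp_zero]
    ring
  unfold virial
  simp_rw [h1]
  have h2 := ((((hasDerivAt_id (0 : ℝ)).const_mul 4).exp).mul_const
    (1 / 2 * (kineticSq γ u - d / ((d : ℝ) + 2) * critPow u))).const_add
      ((1 - ω ^ 2) / 2 * massSq u)
  refine (HasDerivAt.deriv h2).trans ?_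
  simp
  ring

lemma virial_eq_zero_iff (hd : 0 < d) (hp : p = 1 + 4 / (d : ℝ)) (hu : MemH1 u) :
    virial p γ ω d 2 u = 0 ↔ kineticSq γ u = d / ((d : ℝ) + 2) * critPow u := by
  rw [virial_eq hd hp hu, mul_eq_zero, or_iff_right two_ne_zero, sub_eq_zero]

/-- The least action of the radial solutions. -/
lemma IsSharpGN.le_action (hC : IsSharpGN d γ C) (hd : 3 ≤ d) (hp : p = 1 + 4 / (d : ℝ))
    (hω : 0 < 1 - ω ^ 2) (hγ : 0 < γ) (hu : MemH1RadNonzero u)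
    (hE : energy (1 - ω ^ 2) γ u = critPow u) :
    (1 - ω ^ 2) / 2 * extremalMass d C ≤ action p γ ω u ∧
      (action p γ ω u = (1 - ω ^ 2) / 2 * extremalMass d C →
        kineticSq γ u = d / ((d : ℝ) + 2) * critPow u) := by
  have hd0 : 0 < d := by omega
  have hd' : (0 : ℝ) < d := by exact_mod_cast hd0
  have hV := hu.critPow_pos hd
  have hκ := profileMax_pos hd0
  have hC0 := hC.pos
  have hX := extremalMass_pos hd0 hC0
  have hS : action p γ ω u = critPow u / ((d : ℝ) + 2) := by
    rw [action_eq hp, hE, inv_critExp hd0]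
    field_simp
    ring
  have hK := mul_profileMax_mul hd0 hC0
  have h1 := hC.critPow_mul_le hd hω hγ hu.1 hu.2.1
  rw [hE, Real.rpow_add hV, Real.rpow_one] at h1
  have h2 : (1 - ω ^ 2) ^ (2 / (d : ℝ)) ≤ C * profileMax d * critPow u ^ (2 / (d : ℝ)) := by
    refine le_of_mul_le_mul_left (h1.trans_eq ?_) hV
    ring
  have h3 : ((1 - ω ^ 2) * (((d : ℝ) + 2) / 2 * extremalMass d C)) ^ (2 / (d : ℝ)) ≤
      critPow u ^ (2 / (d : ℝ)) := by
    rw [Real.mul_rpow hω.le (by positivity)]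
    refine le_of_mul_le_mul_left ?_ (mul_pos hC0 hκ)
    refine le_of_eq_of_le ?_ h2
    rw [mul_left_comm, hK, mul_one]
  have h4 := (Real.rpow_le_rpow_iff (by positivity) hV.le (by positivity)).1 h3
  refine ⟨?_, fun h => ?_⟩
  · rw [hS, le_div_iff₀ (by positivity)]
    linarith
  · have h5 : critPow u = (1 - ω ^ 2) * (((d : ℝ) + 2) / 2 * extremalMass d C) := by
      rw [hS, div_eq_iff (by positivity)] at h
      rw [h]
      ring
    have hM := hu.massSq_pos
    have hT := kineticSq_pos hd hγ hu.1 hu.2.2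
    -- At the least action V is known, and the Gagliardo–Nirenberg bound then forces equality in the
    -- profile inequality for (mM, T). Its equality case gives mM = 2E/(d+2), hence T = d/(d+2) · V.
    have h6 := eq_of_profile_le hd0 (mul_pos hω hM) hT (by
      change profileMax d * energy (1 - ω ^ 2) γ u ^ _ ≤ _
      rw [hE, Real.rpow_add hV, Real.rpow_one, Real.mul_rpow hω.le hM.le]
      have h7 := hC.le u hu.1 hu.2.1
      refine le_of_mul_le_mul_left ?_ hC0
      have h8 : C * profileMax d * critPow u ^ (2 / (d : ℝ)) = (1 - ω ^ 2) ^ (2 / (d : ℝ)) := by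
        rw [h5, Real.mul_rpow hω.le (by positivity), mul_left_comm, hK, mul_one]
      calc C * (profileMax d * (critPow u * critPow u ^ (2 / (d : ℝ))))
          = (1 - ω ^ 2) ^ (2 / (d : ℝ)) * critPow u := by rw [← h8]; ring
        _ ≤ (1 - ω ^ 2) ^ (2 / (d : ℝ)) * (C * (massSq u ^ (2 / (d : ℝ)) * kineticSq γ u)) :=
            mul_le_mul_of_nonneg_left h7 (by positivity)
        _ = _ := by ring)
    change (1 - ω ^ 2) * massSq u = 2 / ((d : ℝ) + 2) * energy (1 - ω ^ 2) γ u at h6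
    have h9 : kineticSq γ u = critPow u - (1 - ω ^ 2) * massSq u := by
      rw [← hE, energy]
      ring
    rw [h9, h6, hE]
    field_simp
    ring

lemma action_eq_of_virial (hd : 0 < d) (hp : p = 1 + 4 / (d : ℝ))
    (hT : kineticSq γ u = d / ((d : ℝ) + 2) * critPow u) :
    action p γ ω u = (1 - ω ^ 2) / 2 * massSq u := by
  rw [action_eq' hd hp, hT]
  ring

lemma IsSharpGN.extremalMass_le (hC : IsSharpGN d γ C) (hd : 3 ≤ d) (hu : MemH1RadNonzero u)
    (hT : kineticSq γ u = d / ((d : ℝ) + 2) * critPow u) : extremalMass d C ≤ massSq u := by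
  have hd0 : 0 < d := by omega
  have hd' : (0 : ℝ) < d := by exact_mod_cast hd0
  have hC0 := hC.pos
  have hV := hu.critPow_pos hd
  have h1 := hC.le u hu.1 hu.2.1
  rw [hT] at h1
  refine (Real.rpow_le_rpow_iff (extremalMass_pos hd0 hC0).le (massSq_nonneg u)
    (by positivity : 0 < 2 / (d : ℝ))).1 ?_
  rw [extremalMass_rpow hd0 hC0, div_le_iff₀ (by positivity)]
  refine le_of_mul_le_mul_right ?_ (by positivity : 0 < critPow u / ((d : ℝ) + 2))
  refine le_of_eq_of_le ?_ (h1.trans_eq ?_)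
  · field_simp
  · ring

/-- With V = 1 the constraint K = 0 prescribes T = d/(d+2), and equality in Gagliardo–Nirenberg then
prescribes M = X. Rescaling an extremal to these values of M and T makes V = 1 automatic. -/
lemma IsSharpGN.exists_extremal (hC : IsSharpGN d γ C) (hd : 3 ≤ d) (hγ : 0 < γ) :
    ∃ v : Space d → ℂ, MemH1RadNonzero v ∧ massSq v = extremalMass d C ∧
      kineticSq γ v = d / ((d : ℝ) + 2) ∧ critPow v = 1 := by
  have hd0 : 0 < d := by omega
  have hd' : (0 : ℝ) < d := by exact_mod_cast hd0
  have hC0 := hC.pos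
  obtain ⟨w, hw, hwC⟩ := hC.exists_eq
  obtain ⟨v, hv, hvM, hvT, hvV⟩ := hw.exists_rescale hd hγ (extremalMass_pos hd0 hC0)
    (by positivity : 0 < (d : ℝ) / ((d : ℝ) + 2))
  refine ⟨v, hv, hvM, hvT, ?_⟩
  have h1 : 0 < massSq w ^ (2 / (d : ℝ)) * kineticSq γ w :=
    mul_pos (Real.rpow_pos_of_pos hw.massSq_pos _) (kineticSq_pos hd hγ hw.1 hw.2.2)
  rw [extremalMass_rpow hd0 hC0, hwC] at hvV
  refine mul_right_cancel₀ h1.ne' (hvV.trans ?_)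
  field_simp

lemma IsSharpGN.isLeast_constrainedActions (hC : IsSharpGN d γ C) (hd : 3 ≤ d)
    (hp : p = 1 + 4 / (d : ℝ)) (hω : 0 < 1 - ω ^ 2) (hγ : 0 < γ) :
    IsLeast (constrainedActions d p γ ω d 2) ((1 - ω ^ 2) / 2 * extremalMass d C) := by
  have hd0 : 0 < d := by omega
  constructor
  · obtain ⟨v, hv, hvM, hvT, hvV⟩ := hC.exists_extremal hd hγ
    have hT : kineticSq γ v = d / ((d : ℝ) + 2) * critPow v := by rw [hvT, hvV, mul_one]
    exact ⟨v, hv, (virial_eq_zero_iff hd0 hp hv.1).2 hT, by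
      rw [action_eq_of_virial hd0 hp hT, hvM]⟩
  · rintro s ⟨u, hu, hK, rfl⟩
    have hT := (virial_eq_zero_iff hd0 hp hu.1).1 hK
    rw [action_eq_of_virial hd0 hp hT]
    exact mul_le_mul_of_nonneg_left (hC.extremalMass_le hd hu hT) (by positivity)

lemma IsSharpGN.isLeast_radialGNConstants (hC : IsSharpGN d γ C) (hd : 3 ≤ d)
    (hp : p = 1 + 4 / (d : ℝ)) (hγ : 0 < γ) : IsLeast (radialGNConstants d p γ) C := by
  have hd0 : 0 < d := by omega
  have hd' : (0 : ℝ) < d := by exact_mod_cast hd0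
  have e1 : p + 1 - (d : ℝ) * (p - 1) / 2 = 1 / 2 * (4 / (d : ℝ)) + 2 / d := by
    rw [hp]
    field_simp
    ring
  have e2 : (d : ℝ) * (p - 1) / 2 = 2 := by
    rw [hp]
    field_simp
    ring
  have key : ∀ (K : ℝ) (u : Space d → ℂ), K * Real.sqrt (massSq u) ^
      (p + 1 - (d : ℝ) * (p - 1) / 2) * Real.sqrt (kineticSq γ u) ^ ((d : ℝ) * (p - 1) / 2) =
      K * (massSq u ^ (2 / (d : ℝ)) * kineticSq γ u) := by
    intro K u
    rw [e1, e2, Real.rpow_two, Real.sq_sqrt (kineticSq_nonneg hγ u), Real.sqrt_eq_rpow,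
      ← Real.rpow_mul (massSq_nonneg u), mul_assoc]
    congr 3
    ring
  constructor
  · refine ⟨hC.pos.le, fun u hu hr => ?_⟩
    rw [potentialPow_eq hp, key]
    exact hC.le u hu hr
  · rintro K ⟨-, hK⟩
    obtain ⟨w, hw, hwC⟩ := hC.exists_eq
    have h1 := hK w hw.1 hw.2.1
    rw [potentialPow_eq hp, key, hwC] at h1
    exact le_of_mul_le_mul_right h1
      (mul_pos (Real.rpow_pos_of_pos hw.massSq_pos _) (kineticSq_pos hd hγ hw.1 hw.2.2))

/-- A normalized extremal function is a rescaled ground state. -/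
lemma IsSharpGN.exists_groundState (hC : IsSharpGN d γ C) (hd : 3 ≤ d)
    (hp : p = 1 + 4 / (d : ℝ)) (hω : 0 < 1 - ω ^ 2) (hγ : 0 < γ) {ψ : Space d → ℂ}
    (hψ : MemH1RadNonzero ψ) (hM : massSq ψ = extremalMass d C)
    (hT : kineticSq γ ψ = d / ((d : ℝ) + 2)) (hV : critPow ψ = 1) {ν : ℝ} (hν : 0 < ν)
    (hν2 : ν ^ 2 = 1 / (((d : ℝ) + 2) * ((1 - ω ^ 2) / 2 * extremalMass d C))) :
    ∃ Q ∈ radialGroundStates d p γ ω, action p γ ω Q = (1 - ω ^ 2) / 2 * extremalMass d C ∧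
      ∀ x, ψ x = ((ν ^ ((d : ℝ) / 2) : ℝ) : ℂ) * Q (ν • x) := by
  have hd0 : 0 < d := by omega
  have hd' : (0 : ℝ) < d := by exact_mod_cast hd0
  have hC0 := hC.pos
  have hX := extremalMass_pos hd0 hC0
  -- The rescaling a ψ(·/ν) preserves mass and multiplies T and V by ν⁻². The prescribed ν gives
  -- V(Q) = (d+2) r, exactly the value for which mM = 2/(d+2) · V, so that E = V.
  set a : ℝ := ν ^ (-((d : ℝ) / 2)) with ha
  have hap : 0 < a := Real.rpow_pos_of_pos hν _
  have hna : ‖(a : ℂ)‖ = a := by rw [Complex.norm_real, Real.norm_of_nonneg hap.le]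
  have hb : 0 < ν⁻¹ := inv_pos.2 hν
  have hbd : ((ν⁻¹) ^ d)⁻¹ = ν ^ (d : ℝ) := by rw [inv_pow, inv_inv, Real.rpow_natCast]
  have ha2 : a ^ 2 * ((ν⁻¹) ^ d)⁻¹ = 1 := by
    rw [hbd, ← Real.rpow_natCast a, ← Real.rpow_mul hν.le, ← Real.rpow_add hν]
    have : -((d : ℝ) / 2) * ((2 : ℕ) : ℝ) + d = 0 := by push_cast; ring
    rw [this, Real.rpow_zero]
  have hν3 : (ν⁻¹) ^ 2 = ((d : ℝ) + 2) * ((1 - ω ^ 2) / 2 * extremalMass d C) := by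
    rw [inv_pow, hν2, one_div, inv_inv]
  have haq : a ^ critExp d * ((ν⁻¹) ^ d)⁻¹ = (ν⁻¹) ^ 2 := by
    rw [hbd, ← Real.rpow_mul hν.le, ← Real.rpow_add hν, inv_pow, ← Real.rpow_natCast ν,
      ← Real.rpow_neg hν.le]
    congr 1
    unfold critExp
    push_cast
    field_simp
    ring
  set Q : Space d → ℂ := fun x => (a : ℂ) * ψ (ν⁻¹ • x) with hQ
  have hQm : MemH1RadNonzero Q := hψ.rescale (by exact_mod_cast hap.ne') hb
  have hQM : massSq Q = extremalMass d C := by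
    rw [hQ, massSq_rescale ψ _ hb, hna, ha2, one_mul, hM]
  have hQV : critPow Q = ((d : ℝ) + 2) * ((1 - ω ^ 2) / 2 * extremalMass d C) := by
    rw [hQ, critPow_rescale ψ _ hb, hna, haq, hV, mul_one, hν3]
  have hQT : kineticSq γ Q = d / ((d : ℝ) + 2) * critPow Q := by
    rw [hQV, ← hν3, hQ, kineticSq_rescale hψ.1 γ _ hb, hna, hT, mul_right_comm (a ^ 2), ha2,
      one_mul, mul_comm]
  have hcrit : IsCriticalPoint p γ ω Q := by
    refine hC.isCriticalPoint hd hp hω hγ hQm ?_ hQT ?_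
    · rw [hQM, hQV]
      field_simp
    · rw [hQT, hQM, extremalMass_rpow hd0 hC0]
      field_simp
  have hS : action p γ ω Q = (1 - ω ^ 2) / 2 * extremalMass d C := by
    rw [action_eq_of_virial hd0 hp hQT, hQM]
  refine ⟨Q, ⟨⟨hQm, hcrit⟩, fun v hv => ?_⟩, hS, fun x => ?_⟩
  · rw [hS]
    exact (hC.le_action hd hp hω hγ hv.1 (hv.2.energy_eq hd hp hω hγ hv.1.1)).1
  · simp only [hQ]
    rw [smul_smul, inv_mul_cancel₀ hν.ne', one_smul, ← mul_assoc, ← Complex.ofReal_mul, ha,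
      ← Real.rpow_add hν, add_neg_cancel, Real.rpow_zero, Complex.ofReal_one, one_mul]

end sharpConstant

end NLKG

end

/-! ### Conclusion -/

theorem mainTheorem5 (d : ℕ) (hd : 3 ≤ d) (p γ ω : ℝ) (hp : p = 1 + 4 / (d : ℝ))
    (hγ : 0 < γ) (hω : |ω| < 1) :
    (NLKG.radialGroundStates d p γ ω).Nonempty ∧
    NLKG.radialGroundStates d p γ ω ⊆ NLKG.radialMinimizers d p γ ω d 2 ∧
    IsLeast (NLKG.constrainedActions d p γ ω d 2) (NLKG.minAction d p γ ω d 2) ∧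
    0 < NLKG.radialGNConst d p γ ∧
    IsLeast (NLKG.radialGNConstants d p γ) (NLKG.radialGNConst d p γ) ∧
    NLKG.minAction d p γ ω d 2 =
      (1 - ω ^ 2) / 2 *
        (((d : ℝ) + 2) / ((d : ℝ) * NLKG.radialGNConst d p γ)) ^ ((d : ℝ) / 2) ∧
    (∃ ψ ∈ NLKG.radialMinimizers d p γ ω d 2, NLKG.potentialPow p ψ = 1) ∧
    ∀ ψ ∈ NLKG.radialMinimizers d p γ ω d 2, NLKG.potentialPow p ψ = 1 →
      ∀ ν : ℝ, 0 < ν → ν ^ 2 = 1 / (((d : ℝ) + 2) * NLKG.minAction d p γ ω d 2) →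
        ∃ Q ∈ NLKG.radialGroundStates d p γ ω,
          ∀ x, ψ x = ((ν ^ ((d : ℝ) / 2) : ℝ) : ℂ) * Q (ν • x) := by
  have hd0 : 0 < d := by omega
  have hm : 0 < 1 - ω ^ 2 := by
    have := (sq_lt_one_iff_abs_lt_one ω).2 hω
    linarith
  obtain ⟨C, hC0, hCle, hCeq⟩ := NLKG.exists_sharp_gagliardoNirenberg hd hγ
  have hC : NLKG.IsSharpGN d γ C := ⟨hC0, hCle, hCeq⟩
  have hact := hC.isLeast_constrainedActions hd hp hm hγ
  have hGN := hC.isLeast_radialGNConstants hd hp hγ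
  have hr : NLKG.minAction d p γ ω d 2 = (1 - ω ^ 2) / 2 * NLKG.extremalMass d C := hact.csInf_eq
  have hCe : NLKG.radialGNConst d p γ = C := hGN.csInf_eq
  have hX := NLKG.extremalMass_pos hd0 hC0
  rw [hr, hCe]
  obtain ⟨ψ, hψ, hψM, hψT, hψV⟩ := hC.exists_extremal hd hγ
  have hψT' : NLKG.kineticSq γ ψ = d / ((d : ℝ) + 2) * NLKG.critPow ψ := by
    rw [hψT, hψV, mul_one]
  obtain ⟨Q, hQ, hQS, -⟩ := hC.exists_groundState hd hp hm hγ hψ hψM hψT hψV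
    (ν := Real.sqrt (1 / (((d : ℝ) + 2) * ((1 - ω ^ 2) / 2 * NLKG.extremalMass d C))))
    (Real.sqrt_pos.2 (by positivity)) (Real.sq_sqrt (by positivity))
  refine ⟨⟨Q, hQ⟩, fun u hu => ?_, hact, hC0, hGN, rfl, ⟨ψ, ⟨hψ, ?_, ?_⟩, ?_⟩, ?_⟩
  · have h1 := hC.le_action hd hp hm hγ hu.1.1 (hu.1.2.energy_eq hd hp hm hγ hu.1.1.1)
    -- A ground state has action at most that of Q, which is the lower bound for all radial critical
    -- points; equality then yields the virial constraint.
    have h2 := le_antisymm ((hu.2 Q hQ.1).trans_eq hQS) h1.1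
    exact ⟨hu.1.1, h2.trans hr.symm, (NLKG.virial_eq_zero_iff hd0 hp hu.1.1.1).2 (h1.2 h2)⟩
  · rw [NLKG.action_eq_of_virial hd0 hp hψT', hψM, hr]
  · exact (NLKG.virial_eq_zero_iff hd0 hp hψ.1).2 hψT'
  · rw [NLKG.potentialPow_eq hp, hψV]
  · rintro φ ⟨hφ, hφS, hφK⟩ hφV ν hν hν2
    rw [NLKG.potentialPow_eq hp] at hφV
    have hT := (NLKG.virial_eq_zero_iff hd0 hp hφ.1).1 hφK
    rw [NLKG.action_eq_of_virial hd0 hp hT, hr] at hφS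
    -- A minimizer with V = 1 has the same M, T and V as the normalized extremal, and the
    -- construction of the ground state uses nothing else about ψ.
    have hM := mul_left_cancel₀ (by positivity) hφS
    rw [hφV, mul_one] at hT
    obtain ⟨P, hP, -, hPφ⟩ := hC.exists_groundState hd hp hm hγ hφ hM hT hφV hν hν2
    exact ⟨P, hP, hPφ⟩
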